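/- Let $p$ be a prime, $G$ a profinite group, and $U$ a pro-unipotent group over $\mathbb{Q}_p$ with an action of $G$ by group-scheme automorphisms that is continuous on $U(\mathbb{Q}_p)$. Let $$\dots\subseteq W_{-3}U\subseteq W_{-2}U\subseteq W_{-1}U=U$$ be a $G$-stable filtration by closed subgroup-schemes with $[W_{-i}U,W_{-j}U]\subseteq W_{-i-j}U$ for all $i,j\ge 1$. Assume that it is separated, $\bigcap_n W_{-n}U=1$, and that every $W_{-n}U$ has finite codimension in $U$. For $n\ge 1$ let $V_n=W_{-n}U/W_{-n-1}U$, regarded as a finite-dimensional $\mathbb{Q}_p$-vector space with continuous $G$-action, and assume that $H^0(G,V_n)=0$ and that the continuous cohomology $H^1(G,V_n)$ is finite-dimensional, for all $n\ge 1$. A filtered $\mathbb{Q}_p$-algebra is a commutative $\mathbb{Q}_p$-algebra $\Lambda$ with subspaces $W_0\Lambda\subseteq W_1\Lambda\subseteq\cdots\subseteq\Lambda$ such that $1\in W_0\Lambda$ and $W_i\Lambda\cdot W_j\Lambda\subseteq W_{i+j}\Lambda$; a filtered affine scheme is the spectrum of such an algebra. The ring $\mathcal{O}(U)$ is filtered by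 transport of structure along $\log\colon U\cong\mathrm{Lie}(U)$ from the filtration on $\mathrm{Sym}^\bullet(\mathrm{Lie}(U)^\vee)$ generated by placing in degree $w$ the (continuous) linear functionals that vanish on $W_{-w-1}\mathrm{Lie}(U)$. For a filtered algebra $\Lambda$ let $U(\Lambda)$ be the group of filtered homomorphisms $\mathcal{O}(U)\to\Lambda$, with the topology induced from the direct limit topology of $\Lambda$ over its finite-dimensional $\mathbb{Q}_p$-subspaces. Let $H^1(G,U(\Lambda))$ be the pointed set of continuous cocycles $\xi\colon G\to U(\Lambda)$, $\xi(gh)=\xi(g)\cdot g(\xi(h))$, modulo the relation $\xi\sim\xi'$ if $\xi'(g)=u^{-1}\,\xi(g)\,g(u)$ for some $u\in U(\Lambda)$. Then the functor $\Lambda\mapsto H^1(G,U(\Lambda))$ from filtered $\mathbb{Q}_p$-algebras to pointed sets is representable by a pointed filtered affine $\mathbb{Q}_p$-scheme $X$. Moreover $X$ is isomorphic to a closed subscheme of $\prod_{n>0}H^1(G,V_n)$ with the induced filtration, where $H^1(G,V_n)$ is regarded as an affine space whose linear coordinates have filtration degree $n$ (that is, $\mathcal{O}(X)$ is a quotient of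 the affine ring of this product, with the image filtration). Consequently the Hilbert series satisfies $$\sum_{i\ge 0}\dim\bigl(\mathrm{gr}^W_i\mathcal{O}(X)\bigr)t^i\;\preceq\;\prod_{n>0}(1-t^n)^{-\dim_{\mathbb{Q}_p}H^1(G,V_n)},$$ where $\sum a_it^i\preceq\sum a_i't^i$ means $\sum_{i\le m}a_i\le\sum_{i\le m}a_i'$ for every $m\ge 0$. -/

import Mathlib

open CategoryTheory TensorProduct

universe u

noncomputable section

namespace WeightFiltration

/-! ### Filtered algebras and filtered affine schemes -/

section Subquotients

variable {k : Type*} [Field k] {M : Type*} [AddCommGroup M] [Module k M]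

/-- The subquotient `S / (S ∩ T)` of a vector space; for `T ≤ S` it is `S / T`. -/
def Subquotient (S T : Submodule k M) : Type _ := S ⧸ T.submoduleOf S

instance (S T : Submodule k M) : AddCommGroup (Subquotient S T) :=
  inferInstanceAs (AddCommGroup (S ⧸ T.submoduleOf S))

instance (S T : Submodule k M) : Module k (Subquotient S T) :=
  inferInstanceAs (Module k (S ⧸ T.submoduleOf S))

/-- The representation on the subquotient of a representation by stable subspaces. -/
def subquotientRep {G : Type*} [Group G] (σ : Representation k G M) (S T : Submodule k M)
    (hS : ∀ g, S ≤ S.comap (σ g)) (hT : ∀ g, T ≤ T.comap (σ g)) :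
    Representation k G (Subquotient S T) :=
  (σ.subrepresentation S hS).quotient (T.submoduleOf S) fun g _ hx => hT g hx

end Subquotients

section Filtrations

variable (k : Type*) [Field k]

/-- An increasing multiplicative filtration `W₀ ⊆ W₁ ⊆ ⋯` on a commutative `k`-algebra. -/
structure AlgFiltration (A : Type*) [CommRing A] [Algebra k A] where
  W : ℕ → Submodule k A
  mono : Monotone W
  one_mem : (1 : A) ∈ W 0
  mul_mem : ∀ {i j : ℕ} {x y : A}, x ∈ W i → y ∈ W j → x * y ∈ W (i + j)

variable {k}

theorem AlgFiltration.algebraMap_mem {A : Type*} [CommRing A] [Algebra k A]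
    (F : AlgFiltration k A) (i : ℕ) (c : k) : algebraMap k A c ∈ F.W i := by
  rw [Algebra.algebraMap_eq_smul_one]
  exact (F.W i).smul_mem c (F.mono (Nat.zero_le i) F.one_mem)

/-- The monomials `a₁ ⋯ aᵣ` with `aⱼ ∈ S wⱼ` and `w₁ + ⋯ + wᵣ ≤ i`. -/
def weightedMonomials {A : Type*} [CommRing A] (S : ℕ → Set A) (i : ℕ) : Set A :=
  {x | ∃ l : List (ℕ × A), (∀ q ∈ l, q.2 ∈ S q.1) ∧ (l.map Prod.fst).sum ≤ i ∧
    x = (l.map Prod.snd).prod}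

variable (k) in
/-- The finest filtration on `A` for which the elements of `S w` lie in filtration degree `w`:
its `i`-th step is spanned by the monomials in these elements of total weight at most `i`. -/
def AlgFiltration.generate {A : Type*} [CommRing A] [Algebra k A] (S : ℕ → Set A) :
    AlgFiltration k A where
  W i := Submodule.span k (weightedMonomials S i)
  mono i j hij := Submodule.span_mono fun _ ⟨l, h1, h2, h3⟩ => ⟨l, h1, h2.trans hij, h3⟩
  one_mem := Submodule.subset_span ⟨[], by simp, by simp, by simp⟩
  mul_mem {i j x y} hx hy := by
    have h := Submodule.mul_mem_mul hx hy
    rw [Submodule.span_mul_span] at h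
    refine Submodule.span_mono ?_ h
    rintro _ ⟨_, ⟨l, h1, h2, rfl⟩, _, ⟨l', h1', h2', rfl⟩, rfl⟩
    refine ⟨l ++ l', ?_, ?_, ?_⟩
    · intro q hq
      rcases List.mem_append.1 hq with h | h
      exacts [h1 q h, h1' q h]
    · simpa using Nat.add_le_add h2 h2'
    · simp

/-- An algebra homomorphism compatible with filtrations. -/
def IsFiltered {A B : Type*} [CommRing A] [Algebra k A] [CommRing B] [Algebra k B]
    (F : AlgFiltration k A) (F' : AlgFiltration k B) (f : A →ₐ[k] B) : Prop :=
  ∀ i, ∀ x ∈ F.W i, f x ∈ F'.W i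

variable (k) in
/-- The category of filtered commutative `k`-algebras, the opposite of the category of filtered
affine `k`-schemes. -/
structure FiltAlg where
  carrier : Type u
  [commRing : CommRing carrier]
  [algebra : Algebra k carrier]
  fil : AlgFiltration k carrier

instance : CoeSort (FiltAlg.{u} k) (Type u) := ⟨FiltAlg.carrier⟩

attribute [instance] FiltAlg.commRing FiltAlg.algebra

/-- A morphism of filtered algebras. -/
@[ext]
structure FiltAlg.Hom (A B : FiltAlg.{u} k) where
  toAlgHom : A →ₐ[k] B
  filtered : IsFiltered A.fil B.fil toAlgHom

instance : Category (FiltAlg.{u} k) where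
  Hom A B := FiltAlg.Hom A B
  id A := ⟨AlgHom.id k A, fun _ _ hx => hx⟩
  comp f g := ⟨g.toAlgHom.comp f.toAlgHom, fun i x hx => g.filtered i _ (f.filtered i x hx)⟩

variable (k) in
/-- A pointed filtered affine `k`-scheme: a filtered algebra `O(X)` and a `k`-point of `X`. The
point is a filtered morphism `Spec k → X` because every step of the filtration on `k` is `k`. -/
structure PointedFiltAffine where
  ring : FiltAlg.{u} k
  point : ring →ₐ[k] k

/-- The base point of `X(Λ)`. -/
def PointedFiltAffine.basePoint (X : PointedFiltAffine.{u} k) (Λ : FiltAlg.{u} k) :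
    X.ring ⟶ Λ :=
  ⟨(Algebra.ofId k Λ).comp X.point, fun i _ _ => Λ.fil.algebraMap_mem i _⟩

/-- The functor of points `Λ ↦ X(Λ) = Hom(O(X), Λ)` of a pointed filtered affine scheme. -/
def PointedFiltAffine.points (X : PointedFiltAffine.{u} k) : FiltAlg.{u} k ⥤ Pointed.{u} where
  obj Λ := ⟨X.ring ⟶ Λ, X.basePoint Λ⟩
  map f := ⟨fun x => x ≫ f, by
    apply FiltAlg.Hom.ext
    exact AlgHom.ext fun x => f.toAlgHom.commutes _⟩

/-- `Z` is, via the comorphism `φ`, a closed subscheme of `X` with the induced filtration. -/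
def IsClosedSubscheme {A B : Type*} [CommRing A] [Algebra k A] [CommRing B] [Algebra k B]
    (FX : AlgFiltration k A) (FZ : AlgFiltration k B) (φ : A →ₐ[k] B) : Prop :=
  Function.Surjective φ ∧ ∀ i, FZ.W i = (FX.W i).map φ.toLinearMap

/-! ### Hilbert series -/

/-- `W_{i-1}`, with the convention `W_{-1} = 0`. -/
def AlgFiltration.prev {A : Type*} [CommRing A] [Algebra k A] (F : AlgFiltration k A) :
    ℕ → Submodule k A
  | 0 => ⊥
  | i + 1 => F.W i

/-- The Hilbert series `∑ᵢ dim(gr_i A) tⁱ`, with coefficients in `ℕ ∪ {∞}`. -/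
def AlgFiltration.hilbertSeries {A : Type*} [CommRing A] [Algebra k A] (F : AlgFiltration k A) :
    PowerSeries ℕ∞ :=
  PowerSeries.mk fun i =>
    Cardinal.toENat (Module.rank k (Subquotient (F.W i) (F.prev i)))

/-- The relation `f ⪯ g` on power series: every partial sum of coefficients of `f` is at most the
corresponding partial sum for `g`. -/
def SeriesLE (f g : PowerSeries ℕ∞) : Prop :=
  ∀ n : ℕ, ∑ i ∈ Finset.range (n + 1), PowerSeries.coeff i f ≤
    ∑ i ∈ Finset.range (n + 1), PowerSeries.coeff i g

/-- `(1 - tⁿ)⁻¹ = 1 + tⁿ + t²ⁿ + ⋯` for `n > 0`. -/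
def geomSeries (n : ℕ) : PowerSeries ℕ∞ :=
  PowerSeries.mk fun i => if n ∣ i then 1 else 0

/-- The infinite product `∏_{n>0} (1 - tⁿ)^{-d n}`. The factors with `n > i` are congruent to `1`
modulo `t^{i+1}`, so that the coefficient of `tⁱ` is that of the product over `1 ≤ n ≤ i`. -/
def eulerProduct (d : ℕ → ℕ) : PowerSeries ℕ∞ :=
  PowerSeries.mk fun i => PowerSeries.coeff i (∏ n ∈ Finset.Icc 1 i, geomSeries n ^ d n)

/-! ### Products of vector groups -/

/-- The affine ring of the product `∏_{n>0} M n` of the affine spaces of finite-dimensional vector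
spaces `M n`, the symmetric algebra of `⨁_{n>0} (M n)^∨`. -/
abbrev ProdVectorRing (k : Type*) [Field k] (M : ℕ → Type*) [∀ n, AddCommGroup (M n)]
    [∀ n, Module k (M n)] : Type _ :=
  SymmetricAlgebra k (DirectSum ℕ+ fun n => Module.Dual k (M n))

/-- The filtration on `O(∏_{n>0} M n)` for which `M n` is placed in filtration degree `-n`, so that
its linear coordinates have weight `n`. -/
def prodVectorFiltration (k : Type*) [Field k] (M : ℕ → Type*) [∀ n, AddCommGroup (M n)]
    [∀ n, Module k (M n)] : AlgFiltration k (ProdVectorRing k M) :=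
  AlgFiltration.generate k fun w =>
    {x | ∃ (n : ℕ+) (l : Module.Dual k (M n)), w = n ∧
      x = SymmetricAlgebra.ι k _ (DirectSum.lof k ℕ+ (fun n : ℕ+ => Module.Dual k (M n)) n l)}

end Filtrations

/-! ### Pro-unipotent groups and their filtrations

An affine group scheme `U` over `k` is given by its commutative Hopf algebra `A = O(U)`. The group
`U(Λ)` is `WithConv (A →ₐ[k] Λ)`, the algebra homomorphisms with the convolution product. -/

section Prounipotent

variable (k : Type*) [Field k] (A : Type u) [CommRing A] [HopfAlgebra k A]

/-- `U` is pro-unipotent (an inverse limit of unipotent algebraic groups): every regular function on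
`U` is a matrix coefficient of a representation of `U` by upper unitriangular matrices. -/
def IsProunipotent : Prop :=
  ∀ a : A, ∃ (n : ℕ) (c : Matrix (Fin n) (Fin n) A),
    (∀ i, c i i = 1) ∧ (∀ i j, j < i → c i j = 0) ∧
    (∀ i j, Coalgebra.counit (R := k) (c i j) = if i = j then 1 else 0) ∧
    (∀ i j, Coalgebra.comul (R := k) (c i j) = ∑ l, c i l ⊗ₜ[k] c l j) ∧
    a ∈ Submodule.span k (Set.range fun ij : Fin n × Fin n => c ij.1 ij.2)

variable {k A} in
/-- The inverse of a point of `U(Λ)`. -/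
def pointInv {Λ : Type*} [CommRing Λ] [Algebra k Λ] (x : WithConv (A →ₐ[k] Λ)) :
    WithConv (A →ₐ[k] Λ) :=
  WithConv.toConv (x.ofConv.comp (HopfAlgebra.antipodeAlgHom k A))

variable {k A} in
theorem pointInv_mul {Λ : Type*} [CommRing Λ] [Algebra k Λ] (x : WithConv (A →ₐ[k] Λ)) :
    pointInv x * x = 1 := by
  have h := AlgHom.comp_convMul_distrib x.ofConv
    (WithConv.toConv (HopfAlgebra.antipodeAlgHom k A)) (WithConv.toConv (AlgHom.id k A))
  rw [AlgHom.antipode_id_cancel] at h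
  apply WithConv.ofConv_injective
  refine Eq.trans ?_ (h.symm.trans ?_)
  · rfl
  · refine AlgHom.ext fun a => ?_
    simp [AlgHom.convOne_def]

/-- A filtration `⋯ ⊆ W_{-2}U ⊆ W_{-1}U = U` by closed subgroup schemes with
`[W_{-i}U, W_{-j}U] ⊆ W_{-i-j}U`. The ideal `J n` cuts out `W_{-n}U`; `J 0 = ⊥` corresponds to the
convention `W_0 U = U`. -/
structure GroupFiltration where
  J : ℕ → Ideal A
  hopf : ∀ n, (J n).IsHopfIdeal k
  mono : Monotone J
  J_one : J 1 = ⊥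
  commutator : ∀ i j : ℕ, 1 ≤ i → 1 ≤ j → ∀ (Λ : Type u) [CommRing Λ] [Algebra k Λ]
    (x y : WithConv (A →ₐ[k] Λ)), (∀ a ∈ J i, x a = 0) → (∀ a ∈ J j, y a = 0) →
      ∀ a ∈ J (i + j), (x * y * pointInv x * pointInv y) a = 0

variable {k A}

/-- The filtration is separated: `⋂ W_{-n}U = 1`. -/
def GroupFiltration.IsSeparated (F : GroupFiltration k A) : Prop :=
  ⨆ n, F.J n = RingHom.ker (Bialgebra.counitAlgHom k A)

variable (k A) in
/-- For a regular function `a`, the function `u ↦ a(log u)` on `U`, where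
`log u = ∑_{m ≥ 1} (-1)^{m-1} (u - 1)^m / m` in the convolution algebra (a locally finite sum if `U`
is pro-unipotent). It is the composite of `log : U → Lie(U)` with the linear function on `Lie(U)`
given by the class of `a` in the cotangent space. -/
def compLog (a : A) : A :=
  ∑ᶠ m : ℕ, ((-1 : k) ^ m / ((m : k) + 1)) •
    ((WithConv.toConv (LinearMap.id : A →ₗ[k] A) - 1) ^ (m + 1)) a

/-- The filtration on `O(U)`, obtained by transport along `log : U ≅ Lie(U)` from
`O(Lie(U)) = Sym(Lie(U)^∨)`: a linear function on `Lie(U)` has weight `w` if it vanishes on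
`W_{-w-1} Lie(U)`, that is, if it is the class of an element of `J (w + 1)`. -/
def GroupFiltration.algFiltration (F : GroupFiltration k A) : AlgFiltration k A :=
  AlgFiltration.generate k fun w => compLog k A '' (F.J (w + 1) : Set A)

/-- `W_{-n} Lie(U)`, inside the linear dual of `A`: the derivations at the identity that vanish on
the ideal of `W_{-n}U`. For `n = 0` this is `Lie(U)`. -/
def GroupFiltration.lie (F : GroupFiltration k A) (n : ℕ) : Submodule k (Module.Dual k A) where
  carrier := {D | (∀ a b : A, D (a * b) =
      Coalgebra.counit (R := k) a * D b + Coalgebra.counit (R := k) b * D a) ∧ ∀ a ∈ F.J n, D a = 0}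
  add_mem' {D E} hD hE := by
    refine ⟨fun a b => ?_, fun a ha => ?_⟩
    · simp only [LinearMap.add_apply, hD.1, hE.1]; ring
    · simp [hD.2 a ha, hE.2 a ha]
  zero_mem' := by simp
  smul_mem' c D hD := by
    refine ⟨fun a b => ?_, fun a ha => ?_⟩
    · simp only [LinearMap.smul_apply, smul_eq_mul, hD.1]; ring
    · simp [hD.2 a ha]

/-- Every `W_{-n}U` has finite codimension in `U`. -/
def GroupFiltration.FiniteCodim (F : GroupFiltration k A) : Prop :=
  ∀ n, FiniteDimensional k (Subquotient (F.lie 0) (F.lie n))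

/-- The vector space `V_n = W_{-n}U / W_{-n-1}U` (a vector group is identified with its Lie
algebra). -/
abbrev GroupFiltration.V (F : GroupFiltration k A) (n : ℕ) : Type _ :=
  Subquotient (F.lie n) (F.lie (n + 1))

end Prounipotent

/-! ### Group actions and cohomology -/

section Cohomology

variable {k : Type*} [Field k] {A : Type u} [CommRing A] [HopfAlgebra k A]
  {G : Type u} [Group G]

/-- An action of `G` on the group scheme `U` is a homomorphism `ρ : G → End(O(U))`, where `ρ g` is
composition with the action of `g⁻¹` on `U`. So `g` sends `x ∈ U(Λ)` to `x ∘ ρ(g⁻¹)`. -/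
def actPoint (ρ : G →* (A →ₐc[k] A)) {Λ : Type*} [CommRing Λ] [Algebra k Λ] (g : G)
    (x : WithConv (A →ₐ[k] Λ)) : WithConv (A →ₐ[k] Λ) :=
  WithConv.toConv (x.ofConv.comp (ρ g⁻¹ : A →ₐ[k] A))

/-- The filtration is `G`-stable. -/
def GroupFiltration.IsStable (F : GroupFiltration k A) (ρ : G →* (A →ₐc[k] A)) : Prop :=
  ∀ g n, ∀ a ∈ F.J n, ρ g a ∈ F.J n

/-- The action of `G` on the linear dual of `O(U)`. -/
def dualRep (ρ : G →* (A →ₐc[k] A)) : Representation k G (Module.Dual k A) where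
  toFun g :=
    { toFun := fun D => D.comp (ρ g⁻¹ : A →ₗ[k] A)
      map_add' := fun _ _ => rfl
      map_smul' := fun _ _ => rfl }
  map_one' := by ext D a; simp
  map_mul' g h := by ext D a; simp

theorem GroupFiltration.lie_le_comap (F : GroupFiltration k A) {ρ : G →* (A →ₐc[k] A)}
    (hF : F.IsStable ρ) (n : ℕ) (g : G) : F.lie n ≤ (F.lie n).comap (dualRep ρ g) := by
  rintro D ⟨h1, h2⟩
  refine ⟨fun a b => ?_, fun a ha => h2 _ (hF _ _ a ha)⟩
  have := h1 (ρ g⁻¹ a) (ρ g⁻¹ b)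
  rw [← map_mul] at this
  simpa [dualRep] using this

/-- The action of `G` on `V_n`. -/
def GroupFiltration.rep (F : GroupFiltration k A) {ρ : G →* (A →ₐc[k] A)}
    (hF : F.IsStable ρ) (n : ℕ) : Representation k G (F.V n) :=
  subquotientRep (dualRep ρ) (F.lie n) (F.lie (n + 1)) (F.lie_le_comap hF n)
    (F.lie_le_comap hF (n + 1))

/-- The topology on `U(Λ)` induced by a topology on `Λ`: the coarsest one for which all regular
functions `U(Λ) → Λ` are continuous. -/
@[reducible] def pointTopology (A Λ : Type*) [CommRing A] [Algebra k A] [CommRing Λ] [Algebra k Λ]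
    (t : TopologicalSpace Λ) : TopologicalSpace (WithConv (A →ₐ[k] Λ)) :=
  TopologicalSpace.induced (fun x (a : A) => x a) (@Pi.topologicalSpace A (fun _ => Λ) fun _ => t)

theorem continuous_point_iff {X A Λ : Type*} [TopologicalSpace X] [CommRing A] [Algebra k A]
    [CommRing Λ] [Algebra k Λ] (t : TopologicalSpace Λ) (f : X → WithConv (A →ₐ[k] Λ)) :
    @Continuous _ _ _ (pointTopology A Λ t) f ↔ ∀ a, Continuous fun x => f x a := by
  unfold pointTopology
  rw [continuous_induced_rng, continuous_pi_iff]
  rfl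

variable [TopologicalSpace k] [TopologicalSpace G]

/-- Continuous 1-cocycles with values in a representation on a finite-dimensional vector space `V`
with its canonical topology. -/
def contZ1 [ContinuousAdd k] [ContinuousMul k] {V : Type*} [AddCommGroup V] [Module k V]
    (σ : Representation k G V) : Submodule k (G → V) where
  carrier := {c | @Continuous G V _ (moduleTopology k V) c ∧ ∀ g h, c (g * h) = c g + σ g (c h)}
  add_mem' {c d} hc hd := by
    let _ := moduleTopology k V
    have _ : IsModuleTopology k V := ⟨rfl⟩
    have _ := IsModuleTopology.toContinuousAdd k V
    refine ⟨hc.1.add hd.1, fun g h => ?_⟩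
    simp only [Pi.add_apply, hc.2, hd.2, map_add]
    abel
  zero_mem' := ⟨@continuous_const G V _ (moduleTopology k V) 0, by simp⟩
  smul_mem' r c hc := by
    let _ := moduleTopology k V
    have _ : IsModuleTopology k V := ⟨rfl⟩
    have _ := IsModuleTopology.toContinuousSMul k V
    refine ⟨hc.1.const_smul r, fun g h => ?_⟩
    simp [hc.2]

/-- The 1-coboundaries `g ↦ g v - v`. -/
def coboundaries {V : Type*} [AddCommGroup V] [Module k V] (σ : Representation k G V) :
    Submodule k (G → V) :=
  LinearMap.range (LinearMap.pi fun g => σ g - LinearMap.id)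

/-- Continuous cohomology `H¹(G, V)` of a representation on a finite-dimensional vector space. -/
abbrev ContH1 [ContinuousAdd k] [ContinuousMul k] {V : Type*} [AddCommGroup V] [Module k V]
    (σ : Representation k G V) : Type _ :=
  Subquotient (contZ1 σ) (coboundaries σ)

/-- The direct limit topology on a vector space over its finite-dimensional subspaces, each with its
canonical topology. -/
@[reducible] def finiteTopology (k : Type*) [Field k] [TopologicalSpace k] (Λ : Type*) [AddCommGroup Λ]
    [Module k Λ] : TopologicalSpace Λ :=
  ⨆ S : {S : Submodule k Λ // FiniteDimensional k S},
    (moduleTopology k S.1).coinduced (Subtype.val : S.1 → Λ)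

/-- The action of `G` on `U` is continuous: `G × U(k) → U(k)` is continuous. -/
def IsContinuousAction (ρ : G →* (A →ₐc[k] A)) : Prop :=
  let _ : TopologicalSpace (WithConv (A →ₐ[k] k)) := pointTopology A k inferInstance
  Continuous fun q : G × WithConv (A →ₐ[k] k) => actPoint ρ q.1 q.2

/-- Continuous 1-cocycles `ξ : G → U(Λ)`, where `U(Λ)` is the set of filtered `Λ`-points of `U`, with
the subspace topology from the set of all `Λ`-points. -/
@[ext]
structure Cocycle (ρ : G →* (A →ₐc[k] A)) (W : AlgFiltration k A) (Λ : FiltAlg.{u} k) where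
  toFun : G → WithConv (A →ₐ[k] Λ)
  filtered : ∀ g, IsFiltered W Λ.fil (toFun g).ofConv
  continuous : @Continuous G _ _ (pointTopology A Λ (finiteTopology k Λ)) toFun
  map_mul : ∀ g h, toFun (g * h) = toFun g * actPoint ρ g (toFun h)

/-- `ξ' = u⁻¹ · ξ · g(u)` for some `u ∈ U(Λ)`. -/
def Cohomologous {ρ : G →* (A →ₐc[k] A)} {W : AlgFiltration k A} {Λ : FiltAlg.{u} k}
    (ξ ξ' : Cocycle ρ W Λ) : Prop :=
  ∃ u : WithConv (A →ₐ[k] Λ), IsFiltered W Λ.fil u.ofConv ∧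
    ∀ g, ξ'.toFun g = pointInv u * ξ.toFun g * actPoint ρ g u

/-- The trivial cocycle. -/
def trivialCocycle (ρ : G →* (A →ₐc[k] A)) (W : AlgFiltration k A) (Λ : FiltAlg.{u} k) :
    Cocycle ρ W Λ where
  toFun _ := 1
  filtered _ i _ _ := Λ.fil.algebraMap_mem i _
  continuous := @continuous_const _ _ _ (pointTopology A Λ (finiteTopology k Λ)) _
  map_mul g h := by
    rw [one_mul]
    apply WithConv.ofConv_injective
    refine AlgHom.ext fun a => ?_
    simp [actPoint, AlgHom.convOne_def]

theorem continuous_finiteTopology {Λ Λ' : Type*} [AddCommGroup Λ] [Module k Λ]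
    [AddCommGroup Λ'] [Module k Λ'] (f : Λ →ₗ[k] Λ') :
    @Continuous _ _ (finiteTopology k Λ) (finiteTopology k Λ') f := by
  unfold finiteTopology
  rw [continuous_iSup_dom]
  rintro ⟨S, hS⟩
  rw [continuous_coinduced_dom]
  let T : {S : Submodule k Λ' // FiniteDimensional k S} := ⟨S.map f, inferInstance⟩
  refine continuous_iSup_rng (i := T) ?_
  let fS : S →ₗ[k] S.map f := f.submoduleMap S
  let _ := moduleTopology k S
  let _ : TopologicalSpace (S.map f) := moduleTopology k (S.map f)
  have _ : IsModuleTopology k S := ⟨rfl⟩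
  have _ : IsModuleTopology k (S.map f) := ⟨rfl⟩
  have _ := IsModuleTopology.toContinuousAdd k (S.map f)
  have _ := IsModuleTopology.toContinuousSMul k (S.map f)
  have h : Continuous fS := IsModuleTopology.continuous_of_linearMap fS
  let _ : TopologicalSpace Λ' :=
    TopologicalSpace.coinduced (Subtype.val : S.map f → Λ') inferInstance
  have h' : Continuous (Subtype.val : S.map f → Λ') := continuous_coinduced_rng
  exact h'.comp h

/-- Functoriality of cocycles in `Λ`. -/
def Cocycle.map {ρ : G →* (A →ₐc[k] A)} {W : AlgFiltration k A} {Λ Λ' : FiltAlg.{u} k}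
    (f : Λ ⟶ Λ') (ξ : Cocycle ρ W Λ) : Cocycle ρ W Λ' where
  toFun g := WithConv.toConv (f.toAlgHom.comp (ξ.toFun g).ofConv)
  filtered g i x hx := f.filtered i _ (ξ.filtered g i x hx)
  continuous := by
    rw [continuous_point_iff]
    intro a
    exact @Continuous.comp _ _ _ _ (finiteTopology k Λ) (finiteTopology k Λ') _ _
      (continuous_finiteTopology f.toAlgHom.toLinearMap)
      ((continuous_point_iff _ _).1 ξ.continuous a)
  map_mul g h := by
    rw [ξ.map_mul, AlgHom.comp_convMul_distrib]
    rfl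

theorem Cohomologous.map {ρ : G →* (A →ₐc[k] A)} {W : AlgFiltration k A} {Λ Λ' : FiltAlg.{u} k}
    (f : Λ ⟶ Λ') {ξ ξ' : Cocycle ρ W Λ} (h : Cohomologous ξ ξ') :
    Cohomologous (ξ.map f) (ξ'.map f) := by
  obtain ⟨x, hx, h⟩ := h
  refine ⟨WithConv.toConv (f.toAlgHom.comp x.ofConv), fun i a ha => f.filtered i _ (hx i a ha),
    fun g => ?_⟩
  change WithConv.toConv (f.toAlgHom.comp (ξ'.toFun g).ofConv) = _
  rw [h, AlgHom.comp_convMul_distrib, AlgHom.comp_convMul_distrib]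
  rfl

/-- The non-abelian continuous cohomology functor `Λ ↦ H¹(G, U(Λ))` from filtered algebras to pointed
sets: continuous cocycles modulo the relation of being cohomologous. (As `U(Λ)` is a `G`-stable
subgroup of the group of all `Λ`-points, this relation is an equivalence relation.) -/
def nonabelianH1 (ρ : G →* (A →ₐc[k] A)) (W : AlgFiltration k A) :
    FiltAlg.{u} k ⥤ Pointed.{u} where
  obj Λ := ⟨Quot (Cohomologous (ρ := ρ) (W := W) (Λ := Λ)), Quot.mk _ (trivialCocycle ρ W Λ)⟩
  map f := ⟨Quot.map (Cocycle.map f) fun _ _ h => h.map f, by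
    refine congrArg (Quot.mk _) (Cocycle.ext (funext fun g => ?_))
    apply WithConv.ofConv_injective
    exact AlgHom.ext fun a => f.toAlgHom.commutes _⟩
  map_id Λ := by
    apply Pointed.Hom.ext
    funext x
    induction x using Quot.ind
    rfl
  map_comp f g := by
    apply Pointed.Hom.ext
    funext x
    induction x using Quot.ind
    rfl

end Cohomology

end WeightFiltration

end

/-!
The proof replaces the group `U` by coordinates, and cocycles with values in `U(Λ)` by families of
`Λ`-valued functions on `G`, one for each coordinate, which are analysed weight by weight.

*Coordinates on `U`.* The cotangent space of `U` at the identity has a basis adapted to the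
filtration, the classes of functions `β i`; composing with the logarithm gives functions
`x i = compLog (β i)` of weight `i.1` on `U` (`IsProunipotent.nonempty_logCoordinates`). The coordinate
ring is generated by logarithms, because an entry of a unitriangular matrix representation is, up to
a scalar, the sum of its logarithm and a polynomial in entries closer to the diagonal
(`IsProunipotent.mem_of_forall_compLog_mem`), and the `x i` are algebraically independent, so that a
point is an arbitrary family of values (`LogCoordinates.exists_point`). The key estimate is
`IsProunipotent.convProd_compLog_eq_zero`: a product of elements of `Lie(U)` of total weight greater
than `n` pairs trivially with the coordinates of weight `n`. Reordering the factors only changes the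
product by shorter products of at least the same weight, since the filtration of `Lie(U)` is
compatible with brackets; and a product of `r ≥ 2` factors in arbitrary order is multiplied by
`2 ^ r` under the squaring map of `U`, while a logarithm is multiplied by `2`. Together with
`weight_le_of_iterDerivation_eq_zero`, which reads off weights of polynomials from derivatives at
the identity, this shows that the group law is addition plus a polynomial of bounded weight in
coordinates of smaller weight (`LogCoordinates.exists_groupLaw`), and that filtered points are the
families with `c i ∈ W_{i.1} Λ` (`LogCoordinates.isFiltered_iff`). The group `G` acts linearly, and
on the coordinates of weight `n` through its action on `V_n` (`LogCoordinates.exists_levelEquiv`).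

*Coefficients.* As `G` is compact, a continuous map from `G` to the direct limit of the
finite-dimensional subspaces of `Λ` is a finite sum of continuous scalar functions times elements of
`Λ` (`mem_tensorFunctions_of_continuous`). Linear operators on scalar functions therefore extend to
`Λ`-valued functions, functorially in `Λ` and preserving filtrations (`extend`,
`isExtension_extend`).

*Normal forms.* Since `H⁰(G, V_n) = 0`, the differential from `V_n` to the 1-cochains has a left
inverse, and a 1-cochain is called normalized if this left inverse kills it. On normalized cochains
the kernel of the next differential is `H¹(G, V_n)`, and the differential can be inverted modulo
this kernel (`CohomologySplitting`, `LogCoordinates.nonempty_splitting`). In the component of weight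
`n`, a change of a cocycle by `u` is the linear change by the coboundary of the component of `u`, up
to terms of smaller weight; hence by recursion on the weight every class in `H¹(G, U(Λ))` contains
exactly one normalized cocycle (`LogCoordinates.exists_normalized`,
`LogCoordinates.eq_of_normalized`). Its component of weight `n` is determined by the components of
smaller weight and an element of `H¹(G, V_n) ⊗ W_n Λ`, which gives a map `LogCoordinates.cochain`
from points of the affine space `∏ H¹(G, V_n)` to normalized cochains. It is compatible with all
homomorphisms of algebras (`LogCoordinates.map_cochain`), injective, and all normalized cocycles are
in its image (`LogCoordinates.exists_eq_cochain`).

*Conclusion.* The points of the affine space whose cochain is a cocycle are those of a closed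
subscheme (`LogCoordinates.cocycleIdeal`), which represents the functor
(`LogCoordinates.exists_representing`). Its graded ring is spanned in degree `i` by the monomials of
weight `i` in the linear coordinates, whose number is the coefficient of `t ^ i` in the product
(`hilbertSeries_le`).
-/

noncomputable section

namespace WeightFiltration

/-! ### The logarithm on a pro-unipotent group -/

section Log

variable {k : Type*} [Field k] {A : Type u} [CommRing A] [HopfAlgebra k A]

variable (k A) in
/-- The element `id - 1` of the convolution algebra of `k`-linear endomorphisms of `A`. -/
def idSubOne : WithConv (A →ₗ[k] A) := WithConv.toConv LinearMap.id - 1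

/-- A convolution product of linear maps applied entrywise to a multiplicative matrix is the
product of matrices. -/
theorem convMul_matrix_apply {B : Type*} [CommRing B] [Algebra k B] {n : ℕ}
    {c : Matrix (Fin n) (Fin n) A}
    (hc : ∀ i j, Coalgebra.comul (R := k) (c i j) = ∑ l, c i l ⊗ₜ[k] c l j)
    (f g : WithConv (A →ₗ[k] B)) : c.map (f * g) = c.map f * c.map g := by
  ext i j
  simp [Matrix.mul_apply, hc]

/-- On a unipotent matrix `c` of matrix coefficients, the convolution powers of `id - 1` are the
powers of the nilpotent matrix `c - 1`. -/
theorem idSubOne_pow_matrix {n : ℕ} {c : Matrix (Fin n) (Fin n) A}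
    (hε : ∀ i j, Coalgebra.counit (R := k) (c i j) = if i = j then 1 else 0)
    (hc : ∀ i j, Coalgebra.comul (R := k) (c i j) = ∑ l, c i l ⊗ₜ[k] c l j) (m : ℕ) :
    c.map ((idSubOne k A) ^ m) = (c - 1) ^ m := by
  induction m with
  | zero =>
    ext i j
    rw [pow_zero, pow_zero, Matrix.map_apply, LinearMap.convOne_apply, hε, Matrix.one_apply]
    split_ifs <;> simp
  | succ m ih =>
    rw [pow_succ, pow_succ, convMul_matrix_apply hc, ih]
    congr 1
    ext i j
    simp only [idSubOne, Matrix.map_apply, Matrix.sub_apply, Matrix.one_apply, WithConv.ofConv_sub,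
      LinearMap.sub_apply]
    rw [LinearMap.convOne_apply, hε]
    split_ifs <;> simp

/-- `id - 1` is locally nilpotent for convolution on the coordinate ring of a pro-unipotent group.
-/
theorem IsProunipotent.exists_idSubOne_pow_eq_zero (hA : IsProunipotent k A) (a : A) :
    ∃ M : ℕ, ∀ m, M ≤ m → ((idSubOne k A) ^ m) a = 0 := by
  obtain ⟨n, c, h1, h2, h3, h4, ha⟩ := hA a
  refine ⟨n, fun m hm => ?_⟩
  have hz : (c - 1) ^ m = 0 := by
    have hnil : (c - 1) ^ n = 0 := by
      have ht : (c - 1).BlockTriangular id := by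
        intro i j hij
        simp only [id] at hij
        simp [h2 i j hij, hij.ne']
      have := Matrix.aeval_self_charpoly (c - 1)
      rw [Matrix.charpoly_of_isUpperTriangular _ ht] at this
      simpa [h1] using this
    rw [← Nat.sub_add_cancel hm, pow_add, hnil, mul_zero]
  induction ha using Submodule.span_induction with
  | mem x hx =>
    obtain ⟨ij, rfl⟩ := hx
    have := congrFun (congrFun (idSubOne_pow_matrix (k := k) h3 h4 m) ij.1) ij.2
    rw [hz] at this
    exact this
  | zero => exact map_zero _
  | add x y _ _ hx hy => exact (map_add ((idSubOne k A ^ m).ofConv) x y).trans (by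
      rw [hx, hy, add_zero])
  | smul r x _ hx => exact (map_smul ((idSubOne k A ^ m).ofConv) r x).trans (by
      rw [hx, smul_zero])

theorem compLog_eq_sum {a : A} {M : ℕ} (hM : ∀ m, M ≤ m → ((idSubOne k A) ^ m) a = 0) :
    compLog k A a =
      ∑ m ∈ Finset.range M, ((-1 : k) ^ m / ((m : k) + 1)) • ((idSubOne k A) ^ (m + 1)) a := by
  refine finsum_eq_sum_of_support_subset _ fun m hm => ?_
  by_contra h
  refine hm ?_
  simp only [Finset.coe_range, Set.mem_Iio, not_lt] at h
  change _ • ((idSubOne k A) ^ (m + 1)) a = 0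
  rw [hM _ (by omega), smul_zero]

end Log

/-! ### Adams operations -/

theorem descPochhammer_coeff_zero_succ (R : Type*) [CommRing R] (j : ℕ) :
    (descPochhammer R (j + 1)).coeff 0 = 0 := by
  rw [descPochhammer_succ_left, Polynomial.coeff_zero_eq_eval_zero]
  simp

theorem descPochhammer_coeff_one_succ (R : Type*) [CommRing R] (j : ℕ) :
    (descPochhammer R (j + 1)).coeff 1 = (-1) ^ j * (j.factorial : R) := by
  induction j with
  | zero => simp
  | succ j ih =>
    rw [descPochhammer_succ_right, mul_sub, Polynomial.coeff_sub, Polynomial.coeff_mul_X,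
      descPochhammer_coeff_zero_succ]
    have : ((j + 1 : ℕ) : Polynomial R) = Polynomial.C ((j + 1 : ℕ) : R) := by simp
    rw [this, Polynomial.coeff_mul_C, ih, Nat.factorial_succ]
    push_cast
    ring

section Adams

variable {k : Type*} [Field k] {A : Type u} [CommRing A] [HopfAlgebra k A]

variable (k A) in
/-- The convolution power `idⁿ` as an algebra homomorphism, that is, the Adams operation
`u ↦ uⁿ` on the coordinate ring. -/
def adams (n : ℕ) : A →ₐ[k] A :=
  ((WithConv.toConv (AlgHom.id k A)) ^ n).ofConv

theorem adams_apply (n : ℕ) (a : A) :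
    adams k A n a = ((WithConv.toConv (LinearMap.id : A →ₗ[k] A)) ^ n) a := by
  have h := AlgHom.toLinearMap_convPow (WithConv.toConv (AlgHom.id k A)) n
  exact congrArg (fun f : WithConv (A →ₗ[k] A) => f a) h

theorem adams_adams (m n : ℕ) (a : A) : adams k A m (adams k A n a) = adams k A (m * n) a := by
  have h : ∀ n, (adams k A m).comp (adams k A n) = adams k A (m * n) := by
    intro n
    induction n with
    | zero =>
      refine AlgHom.ext fun a => ?_
      simp [adams]
    | succ n ih =>
      have h1 : adams k A (n + 1) =
          (WithConv.toConv (adams k A n) * WithConv.toConv (AlgHom.id k A)).ofConv := by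
        simp [adams, pow_succ]
      rw [h1, AlgHom.comp_convMul_distrib]
      simp only [ih]
      simp [adams, mul_add, pow_add]
  exact congrArg (fun f : A →ₐ[k] A => f a) (h n)

end Adams

section Log

variable {k : Type*} [Field k] [CharZero k] {A : Type u} [CommRing A] [HopfAlgebra k A]

/-- A polynomial with coefficients in an algebra over a field of characteristic zero is determined
by its values at the natural numbers. -/
theorem polynomial_eq_of_eval_natCast {B : Type*} [CommRing B] [Algebra k B]
    {P Q : Polynomial B} (h : ∀ n : ℕ, P.eval (n : B) = Q.eval (n : B)) : P = Q := by
  rw [← sub_eq_zero]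
  set R := P - Q with hR
  have hz : ∀ n : ℕ, R.eval (n : B) = 0 := fun n => by simp [hR, h]
  ext i
  rw [Polynomial.coeff_zero]
  by_contra hne
  obtain ⟨θ, hθ⟩ : ∃ θ : B →ₗ[k] k, θ (R.coeff i) ≠ 0 := by
    by_contra! hall
    exact hne ((Module.forall_dual_apply_eq_zero_iff k _).1 hall)
  -- apply a linear form to the coefficients to reduce to polynomials over `k`
  let S : Polynomial k := ∑ j ∈ Finset.range (R.natDegree + 1),
    Polynomial.monomial j (θ (R.coeff j))
  have hS : S = 0 := by
    refine Polynomial.eq_zero_of_infinite_isRoot S (Set.Infinite.mono ?_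
      (Set.infinite_range_of_injective (Nat.cast_injective (R := k))))
    rintro _ ⟨n, rfl⟩
    have h1 := congrArg θ (hz n)
    rw [Polynomial.eval_eq_sum_range, map_sum, map_zero] at h1
    simp only [Set.mem_ofPred_eq, Polynomial.IsRoot, S, Polynomial.eval_finsetSum,
      Polynomial.eval_monomial]
    rw [← h1]
    refine Finset.sum_congr rfl fun j _ => ?_
    rw [← Nat.cast_pow, ← Nat.cast_pow, ← nsmul_eq_mul', ← nsmul_eq_mul', map_nsmul]
  have h2 : S.coeff i = θ (R.coeff i) := by
    simp only [S, Polynomial.finsetSum_coeff, Polynomial.coeff_monomial]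
    rw [Finset.sum_ite_eq']
    split_ifs with hi
    · rfl
    · rw [Polynomial.coeff_eq_zero_of_natDegree_lt (by simpa using hi), map_zero]
  rw [hS, Polynomial.coeff_zero] at h2
  exact hθ h2.symm

/-- The convolution powers `idⁿ` applied to a fixed function `a` are the values at `n` of a
polynomial whose linear coefficient is `compLog a`. -/
theorem IsProunipotent.exists_adamsPolynomial (hA : IsProunipotent k A) (a : A) :
    ∃ P : Polynomial A,
      (∀ n : ℕ, P.eval (n : A) = ((WithConv.toConv (LinearMap.id : A →ₗ[k] A)) ^ n) a) ∧
      P.coeff 0 = algebraMap k A (Coalgebra.counit a) ∧ P.coeff 1 = compLog k A a := by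
  obtain ⟨M, hM⟩ := hA.exists_idSubOne_pow_eq_zero a
  have hM' : ∀ m, M ≤ m → ((idSubOne k A) ^ m) a = 0 := hM
  let P : Polynomial A := ∑ j ∈ Finset.range (M + 1),
    Polynomial.C (((j.factorial : k)⁻¹) • ((idSubOne k A) ^ j) a) * descPochhammer A j
  refine ⟨P, fun n => ?_, ?_, ?_⟩
  · have hid : (WithConv.toConv (LinearMap.id : A →ₗ[k] A)) = idSubOne k A + 1 := by
      simp [idSubOne]
    have hpow : ((WithConv.toConv (LinearMap.id : A →ₗ[k] A)) ^ n) a =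
        ∑ j ∈ Finset.range (n + 1), (n.choose j : k) • ((idSubOne k A) ^ j) a := by
      rw [hid, (Commute.one_right _).add_pow]
      simp only [one_pow, mul_one, WithConv.ofConv_sum, LinearMap.sum_apply]
      refine Finset.sum_congr rfl fun j _ => ?_
      rw [← nsmul_eq_mul', Nat.cast_smul_eq_nsmul]
      rfl
    rw [hpow]
    simp only [P, Polynomial.eval_finsetSum, Polynomial.eval_mul, Polynomial.eval_C,
      descPochhammer_eval_eq_descFactorial]
    have key : ∀ j, (((j.factorial : k)⁻¹) • ((idSubOne k A) ^ j) a) * ((n.descFactorial j : ℕ) : A) =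
        (n.choose j : k) • ((idSubOne k A) ^ j) a := by
      intro j
      rw [Nat.descFactorial_eq_factorial_mul_choose, ← nsmul_eq_mul', ← Nat.cast_smul_eq_nsmul k,
        smul_smul]
      congr 1
      have : (j.factorial : k) ≠ 0 := by exact_mod_cast j.factorial_ne_zero
      push_cast
      field_simp
    simp only [key]
    rcases le_total M n with h | h
    · refine Finset.sum_subset (Finset.range_mono (by omega)) fun j _ hj => ?_
      rw [hM _ (by simpa using (by simpa using hj : M + 1 ≤ j) |>.trans' (by omega)), smul_zero]
    · refine (Finset.sum_subset (Finset.range_mono (by omega)) fun j _ hj => ?_).symm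
      rw [Nat.choose_eq_zero_of_lt (by simpa using hj), Nat.cast_zero, zero_smul]
  · simp only [P, Polynomial.finsetSum_coeff, Polynomial.coeff_C_mul]
    rw [Finset.sum_range_succ']
    simp [descPochhammer_coeff_zero_succ]
  · simp only [P, Polynomial.finsetSum_coeff, Polynomial.coeff_C_mul]
    rw [Finset.sum_range_succ', compLog_eq_sum hM]
    simp only [descPochhammer_zero, Polynomial.coeff_one, one_ne_zero, if_false, mul_zero, add_zero]
    refine Finset.sum_congr rfl fun j _ => ?_
    rw [descPochhammer_coeff_one_succ]
    have h1 : ((-1 : A) ^ j * (j.factorial : A)) = algebraMap k A ((-1) ^ j * (j.factorial : k)) := by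
      simp
    rw [h1, ← Algebra.commutes, ← Algebra.smul_def, smul_smul]
    congr 1
    have h2 : (j.factorial : k) ≠ 0 := by exact_mod_cast j.factorial_ne_zero
    have h3 : (j : k) + 1 ≠ 0 := by exact_mod_cast j.succ_ne_zero
    rw [Nat.factorial_succ]
    push_cast
    field_simp

/-- `compLog` is a derivation along the counit: the logarithm takes values in the tangent space. -/
theorem IsProunipotent.compLog_mul (hA : IsProunipotent k A) (a b : A) :
    compLog k A (a * b) = algebraMap k A (Coalgebra.counit a) * compLog k A b +
      algebraMap k A (Coalgebra.counit b) * compLog k A a := by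
  obtain ⟨P, hP, hP0, hP1⟩ := hA.exists_adamsPolynomial a
  obtain ⟨Q, hQ, hQ0, hQ1⟩ := hA.exists_adamsPolynomial b
  obtain ⟨R, hR, hR0, hR1⟩ := hA.exists_adamsPolynomial (a * b)
  have h : R = P * Q := polynomial_eq_of_eval_natCast (k := k) fun n => by
    rw [Polynomial.eval_mul, hP, hQ, hR, ← adams_apply, ← adams_apply, ← adams_apply, map_mul]
  rw [← hR1, h, Polynomial.coeff_mul, ← hP0, ← hQ0, ← hP1, ← hQ1]
  simp [Finset.Nat.antidiagonal_succ]
  ring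

/-- `log (u ^ n) = n log u`. -/
theorem IsProunipotent.adams_compLog (hA : IsProunipotent k A) (n : ℕ) (a : A) :
    adams k A n (compLog k A a) = n * compLog k A a := by
  obtain ⟨P, hP, hP0, hP1⟩ := hA.exists_adamsPolynomial a
  have h : P.map (adams k A n : A →+* A) = P.comp (Polynomial.C (n : A) * Polynomial.X) :=
    polynomial_eq_of_eval_natCast (k := k) fun m => by
      rw [Polynomial.eval_natCast_map, hP, Polynomial.eval_comp]
      simp only [Polynomial.eval_mul, Polynomial.eval_C, Polynomial.eval_X]
      rw [← Nat.cast_mul, hP, ← adams_apply, ← adams_apply]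
      exact adams_adams n m a
  have h1 := congrArg (fun q => Polynomial.coeff q 1) h
  simp only [Polynomial.coeff_map, Polynomial.comp_C_mul_X_coeff, hP1, pow_one] at h1
  rw [mul_comm]
  exact h1

end Log

/-! ### Left-invariant operators and derivations at the identity -/

section LieFunctionals

variable {k : Type*} [Field k] {A : Type u} [CommRing A] [HopfAlgebra k A]

theorem convMul_mem {B : Type*} [CommRing B] [Algebra k B] {f g : WithConv (A →ₗ[k] B)}
    (K : Submodule k B) (h : ∀ x y, f x * g y ∈ K) (a : A) : (f * g) a ∈ K := by
  rw [LinearMap.convMul_apply]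
  induction Coalgebra.comul (R := k) a using TensorProduct.induction_on with
  | zero => simp
  | tmul x y => simpa using h x y
  | add s t hs ht => rw [map_add, map_add]; exact K.add_mem hs ht

theorem counit_idSubOne (a : A) : Coalgebra.counit (R := k) ((idSubOne k A) a) = 0 := by
  simp only [idSubOne, WithConv.ofConv_sub, LinearMap.sub_apply]
  rw [LinearMap.convOne_apply]
  simp

theorem idSubOne_apply_eq_sub (a : A) :
    (idSubOne k A) a = a - algebraMap k A (Coalgebra.counit a) := rfl

/-- A derivation at the identity does not change under composition with `compLog`. -/
theorem IsProunipotent.apply_compLog (hA : IsProunipotent k A) {D : Module.Dual k A}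
    (hD : ∀ a b : A, D (a * b) =
      Coalgebra.counit (R := k) a * D b + Coalgebra.counit (R := k) b * D a) (a : A) :
    D (compLog k A a) = D a := by
  obtain ⟨M, hM⟩ := hA.exists_idSubOne_pow_eq_zero a
  have h1 : D 1 = 0 := by simpa using hD 1 1
  rw [compLog_eq_sum (M := M + 1) fun m hm => hM m (by omega), Finset.sum_range_succ', map_add,
    map_sum, Finset.sum_eq_zero]
  · rw [show ((-1 : k) ^ 0 / (((0 : ℕ) : k) + 1)) = 1 by simp, one_smul, zero_add, zero_add, pow_one]
    rw [idSubOne_apply_eq_sub, map_sub, Algebra.algebraMap_eq_smul_one, map_smul, h1]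
    simp
  · intro m _
    rw [map_smul]
    have : ((idSubOne k A) ^ (m + 1 + 1)) a ∈ LinearMap.ker D := by
      rw [pow_succ']
      rw [pow_succ]
      rw [← mul_assoc]
      refine convMul_mem _ (fun x y => ?_) a
      rw [LinearMap.mem_ker, hD, counit_idSubOne]
      have h2 : Coalgebra.counit (R := k) (((idSubOne k A) * (idSubOne k A) ^ m) x) = 0 := by
        have : ((idSubOne k A) * (idSubOne k A) ^ m) x ∈
            LinearMap.ker (Coalgebra.counit (R := k) (A := A)) := by
          refine convMul_mem _ (fun x y => ?_) x
          rw [LinearMap.mem_ker, Bialgebra.counit_mul, counit_idSubOne, zero_mul]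
        exact this
      rw [h2]
      simp
    rw [LinearMap.mem_ker.1 this, smul_zero]

theorem IsProunipotent.counit_compLog (hA : IsProunipotent k A) (a : A) :
    Coalgebra.counit (R := k) (compLog k A a) = 0 := by
  obtain ⟨M, hM⟩ := hA.exists_idSubOne_pow_eq_zero a
  rw [compLog_eq_sum hM, map_sum]
  refine Finset.sum_eq_zero fun m _ => ?_
  have : ((idSubOne k A) ^ (m + 1)) a ∈ LinearMap.ker (Coalgebra.counit (R := k) (A := A)) := by
    rw [pow_succ']
    refine convMul_mem _ (fun x y => ?_) a
    rw [LinearMap.mem_ker, Bialgebra.counit_mul, counit_idSubOne, zero_mul]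
  rw [map_smul, LinearMap.mem_ker.1 this, smul_zero]

/-- `compLog` commutes with endomorphisms of the group scheme. -/
theorem IsProunipotent.map_compLog (hA : IsProunipotent k A) (f : A →ₐc[k] A) (a : A) :
    f (compLog k A a) = compLog k A (f a) := by
  have hf : ∀ m b, f (((idSubOne k A) ^ m) b) = ((idSubOne k A) ^ m) (f b) := by
    intro m
    induction m with
    | zero =>
      intro b
      rw [pow_zero, LinearMap.convOne_apply, LinearMap.convOne_apply]
      rw [CoalgHomClass.counit_comp_apply]
      exact (f : A →ₐ[k] A).commutes _
    | succ m ih =>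
      intro b
      rw [pow_succ]
      have h1 := LinearMap.algHom_comp_convMul_distrib (f : A →ₐ[k] A) ((idSubOne k A) ^ m)
        (idSubOne k A)
      have h2 := LinearMap.convMul_comp_coalgHom_distrib ((idSubOne k A) ^ m)
        (idSubOne k A) (f : A →ₗc[k] A)
      have h3 := congrArg (fun F : A →ₗ[k] A => F b) h1
      have h4 := congrArg (fun F : A →ₗ[k] A => F b) h2
      refine h3.trans (Eq.trans ?_ h4.symm)
      congr 3
      · exact congrArg WithConv.toConv (LinearMap.ext fun c => ih c)
      · refine congrArg WithConv.toConv (LinearMap.ext fun c => ?_)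
        change f ((idSubOne k A) c) = (idSubOne k A) (f c)
        rw [idSubOne_apply_eq_sub, idSubOne_apply_eq_sub, map_sub,
          CoalgHomClass.counit_comp_apply]
        exact congrArg (fun z => f c - z) ((f : A →ₐ[k] A).commutes _)
  obtain ⟨M, hM⟩ := hA.exists_idSubOne_pow_eq_zero a
  rw [compLog_eq_sum hM, compLog_eq_sum (a := f a) (M := M) fun m hm => by
    rw [← hf, hM m hm, map_zero], map_sum]
  refine Finset.sum_congr rfl fun m _ => ?_
  rw [map_smul, hf]

/-- The left-invariant operator `a ↦ ∑ a₍₁₎ D(a₍₂₎)` attached to a functional `D`. -/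
def leftInvariant (D : Module.Dual k A) : A →ₗ[k] A :=
  (WithConv.toConv (LinearMap.id : A →ₗ[k] A) *
    WithConv.toConv (Algebra.linearMap k A ∘ₗ D)).ofConv

theorem counit_leftInvariant (D : Module.Dual k A) (a : A) :
    Coalgebra.counit (R := k) (leftInvariant D a) = D a := by
  have h : (Coalgebra.counit (R := k) (A := A)) ∘ₗ leftInvariant D = D := by
    have := LinearMap.algHom_comp_convMul_distrib (Bialgebra.counitAlgHom k A)
      (WithConv.toConv (LinearMap.id : A →ₗ[k] A))
      (WithConv.toConv (Algebra.linearMap k A ∘ₗ D))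
    refine Eq.trans this ?_
    have h1 : WithConv.toConv ((Bialgebra.counitAlgHom k A).toLinearMap.comp
      (WithConv.toConv (LinearMap.id : A →ₗ[k] A)).ofConv) = 1 := rfl
    rw [h1, one_mul]
    ext a
    simp
  exact congrArg (fun F : A →ₗ[k] k => F a) h

theorem leftInvariant_comp (D E : Module.Dual k A) (a : A) :
    leftInvariant D (leftInvariant E a) =
      leftInvariant (WithConv.toConv D * WithConv.toConv E).ofConv a := by
  have h1 : Algebra.linearMap k A ∘ₗ (WithConv.toConv D * WithConv.toConv E).ofConv =
      (WithConv.toConv (Algebra.linearMap k A ∘ₗ D) *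
        WithConv.toConv (Algebra.linearMap k A ∘ₗ E)).ofConv :=
    LinearMap.algHom_comp_convMul_distrib (Algebra.ofId k A) _ _
  unfold leftInvariant
  rw [h1, WithConv.toConv_ofConv, ← mul_assoc]
  have h2 : ∀ (f : WithConv (A →ₗ[k] A)) (t : A ⊗[k] A),
      f (LinearMap.mul' k A (TensorProduct.map LinearMap.id (Algebra.linearMap k A ∘ₗ E) t)) =
      LinearMap.mul' k A (TensorProduct.map f.ofConv (Algebra.linearMap k A ∘ₗ E) t) := by
    intro f t
    induction t using TensorProduct.induction_on with
    | zero => simp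
    | tmul x y =>
      simp only [TensorProduct.map_tmul, LinearMap.id_coe, id_eq, LinearMap.coe_comp,
        Function.comp_apply, Algebra.linearMap_apply, LinearMap.mul'_apply]
      rw [mul_comm, ← Algebra.smul_def, map_smul, Algebra.smul_def, mul_comm]
    | add s t hs ht => simp only [map_add, hs, ht]
  exact h2 (WithConv.toConv LinearMap.id * WithConv.toConv (Algebra.linearMap k A ∘ₗ D)) _

/-- The left-invariant operator of a derivation at the identity is a derivation. -/
theorem leftInvariant_mul {D : Module.Dual k A}
    (hD : ∀ a b : A, D (a * b) =
      Coalgebra.counit (R := k) a * D b + Coalgebra.counit (R := k) b * D a) (a b : A) :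
    leftInvariant D (a * b) = a * leftInvariant D b + b * leftInvariant D a := by
  let Φ : A ⊗[k] A →ₗ[k] A :=
    LinearMap.mul' k A ∘ₗ TensorProduct.map LinearMap.id (Algebra.linearMap k A ∘ₗ D)
  let E : A ⊗[k] A →ₗ[k] A :=
    LinearMap.mul' k A ∘ₗ TensorProduct.map LinearMap.id
      (Algebra.linearMap k A ∘ₗ Coalgebra.counit)
  have h : ∀ s t : A ⊗[k] A, Φ (s * t) = E s * Φ t + E t * Φ s := by
    intro s t
    induction s using TensorProduct.induction_on with
    | zero => simp
    | add s s' hs hs' => rw [add_mul, map_add, hs, hs', map_add, map_add]; ring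
    | tmul x y =>
      induction t using TensorProduct.induction_on with
      | zero => simp
      | add s s' hs hs' => rw [mul_add, map_add, hs, hs', map_add, map_add]; ring
      | tmul x' y' =>
        simp only [Algebra.TensorProduct.tmul_mul_tmul, LinearMap.coe_comp, Function.comp_apply,
          TensorProduct.map_tmul, LinearMap.id_coe, id_eq, hD, map_add, map_mul,
          Algebra.linearMap_apply, LinearMap.mul'_apply, Φ, E]
        ring
  have hE : ∀ c : A, E (Coalgebra.comul c) = c := by
    intro c
    have := mul_one (WithConv.toConv (LinearMap.id : A →ₗ[k] A))
    exact congrArg (fun F : WithConv (A →ₗ[k] A) => F c) this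
  have := h (Coalgebra.comul a) (Coalgebra.comul b)
  rw [← Bialgebra.comul_mul, hE, hE] at this
  exact this

theorem GroupFiltration.counit_eq_zero (F : GroupFiltration k A) {n : ℕ} {a : A}
    (ha : a ∈ F.J n) : Coalgebra.counit (R := k) a = 0 := by
  have := F.hopf n
  exact (‹(F.J n).IsHopfIdeal k›.toIsCoideal.counit_eq_zero) ha

end LieFunctionals

/-! ### Commutators in the Lie algebra -/

section Commutator

variable {k : Type*} [Field k] {A : Type u} [CommRing A] [HopfAlgebra k A]

/-- The point `1 + s D` of `U(Λ)` attached to a derivation `D` at the identity and `s ∈ Λ` with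
`s² = 0`. -/
def infinitesimalPoint {Λ : Type*} [CommRing Λ] [Algebra k Λ] (s : Λ) (hs : s * s = 0)
    (D : Module.Dual k A) (hD : ∀ a b : A, D (a * b) =
      Coalgebra.counit (R := k) a * D b + Coalgebra.counit (R := k) b * D a) :
    WithConv (A →ₐ[k] Λ) :=
  WithConv.toConv <| AlgHom.ofLinearMap
    (1 + s • WithConv.toConv (Algebra.linearMap k Λ ∘ₗ D) : WithConv (A →ₗ[k] Λ)).ofConv
    (by
      have h1 : D 1 = 0 := by simpa using hD 1 1
      simp [h1])
    (by
      intro a b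
      simp only [WithConv.ofConv_add, LinearMap.add_apply, WithConv.ofConv_smul,
        LinearMap.smul_apply, LinearMap.comp_apply, hD,
        Algebra.linearMap_apply, smul_eq_mul, map_add, map_mul]
      rw [LinearMap.convOne_apply, LinearMap.convOne_apply, LinearMap.convOne_apply,
        Bialgebra.counit_mul, map_mul]
      linear_combination (-algebraMap k Λ (D a) * algebraMap k Λ (D b)) * hs)

theorem toLinearMap_infinitesimalPoint {Λ : Type*} [CommRing Λ] [Algebra k Λ] (s : Λ)
    (hs : s * s = 0) (D : Module.Dual k A) (hD) :
    WithConv.toConv (infinitesimalPoint s hs D hD).ofConv.toLinearMap =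
      1 + s • WithConv.toConv (Algebra.linearMap k Λ ∘ₗ D) := rfl

theorem toLinearMap_pointInv_infinitesimalPoint {Λ : Type*} [CommRing Λ] [Algebra k Λ] (s : Λ)
    (hs : s * s = 0) (D : Module.Dual k A) (hD) :
    WithConv.toConv (pointInv (infinitesimalPoint s hs D hD)).ofConv.toLinearMap =
      1 - s • WithConv.toConv (Algebra.linearMap k Λ ∘ₗ D) := by
  set P : WithConv (A →ₗ[k] Λ) := s • WithConv.toConv (Algebra.linearMap k Λ ∘ₗ D) with hP
  have hPP : P * P = 0 := by rw [hP, smul_mul_smul_comm, hs, zero_smul]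
  have h := AlgHom.toLinearMap_convMul (pointInv (infinitesimalPoint s hs D hD))
    (infinitesimalPoint s hs D hD)
  rw [pointInv_mul, toLinearMap_infinitesimalPoint, ← hP, AlgHom.toLinearMap_convOne] at h
  have h2 : (1 + P) * (1 - P) = 1 := by
    rw [mul_sub, add_mul, add_mul, hPP]; simp
  calc _ = _ * ((1 + P) * (1 - P)) := by rw [h2, mul_one]
    _ = 1 - P := by rw [← mul_assoc, ← h, one_mul]

/-- The points `1 + s D` and `1 + t E` have the commutator `1 + s t [D, E]`. -/
theorem GroupFiltration.mul_commutator_eq_zero (F : GroupFiltration k A) {i j : ℕ} (hi : 1 ≤ i)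
    (hj : 1 ≤ j) {D E : Module.Dual k A} (hD : D ∈ F.lie i) (hE : E ∈ F.lie j)
    {Λ : Type u} [CommRing Λ] [Algebra k Λ] {s t : Λ} (hs : s * s = 0) (ht : t * t = 0)
    {a : A} (ha : a ∈ F.J (i + j)) :
    s * t * algebraMap k Λ ((WithConv.toConv D * WithConv.toConv E -
      WithConv.toConv E * WithConv.toConv D) a) = 0 := by
  let x : WithConv (A →ₐ[k] Λ) := infinitesimalPoint s hs D hD.1
  let y : WithConv (A →ₐ[k] Λ) := infinitesimalPoint t ht E hE.1
  have hx : ∀ a ∈ F.J i, x a = 0 := by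
    intro a ha
    change (1 + s • WithConv.toConv (Algebra.linearMap k Λ ∘ₗ D) : WithConv (A →ₗ[k] Λ)) a = 0
    simp only [WithConv.ofConv_add, LinearMap.add_apply, WithConv.ofConv_smul,
      LinearMap.smul_apply, LinearMap.comp_apply, hD.2 a ha]
    rw [LinearMap.convOne_apply, F.counit_eq_zero ha]
    simp
  have hy : ∀ a ∈ F.J j, y a = 0 := by
    intro a ha
    change (1 + t • WithConv.toConv (Algebra.linearMap k Λ ∘ₗ E) : WithConv (A →ₗ[k] Λ)) a = 0
    simp only [WithConv.ofConv_add, LinearMap.add_apply, WithConv.ofConv_smul,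
      LinearMap.smul_apply, LinearMap.comp_apply, hE.2 a ha]
    rw [LinearMap.convOne_apply, F.counit_eq_zero ha]
    simp
  have h := F.commutator i j hi hj Λ x y hx hy a ha
  set P : WithConv (A →ₗ[k] Λ) := s • WithConv.toConv (Algebra.linearMap k Λ ∘ₗ D) with hP
  set Q : WithConv (A →ₗ[k] Λ) := t • WithConv.toConv (Algebra.linearMap k Λ ∘ₗ E) with hQ
  have hPP : P * P = 0 := by rw [hP, smul_mul_smul_comm, hs, zero_smul]
  have hQQ : Q * Q = 0 := by rw [hQ, smul_mul_smul_comm, ht, zero_smul]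
  have hPQP : P * Q * P = 0 := by
    rw [hP, hQ, smul_mul_smul_comm, smul_mul_smul_comm, mul_right_comm, hs, zero_mul, zero_smul]
  have hQPQ : Q * P * Q = 0 := by
    rw [hP, hQ, smul_mul_smul_comm, smul_mul_smul_comm, mul_right_comm, ht, zero_mul, zero_smul]
  have hxy : WithConv.toConv (x * y * pointInv x * pointInv y).ofConv.toLinearMap =
      1 + (P * Q - Q * P) := by
    rw [AlgHom.toLinearMap_convMul, AlgHom.toLinearMap_convMul, AlgHom.toLinearMap_convMul,
      toLinearMap_pointInv_infinitesimalPoint, toLinearMap_pointInv_infinitesimalPoint,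
      toLinearMap_infinitesimalPoint, toLinearMap_infinitesimalPoint, ← hP, ← hQ]
    have e : (1 + P) * (1 + Q) * (1 - P) * (1 - Q) = 1 + (P * Q - Q * P) - P * P - Q * Q
        + P * P * Q - P * Q * P + P * Q * P * Q + Q * P * Q - P * (Q * Q) := by noncomm_ring
    rw [e, hPP, hQQ, hPQP, hQPQ]
    simp
  have h1 : (1 + (P * Q - Q * P)) a = 0 := by rw [← hxy]; exact h
  have h2 : P * Q - Q * P = (s * t) • WithConv.toConv (Algebra.linearMap k Λ ∘ₗ
      (WithConv.toConv D * WithConv.toConv E - WithConv.toConv E * WithConv.toConv D).ofConv) := by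
    have e1 := LinearMap.algHom_comp_convMul_distrib (Algebra.ofId k Λ)
      (WithConv.toConv D) (WithConv.toConv E)
    have e2 := LinearMap.algHom_comp_convMul_distrib (Algebra.ofId k Λ)
      (WithConv.toConv E) (WithConv.toConv D)
    rw [hP, hQ, smul_mul_smul_comm, smul_mul_smul_comm, mul_comm t s, ← smul_sub]
    congr 1
    rw [WithConv.ofConv_sub, LinearMap.comp_sub]
    exact (congrArg₂ (fun p q : A →ₗ[k] Λ => WithConv.toConv (p - q)) e1 e2).symm
  rw [h2] at h1
  simp only [WithConv.ofConv_add, LinearMap.add_apply, WithConv.ofConv_smul,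
    LinearMap.smul_apply, LinearMap.comp_apply] at h1
  rw [LinearMap.convOne_apply, F.counit_eq_zero ha, map_zero, zero_add] at h1
  exact h1

/-- The Lie bracket of `W_{-i} Lie(U)` and `W_{-j} Lie(U)` lies in `W_{-i-j} Lie(U)`: evaluate the
commutator condition on the points `1 + s D` and `1 + t E`, whose commutator is `1 + s t [D, E]`. -/
theorem GroupFiltration.lie_commutator (F : GroupFiltration k A) {i j : ℕ} (hi : 1 ≤ i)
    (hj : 1 ≤ j) {D E : Module.Dual k A} (hD : D ∈ F.lie i) (hE : E ∈ F.lie j) :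
    (WithConv.toConv D * WithConv.toConv E - WithConv.toConv E * WithConv.toConv D).ofConv ∈
      F.lie (i + j) := by
  have hc : ∀ a, (WithConv.toConv D * WithConv.toConv E - WithConv.toConv E * WithConv.toConv D) a =
      Coalgebra.counit (R := k) (leftInvariant D (leftInvariant E a) -
        leftInvariant E (leftInvariant D a)) := by
    intro a
    rw [leftInvariant_comp, leftInvariant_comp, map_sub, counit_leftInvariant,
      counit_leftInvariant]
    rfl
  refine ⟨fun a b => ?_, fun a ha => ?_⟩
  · change (WithConv.toConv D * WithConv.toConv E - WithConv.toConv E * WithConv.toConv D) (a * b) =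
      _ * (WithConv.toConv D * WithConv.toConv E - WithConv.toConv E * WithConv.toConv D) b +
      _ * (WithConv.toConv D * WithConv.toConv E - WithConv.toConv E * WithConv.toConv D) a
    simp only [hc, leftInvariant_mul hE.1, leftInvariant_mul hD.1, map_add, map_sub,
      Bialgebra.counit_mul]
    ring
  · have hs : (TrivSqZeroExt.inl DualNumber.eps : DualNumber (DualNumber A)) *
        TrivSqZeroExt.inl DualNumber.eps = 0 := by
      rw [← TrivSqZeroExt.inl_mul, DualNumber.eps_mul_eps, TrivSqZeroExt.inl_zero]
    have ht : (DualNumber.eps : DualNumber (DualNumber A)) * DualNumber.eps = 0 :=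
      DualNumber.eps_mul_eps
    have h1 := F.mul_commutator_eq_zero (Λ := DualNumber (DualNumber A)) hi hj hD hE hs ht ha
    have h3 := congrArg (fun z : DualNumber (DualNumber A) =>
      Coalgebra.counit (R := k) z.snd.snd) h1
    simpa [TrivSqZeroExt.algebraMap_eq_inl'] using h3

end Commutator

/-! ### Products of Lie algebra elements and the logarithm -/

section Splittings

/-- All ways of splitting a list into two complementary sublists. -/
def splittings {α : Type*} : List α → List (List α × List α)
  | [] => [([], [])]
  | x :: l => (splittings l).map (fun p => (x :: p.1, p.2)) ++
      (splittings l).map fun p => (p.1, x :: p.2)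

theorem length_splittings {α : Type*} (l : List α) : (splittings l).length = 2 ^ l.length := by
  induction l with
  | nil => rfl
  | cons x l ih => simp [splittings, ih, pow_succ]; ring

theorem perm_of_mem_splittings {α : Type*} {l : List α} {p : List α × List α}
    (hp : p ∈ splittings l) : (p.1 ++ p.2).Perm l := by
  induction l generalizing p with
  | nil => simp [splittings] at hp; simp [hp]
  | cons x l ih =>
    simp only [splittings, List.mem_append, List.mem_map] at hp
    rcases hp with ⟨q, hq, rfl⟩ | ⟨q, hq, rfl⟩
    · exact (ih hq).cons x
    · exact List.perm_middle.trans ((ih hq).cons x)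

end Splittings

section Eulerian

variable {k : Type*} [Field k] {A : Type u} [CommRing A] [HopfAlgebra k A]

/-- The left-invariant differential operator attached to a list of functionals. -/
def iterLeftInvariant : List (Module.Dual k A) → (A →ₗ[k] A)
  | [] => LinearMap.id
  | D :: l => leftInvariant D ∘ₗ iterLeftInvariant l

/-- The Leibniz rule for a product of left-invariant derivations. -/
theorem iterLeftInvariant_mul {l : List (Module.Dual k A)}
    (hl : ∀ D ∈ l, ∀ a b : A, D (a * b) =
      Coalgebra.counit (R := k) a * D b + Coalgebra.counit (R := k) b * D a) (a b : A) :
    iterLeftInvariant l (a * b) = ((splittings l).map fun p =>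
      iterLeftInvariant p.1 a * iterLeftInvariant p.2 b).sum := by
  induction l with
  | nil => simp [splittings, iterLeftInvariant]
  | cons D l ih =>
    have hs : ∀ L : List (List (Module.Dual k A) × List (Module.Dual k A)),
        leftInvariant D (L.map fun p => iterLeftInvariant p.1 a * iterLeftInvariant p.2 b).sum =
        (L.map fun p => iterLeftInvariant (D :: p.1) a * iterLeftInvariant p.2 b).sum +
        (L.map fun p => iterLeftInvariant p.1 a * iterLeftInvariant (D :: p.2) b).sum := by
      intro L
      induction L with
      | nil => simp
      | cons p L ihL =>
        simp only [List.map_cons, List.sum_cons, map_add, ihL]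
        rw [leftInvariant_mul (hl D (by simp))]
        simp only [iterLeftInvariant, LinearMap.comp_apply]
        ring
    have h1 : iterLeftInvariant (D :: l) (a * b) = leftInvariant D (iterLeftInvariant l (a * b)) :=
      rfl
    rw [h1, ih fun E hE => hl E (by simp [hE]), hs]
    simp [splittings, List.map_map, Function.comp_def]

/-- The convolution product of a list of functionals. -/
def convProd (l : List (Module.Dual k A)) : WithConv (A →ₗ[k] k) := (l.map WithConv.toConv).prod

theorem convProd_append (l l' : List (Module.Dual k A)) :
    convProd (l ++ l') = convProd l * convProd l' := by
  simp [convProd]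

theorem convProd_cons (D : Module.Dual k A) (l : List (Module.Dual k A)) :
    convProd (D :: l) = WithConv.toConv D * convProd l := by
  simp [convProd]

theorem iterLeftInvariant_eq (l : List (Module.Dual k A)) (a : A) :
    iterLeftInvariant l a = leftInvariant (convProd l).ofConv a := by
  induction l generalizing a with
  | nil =>
    have h : leftInvariant (convProd ([] : List (Module.Dual k A))).ofConv a = a := by
      have := mul_one (WithConv.toConv (LinearMap.id : A →ₗ[k] A))
      exact congrArg (fun f : WithConv (A →ₗ[k] A) => f a) this
    rw [h]; rfl
  | cons D l ih =>
    have h1 : iterLeftInvariant (D :: l) a = leftInvariant D (iterLeftInvariant l a) := rfl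
    rw [h1, ih, leftInvariant_comp, convProd_cons]

theorem counit_iterLeftInvariant (l : List (Module.Dual k A)) (a : A) :
    Coalgebra.counit (R := k) (iterLeftInvariant l a) = convProd l a := by
  rw [iterLeftInvariant_eq, counit_leftInvariant]

/-- The squaring map of `U` sends a product of elements of `Lie(U)` to the sum, over all ways to
distribute its factors to two groups, of the product of the two groups. -/
theorem convProd_adams_two {l : List (Module.Dual k A)}
    (hl : ∀ D ∈ l, ∀ a b : A, D (a * b) =
      Coalgebra.counit (R := k) a * D b + Coalgebra.counit (R := k) b * D a) (a : A) :
    convProd l (adams k A 2 a) =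
      ((splittings l).map fun p => convProd (p.1 ++ p.2) a).sum := by
  have hmul : ∀ x y : A, convProd l (x * y) = ((splittings l).map fun p =>
      convProd p.1 x * convProd p.2 y).sum := by
    intro x y
    rw [← counit_iterLeftInvariant, iterLeftInvariant_mul hl, map_list_sum, List.map_map]
    congr 1
    refine List.map_congr_left fun p _ => ?_
    simp [Bialgebra.counit_mul, counit_iterLeftInvariant]
  have ht : ∀ t : A ⊗[k] A, convProd l (LinearMap.mul' k A t) = ((splittings l).map fun p =>
      LinearMap.mul' k k (TensorProduct.map (convProd p.1).ofConv (convProd p.2).ofConv t)).sum := by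
    intro t
    induction t using TensorProduct.induction_on with
    | zero => simp
    | tmul x y => simpa using hmul x y
    | add s t hs ht => simp only [map_add, hs, ht, List.sum_map_add]
  have h2 : adams k A 2 a = LinearMap.mul' k A (Coalgebra.comul a) := by
    rw [adams_apply, pow_two, LinearMap.convMul_apply]
    simp
  rw [h2, ht]
  congr 1
  refine List.map_congr_left fun p _ => ?_
  rw [convProd_append]
  rfl

/-- A product of elements of `Lie(U)` of total weight at least `s` pairs trivially with `compLog a`
if `a` vanishes on `W_{-s}U`: modulo shorter products of at least the same weight it does not depend
on the order of the factors, and for symmetric products of `r` factors the squaring map of `U` acts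
on the pairing both as `2 ^ r` and as `2`. -/
theorem IsProunipotent.convProd_compLog_eq_zero [CharZero k] (hA : IsProunipotent k A)
    (F : GroupFiltration k A) {s : ℕ} {a : A} (ha : a ∈ F.J s) :
    ∀ l : List (ℕ × Module.Dual k A), (∀ q ∈ l, 1 ≤ q.1 ∧ q.2 ∈ F.lie q.1) →
      s ≤ (l.map Prod.fst).sum → convProd (l.map Prod.snd) (compLog k A a) = 0 := by
  suffices h : ∀ n, ∀ l : List (ℕ × Module.Dual k A), l.length = n →
      (∀ q ∈ l, 1 ≤ q.1 ∧ q.2 ∈ F.lie q.1) →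
      s ≤ (l.map Prod.fst).sum → convProd (l.map Prod.snd) (compLog k A a) = 0 from
    fun l => h _ l rfl
  intro n
  induction n using Nat.strong_induction_on with
  | _ n ih =>
  have hperm : ∀ l l' : List (ℕ × Module.Dual k A), l.Perm l' → ∀ p : List (ℕ × Module.Dual k A),
      (p ++ l).length = n → (∀ q ∈ p ++ l, 1 ≤ q.1 ∧ q.2 ∈ F.lie q.1) →
      s ≤ ((p ++ l).map Prod.fst).sum →
      convProd ((p ++ l).map Prod.snd) (compLog k A a) =
        convProd ((p ++ l').map Prod.snd) (compLog k A a) := by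
    intro l l' hll
    induction hll with
    | nil => intros; rfl
    | cons x h ihp =>
      intro p h1 h2 h3
      have := ihp (p ++ [x]) (by simpa using h1) (by simpa using h2) (by simpa using h3)
      simpa using this
    | swap x y l =>
      -- swapping adjacent factors changes the product by one with their commutator as a single factor,
      -- which is shorter and has the same total weight
      intro p h1 h2 h3
      have hx := h2 x (by simp)
      have hy := h2 y (by simp)
      have hz := ih (n - 1) (by simp at h1; omega)
        (p ++ (y.1 + x.1, (WithConv.toConv y.2 * WithConv.toConv x.2 -
          WithConv.toConv x.2 * WithConv.toConv y.2).ofConv) :: l) (by simp at h1 ⊢; omega)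
        (by
          intro q hq
          simp only [List.mem_append, List.mem_cons] at hq
          rcases hq with hq | rfl | hq
          · exact h2 q (by simp [hq])
          · exact ⟨by have := hx.1; simp; omega, F.lie_commutator hy.1 hx.1 hy.2 hx.2⟩
          · exact h2 q (by simp [hq]))
        (by simp at h3 ⊢; omega)
      simp only [List.map_append, List.map_cons, convProd_append, convProd_cons] at hz ⊢
      rw [WithConv.toConv_ofConv, sub_mul, mul_sub, WithConv.ofConv_sub, LinearMap.sub_apply,
        sub_eq_zero] at hz
      simpa only [mul_assoc] using hz
    | trans h h' ih1 ih2 =>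
      intro p h1 h2 h3
      rw [ih1 p h1 h2 h3]
      refine ih2 p ?_ ?_ ?_
      · rw [← h1]; simp [h.length_eq]
      · intro q hq; exact h2 q ((h.append_left p).mem_iff.2 hq)
      · rw [← ((h.append_left p).map _).sum_eq]; exact h3
  intro l hlen hl hw
  match l, hlen, hl, hw with
  | [], _, _, _ =>
    have : convProd ([] : List (Module.Dual k A)) (compLog k A a) =
      Coalgebra.counit (compLog k A a) := rfl
    simpa [this] using hA.counit_compLog a
  | [q], _, hl, hw =>
    have hq := (hl q (by simp)).2
    simp only [List.map_cons, List.map_nil, List.sum_cons, List.sum_nil, add_zero] at hw ⊢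
    have : convProd [q.2] = WithConv.toConv q.2 := by simp [convProd]
    rw [this]
    exact (hA.apply_compLog hq.1 a).trans (hq.2 a (F.mono hw ha))
  | q :: q' :: l, hlen, hl, hw =>
    -- compute the effect of the squaring map in two ways
    set L := q :: q' :: l with hL
    have h1 : convProd (L.map Prod.snd) (adams k A 2 (compLog k A a)) =
        2 ^ L.length * convProd (L.map Prod.snd) (compLog k A a) := by
      rw [convProd_adams_two]
      · have hsp : ∀ L : List (ℕ × Module.Dual k A), splittings (L.map Prod.snd) =
            (splittings L).map fun p => (p.1.map Prod.snd, p.2.map Prod.snd) := by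
          intro L
          induction L with
          | nil => rfl
          | cons x L ihL => simp [splittings, ihL, Function.comp_def]
        rw [hsp, List.map_map]
        have hc : ∀ p ∈ splittings L, ((fun p : List (Module.Dual k A) × List (Module.Dual k A) =>
            convProd (p.1 ++ p.2) (compLog k A a)) ∘
              fun p : List (ℕ × Module.Dual k A) × List (ℕ × Module.Dual k A) =>
                (p.1.map Prod.snd, p.2.map Prod.snd)) p =
            convProd (L.map Prod.snd) (compLog k A a) := by
          intro p hp
          have := hperm L (p.1 ++ p.2) (perm_of_mem_splittings hp).symm [] (by simpa using hlen)
            (by simpa using hl) (by simpa using hw)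
          simpa using this.symm
        rw [List.map_congr_left hc]
        simp [length_splittings]
      · intro D hD
        obtain ⟨x, hx, rfl⟩ := List.mem_map.1 hD
        exact (hl x hx).2.1
    rw [hA.adams_compLog] at h1
    have h2 : ((2 : ℕ) : A) * compLog k A a = (2 : k) • compLog k A a := by
      rw [Algebra.smul_def, map_ofNat, Nat.cast_ofNat]
    rw [h2, map_smul, smul_eq_mul, ← sub_eq_zero, ← sub_mul, mul_eq_zero] at h1
    refine h1.resolve_left ?_
    rw [sub_eq_zero]
    intro h
    have h3 : (2 : ℕ) ^ 1 = 2 ^ L.length := by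
      rw [pow_one]
      exact_mod_cast h
    have := Nat.pow_right_injective le_rfl h3
    simp [hL] at this

end Eulerian

/-! ### Weights detected by derivations -/

section Detection

variable {k : Type*} [Field k] {B : Type*} [CommRing B] [Algebra k B] {I : Type*}

/-- The composite of the derivations indexed by a list, the head of the list acting first. -/
def iterDerivation (d : I → Derivation k B B) : List I → (B →ₗ[k] B)
  | [] => LinearMap.id
  | i :: l => iterDerivation d l ∘ₗ (d i : B →ₗ[k] B)

theorem derivation_apply_mem_pow (d : Derivation k B B) (m : Ideal B) (n : ℕ) :
    ∀ y ∈ m ^ (n + 1), d y ∈ m ^ n := by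
  induction n with
  | zero => simp
  | succ n ih =>
    intro y hy
    rw [pow_succ'] at hy
    induction hy using Submodule.mul_induction_on' with
    | mem_mul_mem a ha b hb =>
      rw [Derivation.leibniz, smul_eq_mul, smul_eq_mul]
      refine Ideal.add_mem _ ?_ ?_
      · rw [pow_succ']
        exact Ideal.mul_mem_mul ha (ih b hb)
      · exact Ideal.mul_mem_right _ _ hb
    | add a _ b _ ha hb => rw [map_add]; exact Ideal.add_mem _ ha hb

theorem iterDerivation_mem_pow (d : I → Derivation k B B) (m : Ideal B) (l : List I) (n : ℕ) :
    ∀ y ∈ m ^ (n + l.length), iterDerivation d l y ∈ m ^ n := by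
  induction l with
  | nil => simp [iterDerivation]
  | cons i l ih =>
    intro y hy
    exact ih _ (derivation_apply_mem_pow (d i) m _ _ (by simpa [← add_assoc] using hy))

variable {ε : B →ₐ[k] k} {x : I → B} {d : I → Derivation k B B}

theorem multiset_prod_mem_pow (hx : ∀ i, ε (x i) = 0) (s : Multiset I) :
    (s.map x).prod ∈ RingHom.ker ε ^ Multiset.card s := by
  induction s using Multiset.induction_on with
  | empty => simp
  | cons a s ih =>
    rw [Multiset.map_cons, Multiset.prod_cons, Multiset.card_cons, pow_succ']
    exact Ideal.mul_mem_mul (hx a) ih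

/-- Modulo terms of higher order at the base point, `d i` differentiates a monomial in the
coordinates like the partial derivative with respect to `x i`. -/
theorem derivation_multiset_prod_sub_mem [DecidableEq I] (hx : ∀ i, ε (x i) = 0)
    (hd : ∀ i j, ε (d i (x j)) = if i = j then 1 else 0) (i : I) (s : Multiset I) :
    d i (s.map x).prod - s.count i • ((s.erase i).map x).prod ∈
      RingHom.ker ε ^ Multiset.card s := by
  induction s using Multiset.induction_on with
  | empty => simp
  | cons a t ih =>
    rw [Multiset.map_cons, Multiset.prod_cons, Multiset.card_cons, Derivation.leibniz, smul_eq_mul,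
      smul_eq_mul]
    have h1 := Ideal.mul_mem_mul (show x a ∈ RingHom.ker ε from hx a) ih
    rw [← pow_succ'] at h1
    have h2 : d i (x a) - (if i = a then 1 else 0) ∈ RingHom.ker ε := by
      rw [RingHom.mem_ker, map_sub, hd]
      split_ifs <;> simp
    have h3 := Ideal.mul_mem_mul h2 (multiset_prod_mem_pow hx t)
    rw [← pow_succ'] at h3
    convert Ideal.add_mem _ h1 h3 using 1
    by_cases hia : i = a
    · subst hia
      rw [Multiset.count_cons_self, Multiset.erase_cons_head, if_pos rfl]
      have h4 : t.count i • (x i * ((t.erase i).map x).prod) = t.count i • (t.map x).prod := by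
        by_cases hit : i ∈ t
        · rw [← Multiset.prod_cons, ← Multiset.map_cons, Multiset.cons_erase hit]
        · simp [Multiset.count_eq_zero_of_notMem hit]
      rw [mul_sub, mul_smul_comm, h4, succ_nsmul]
      ring
    · rw [Multiset.count_cons_of_ne hia, Multiset.erase_cons_tail _ (Ne.symm hia), if_neg hia,
        Multiset.map_cons, Multiset.prod_cons]
      rw [nsmul_eq_mul, nsmul_eq_mul]
      ring

/-- A product of as many derivations as a monomial in the coordinates has factors detects at the
base point whether the indices agree; monomials with more factors are killed. -/
theorem exists_iterDerivation_multiset_prod [CharZero k] [DecidableEq I]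
    (hx : ∀ i, ε (x i) = 0)
    (hd : ∀ i j, ε (d i (x j)) = if i = j then 1 else 0) (l : List I) :
    ∃ c : k, c ≠ 0 ∧ ε (iterDerivation d l (((l : Multiset I).map x).prod)) = c ∧
      ∀ s : Multiset I, l.length ≤ Multiset.card s → s ≠ (l : Multiset I) →
        ε (iterDerivation d l ((s.map x).prod)) = 0 := by
  induction l with
  | nil =>
    refine ⟨1, one_ne_zero, by simp [iterDerivation], fun s _ hs => ?_⟩
    obtain ⟨a, ha⟩ := Multiset.exists_mem_of_ne_zero hs
    simp only [iterDerivation, LinearMap.id_apply, map_multiset_prod, Multiset.map_map]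
    exact Multiset.prod_eq_zero (Multiset.mem_map.2 ⟨a, ha, hx a⟩)
  | cons i l ih =>
    obtain ⟨c, hc, h1, h2⟩ := ih
    have key : ∀ s : Multiset I, l.length < Multiset.card s →
        ε (iterDerivation d (i :: l) ((s.map x).prod)) =
          s.count i * ε (iterDerivation d l (((s.erase i).map x).prod)) := by
      intro s hs
      have h3 := derivation_multiset_prod_sub_mem hx hd i s
      have h4 : RingHom.ker ε ^ Multiset.card s ≤ RingHom.ker ε ^ (1 + l.length) :=
        Ideal.pow_le_pow_right (by omega)
      have h5 := iterDerivation_mem_pow d (RingHom.ker ε) l 1 _ (h4 h3)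
      rw [pow_one, RingHom.mem_ker, map_sub, map_sub, sub_eq_zero, map_nsmul, map_nsmul,
        nsmul_eq_mul] at h5
      exact h5
    refine ⟨((i :: l : List I) : Multiset I).count i * c, ?_, ?_, fun s hs hne => ?_⟩
    · refine mul_ne_zero ?_ hc
      simp only [Multiset.coe_count, List.count_cons_self]
      exact Nat.cast_ne_zero.2 (Nat.succ_ne_zero _)
    · rw [key _ (by simp)]
      rw [← h1]
      congr 5
      simp
    · rw [key s (by simpa using hs)]
      by_cases hi : i ∈ s
      · rw [h2, mul_zero]
        · rw [Multiset.card_erase_of_mem hi]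
          simp at hs
          exact Nat.le_pred_of_lt hs
        · intro h
          apply hne
          rw [← Multiset.cons_erase hi, h]
          rfl
      · rw [Multiset.count_eq_zero_of_notMem hi]
        simp

variable {w : I → ℕ}

/-- The weight of a function at the base point, measured by the products of derivations that kill
it, is subadditive for products of functions. The bounds may be negative, as is needed for the
induction. -/
theorem iterDerivation_mul_eq_zero {y z : B} {m n : ℤ}
    (hy : ∀ l : List I, m < (l.map w).sum → ε (iterDerivation d l y) = 0)
    (hz : ∀ l : List I, n < (l.map w).sum → ε (iterDerivation d l z) = 0) (l : List I)
    (hl : m + n < (l.map w).sum) : ε (iterDerivation d l (y * z)) = 0 := by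
  induction l generalizing y z m n with
  | nil =>
    simp only [List.map_nil, List.sum_nil, Nat.cast_zero] at hl
    have : m < 0 ∨ n < 0 := by omega
    simp only [iterDerivation, LinearMap.id_apply, map_mul]
    rcases this with h | h
    · have := hy [] (by simpa using h)
      simp only [iterDerivation, LinearMap.id_apply] at this
      rw [this, zero_mul]
    · have := hz [] (by simpa using h)
      simp only [iterDerivation, LinearMap.id_apply] at this
      rw [this, mul_zero]
  | cons i l ih =>
    have h : iterDerivation d (i :: l) (y * z) =
        iterDerivation d l (y * d i z) + iterDerivation d l (z * d i y) := by
      change iterDerivation d l (d i (y * z)) = _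
      rw [Derivation.leibniz, map_add]
      rfl
    simp only [List.map_cons, List.sum_cons, Nat.cast_add] at hl
    rw [h, map_add, ih (m := m) (n := n - w i) hy (fun l' hl' => ?_) (by omega),
      ih (m := n) (n := m - w i) hz (fun l' hl' => ?_) (by omega), add_zero]
    · exact hy (i :: l') (by rw [List.map_cons, List.sum_cons, Nat.cast_add]; omega)
    · exact hz (i :: l') (by rw [List.map_cons, List.sum_cons, Nat.cast_add]; omega)

theorem iterDerivation_multiset_prod_eq_zero
    (hw : ∀ (l : List I) (j : I), w j < (l.map w).sum → ε (iterDerivation d l (x j)) = 0)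
    (s : Multiset I) (l : List I) (hl : (s.map w).sum < (l.map w).sum) :
    ε (iterDerivation d l (s.map x).prod) = 0 := by
  induction s using Multiset.induction_on generalizing l with
  | empty =>
    match l, hl with
    | i :: l, _ =>
      change ε (iterDerivation d l (d i _)) = 0
      simp
  | cons a s ih =>
    rw [Multiset.map_cons, Multiset.prod_cons]
    refine iterDerivation_mul_eq_zero (w := w) (m := w a) (n := ((s.map w).sum : ℕ)) ?_ ?_ l ?_
    · intro l hl
      exact hw l a (by exact_mod_cast hl)
    · intro l hl
      exact ih l (by exact_mod_cast hl)
    · simp only [Multiset.map_cons, Multiset.sum_cons] at hl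
      exact_mod_cast hl

/-- Weights of polynomial expressions in coordinates `x i` dual to derivations `d i` can be read off
at the base point: if all products of derivations of total weight greater than `n` kill
`P(x)` there, then all monomials of `P` have weight at most `n`. -/
theorem weight_le_of_iterDerivation_eq_zero [CharZero k] [DecidableEq I] (hx : ∀ i, ε (x i) = 0)
    (hd : ∀ i j, ε (d i (x j)) = if i = j then 1 else 0)
    (hw : ∀ (l : List I) (j : I), w j < (l.map w).sum → ε (iterDerivation d l (x j)) = 0)
    (P : MvPolynomial I k) (n : ℕ)
    (hP : ∀ l : List I, n < (l.map w).sum → ε (iterDerivation d l (MvPolynomial.aeval x P)) = 0) :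
    ∀ s ∈ P.support, Finsupp.weight w s ≤ n := by
  by_contra! hcon
  have hwt : ∀ s : I →₀ ℕ, ((Finsupp.toMultiset s).map w).sum = Finsupp.weight w s := by
    intro s
    rw [Finsupp.weight_apply, Finsupp.toMultiset_map]
    induction s using Finsupp.induction_linear with
    | zero => simp
    | add s t hs ht => rw [Finsupp.mapDomain_add, map_add, Multiset.sum_add, hs, ht,
        Finsupp.sum_add_index' (by simp) (by intros; rw [add_smul])]
    | single i n => simp [Multiset.sum_nsmul]
  have hprod : ∀ s : I →₀ ℕ, MvPolynomial.aeval x (MvPolynomial.monomial s (1 : k)) =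
      ((Finsupp.toMultiset s).map x).prod := by
    intro s
    rw [MvPolynomial.aeval_monomial, map_one, one_mul, Finsupp.toMultiset_map,
      Finsupp.prod_toMultiset, Finsupp.prod_mapDomain_index (by simp) (by intros; rw [pow_add])]
  obtain ⟨s₀, hs₀, hs₀n⟩ := hcon
  -- among the monomials of maximal weight take one of minimal degree; the corresponding product of
  -- derivations kills all other monomials of `P`
  obtain ⟨s₁, hs₁, hmax⟩ := Finset.exists_max_image P.support (Finsupp.weight w) ⟨s₀, hs₀⟩
  obtain ⟨s₂, hs₂, hmin⟩ := Finset.exists_min_image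
    (P.support.filter fun s => Finsupp.weight w s = Finsupp.weight w s₁)
    (fun s => Multiset.card (Finsupp.toMultiset s)) ⟨s₁, by simpa using hs₁⟩
  obtain ⟨hs₂, hs₂w⟩ := Finset.mem_filter.1 hs₂
  set l := (Finsupp.toMultiset s₂).toList with hl
  have hlm : (l : Multiset I) = Finsupp.toMultiset s₂ := Multiset.coe_toList _
  have hlw : (l.map w).sum = Finsupp.weight w s₁ := by
    rw [← hs₂w, ← hwt, ← hlm]
    simp
  obtain ⟨c, hc, h1, h2⟩ := exists_iterDerivation_multiset_prod hx hd l
  have h3 := hP l (by rw [hlw]; exact hs₀n.trans_le (hmax _ hs₀))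
  rw [P.as_sum, map_sum, map_sum, map_sum, Finset.sum_eq_single s₂] at h3
  · rw [← mul_one (P.coeff s₂), ← smul_eq_mul, ← MvPolynomial.smul_monomial, map_smul, map_smul,
      map_smul, hprod, ← hlm, h1, smul_eq_mul, mul_eq_zero] at h3
    exact h3.elim (MvPolynomial.mem_support_iff.1 hs₂) hc
  · intro s hs hne
    rw [← mul_one (P.coeff s), ← smul_eq_mul, ← MvPolynomial.smul_monomial, map_smul, map_smul,
      map_smul, hprod]
    rcases (hmax s hs).lt_or_eq with h | h
    · rw [iterDerivation_multiset_prod_eq_zero hw _ _ (by rw [hwt, hlw]; exact h), smul_zero]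
    · rw [h2 _ ?_ ?_, smul_zero]
      · rw [hl, Multiset.length_toList]
        exact hmin s (by simp [h, MvPolynomial.mem_support_iff.1 hs])
      · rw [hlm]
        exact fun h => hne (by simpa using congrArg Multiset.toFinsupp h)
  · intro h
    exact absurd hs₂ h

end Detection

/-! ### Adapted bases and generators of the coordinate ring -/

section AdaptedBasis

variable {k : Type*} [Field k]

/-- A vector space with an exhaustive filtration by finite-dimensional subspaces, starting from `0`,
has a basis adapted to the filtration. -/
theorem exists_adapted_basis {Q : Type*} [AddCommGroup Q] [Module k Q] (E : ℕ → Submodule k Q)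
    (hmono : Monotone E) (h0 : E 0 = ⊥) (htop : ∀ q, ∃ n, q ∈ E n)
    (hfin : ∀ n, FiniteDimensional k (E n)) :
    ∃ (d : ℕ+ → ℕ) (b : Module.Basis (Σ n : ℕ+, Fin (d n)) k Q),
      ∀ n : ℕ, E n = Submodule.span k (b '' {i | (i.1 : ℕ) ≤ n}) := by
  let S : ℕ+ → Submodule k Q := fun n => E n.natPred
  let β : ∀ n : ℕ+, Module.Basis (Fin (Module.finrank k (E n ⧸ (S n).submoduleOf (E n)))) k
      (E n ⧸ (S n).submoduleOf (E n)) := fun n => Module.finBasis k _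
  let d : ℕ+ → ℕ := fun n => Module.finrank k (E n ⧸ (S n).submoduleOf (E n))
  choose v hv using fun n : ℕ+ => fun j : Fin (d n) =>
    Submodule.mkQ_surjective ((S n).submoduleOf (E n)) (β n j)
  let b : (Σ n : ℕ+, Fin (d n)) → Q := fun i => v i.1 i.2
  have hbE : ∀ i n, (i.1 : ℕ) ≤ n → b i ∈ E n := fun i n h => hmono h (v i.1 i.2).2
  have hspan : ∀ n : ℕ, E n = Submodule.span k (b '' {i | (i.1 : ℕ) ≤ n}) := by
    intro n
    refine le_antisymm ?_ (Submodule.span_le.2 ?_)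
    · induction n with
      | zero => rw [h0]; exact bot_le
      | succ n ih =>
        intro q hq
        let N : ℕ+ := n.succPNat
        let q' : E N := ⟨q, hq⟩
        let c := (β N).repr (Submodule.mkQ _ q')
        have h1 : q - ∑ j, c j • b ⟨N, j⟩ ∈ E n := by
          have h2 : Submodule.mkQ ((S N).submoduleOf (E N)) (q' - ∑ j, c j • v N j) = 0 := by
            rw [map_sub, map_sum]
            simp only [map_smul, hv]
            rw [(β N).sum_repr, sub_self]
          rw [← LinearMap.mem_ker, Submodule.ker_mkQ] at h2
          have h3 : ((q' - ∑ j, c j • v N j : E N) : Q) ∈ S N := h2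
          have h3' : ((q' - ∑ j, c j • v N j : E N) : Q) = q - ∑ j, c j • b ⟨N, j⟩ := by
            rw [AddSubgroupClass.coe_sub, AddSubmonoidClass.coe_finsetSum]
            rfl
          rw [h3'] at h3
          exact h3
        have h4 : q - ∑ j, c j • b ⟨N, j⟩ ∈ Submodule.span k (b '' {i | (i.1 : ℕ) ≤ n + 1}) :=
          Submodule.span_mono (Set.image_mono fun i hi => Nat.le_succ_of_le hi) (ih h1)
        have h5 : ∑ j, c j • b ⟨N, j⟩ ∈ Submodule.span k (b '' {i | (i.1 : ℕ) ≤ n + 1}) :=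
          Submodule.sum_mem _ fun j _ => Submodule.smul_mem _ _
            (Submodule.subset_span ⟨⟨N, j⟩, by simp [N], rfl⟩)
        exact sub_add_cancel q _ ▸ Submodule.add_mem _ h4 h5
    · rintro _ ⟨i, hi, rfl⟩
      exact hbE i n hi
  have hli : LinearIndependent k b := by
    rw [linearIndependent_iff]
    intro l hl
    by_contra hne
    obtain ⟨i₀, hi₀, hmax⟩ := Finset.exists_max_image l.support (fun i => (i.1 : ℕ))
      (Finsupp.support_nonempty_iff.2 hne)
    obtain ⟨n, j₀⟩ := i₀
    have h1 : ∑ j, l ⟨n, j⟩ • b ⟨n, j⟩ ∈ S n := by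
      have h2 : ∑ i ∈ l.support, l i • b i = 0 := hl
      rw [← Finset.sum_filter_add_sum_filter_not _ (fun i => i.1 = n)] at h2
      have h3 : ∑ i ∈ l.support.filter (fun i => i.1 = n), l i • b i =
          ∑ j, l ⟨n, j⟩ • b ⟨n, j⟩ := by
        refine (Finset.sum_subset ?_ ?_).trans (Finset.sum_map Finset.univ
          (Function.Embedding.sigmaMk (β := fun n => Fin (d n)) n) (fun i => l i • b i))
        · rintro ⟨m, j⟩ hi
          obtain ⟨_, h⟩ := Finset.mem_filter.1 hi
          obtain rfl : m = n := h
          simp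
        · rintro i hi hni
          obtain ⟨j, _, rfl⟩ := Finset.mem_map.1 hi
          have : l (Function.Embedding.sigmaMk (β := fun n => Fin (d n)) n j) = 0 := by
            by_contra h
            exact hni (Finset.mem_filter.2 ⟨Finsupp.mem_support_iff.2 h, rfl⟩)
          rw [this, zero_smul]
      rw [h3] at h2
      rw [eq_neg_of_add_eq_zero_left h2]
      refine Submodule.neg_mem _ (Submodule.sum_mem _ fun i hi => Submodule.smul_mem _ _ ?_)
      obtain ⟨hi, hin⟩ := Finset.mem_filter.1 hi
      refine hbE i _ ?_
      have h4 : (i.1 : ℕ) ≤ n := hmax i hi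
      have h5 : (i.1 : ℕ) ≠ n := fun h => hin (PNat.eq h)
      have h6 := n.natPred_add_one
      omega
    have h2 : ∑ j, l ⟨n, j⟩ • β n j = 0 := by
      have h3 : Submodule.mkQ ((S n).submoduleOf (E n)) (∑ j, l ⟨n, j⟩ • v n j) = 0 := by
        rw [← LinearMap.mem_ker, Submodule.ker_mkQ]
        change ((∑ j, l ⟨n, j⟩ • v n j : E n) : Q) ∈ S n
        simpa [b] using h1
      rw [map_sum] at h3
      simpa only [map_smul, hv] using h3
    exact (Finsupp.mem_support_iff.1 hi₀)
      (Fintype.linearIndependent_iff.1 (β n).linearIndependent _ h2 j₀)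
  refine ⟨d, Module.Basis.mk hli fun q _ => ?_, fun n => ?_⟩
  · obtain ⟨n, hn⟩ := htop q
    rw [hspan] at hn
    exact Submodule.span_mono (Set.image_subset_range _ _) hn
  · rw [Module.Basis.coe_mk]
    exact hspan n

end AdaptedBasis

section Generation

variable {k : Type*} [Field k] {A : Type u} [CommRing A] [HopfAlgebra k A]

/-- The coordinate ring of a pro-unipotent group is generated by the functions `compLog a`: an entry
`c i j` of a unitriangular matrix representation is, up to a scalar, the sum of `compLog (c i j)`
and a polynomial in the entries closer to the diagonal. -/
theorem IsProunipotent.mem_of_forall_compLog_mem (hA : IsProunipotent k A) (S : Subalgebra k A)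
    (hS : ∀ a, compLog k A a ∈ S) (a : A) : a ∈ S := by
  obtain ⟨n, c, h1, h2, h3, h4, ha⟩ := hA a
  refine Submodule.span_le (p := Subalgebra.toSubmodule S).2 ?_ ha
  rintro _ ⟨⟨i, j⟩, rfl⟩
  change c i j ∈ S
  have hz : ∀ (m : ℕ) (i j : Fin n), (j : ℕ) < i + m → ((c - 1) ^ m) i j = 0 := by
    intro m
    induction m with
    | zero =>
      intro i j hij
      have : i ≠ j := by rintro rfl; simp at hij
      rw [pow_zero, Matrix.one_apply_ne this]
    | succ m ih =>
      intro i j hij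
      rw [pow_succ, Matrix.mul_apply]
      refine Finset.sum_eq_zero fun l _ => ?_
      by_cases hl : (l : ℕ) < i + m
      · rw [ih i l hl, zero_mul]
      · have : (c - 1) l j = 0 := by
          rcases lt_or_eq_of_le (show (j : ℕ) ≤ l by omega) with h | h
          · rw [Matrix.sub_apply, h2 l j h, Matrix.one_apply_ne (Fin.ne_of_gt h), sub_zero]
          · obtain rfl := Fin.ext h
            simp [h1]
        rw [this, mul_zero]
  suffices h : ∀ t : ℕ, ∀ i j : Fin n, (j : ℕ) - i ≤ t → c i j ∈ S from h _ i j le_rfl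
  intro t
  induction t using Nat.strong_induction_on with
  | _ t ih =>
  intro i j hij
  rcases lt_trichotomy j i with h | h | h
  · rw [h2 i j h]; exact S.zero_mem
  · rw [h, h1]; exact S.one_mem
  have hsmall : ∀ (m : ℕ) (i' j' : Fin n), (j' : ℕ) - i' < t → ((c - 1) ^ m) i' j' ∈ S := by
    intro m
    induction m with
    | zero =>
      intro i' j' _
      rw [pow_zero, Matrix.one_apply]
      split_ifs
      exacts [S.one_mem, S.zero_mem]
    | succ m ihm =>
      intro i' j' hij'
      rw [pow_succ, Matrix.mul_apply]
      refine S.sum_mem fun l _ => ?_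
      by_cases hl : (l : ℕ) < i' + m
      · rw [hz m i' l hl, zero_mul]; exact S.zero_mem
      by_cases hl' : (j' : ℕ) < l
      · rw [Matrix.sub_apply, h2 l j' hl', Matrix.one_apply_ne (Fin.ne_of_gt hl'), sub_zero,
          mul_zero]
        exact S.zero_mem
      refine S.mul_mem (ihm i' l (by omega)) ?_
      rw [Matrix.sub_apply, Matrix.one_apply]
      refine S.sub_mem (ih _ (lt_of_le_of_lt (by omega) hij') l j' le_rfl) ?_
      split_ifs
      exacts [S.one_mem, S.zero_mem]
  have hlarge : ∀ m : ℕ, ((c - 1) ^ (m + 1 + 1)) i j ∈ S := by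
    intro m
    rw [pow_succ, Matrix.mul_apply]
    refine S.sum_mem fun l _ => ?_
    by_cases hl : (l : ℕ) < i + (m + 1)
    · rw [hz (m + 1) i l hl, zero_mul]; exact S.zero_mem
    by_cases hl' : (j : ℕ) < l + 1
    · have := hz 1 l j hl'
      rw [pow_one] at this
      rw [this, mul_zero]
      exact S.zero_mem
    refine S.mul_mem (hsmall _ _ _ (by omega)) ?_
    have := hsmall 1 l j (by omega)
    rwa [pow_one] at this
  obtain ⟨M, hM⟩ := hA.exists_idSubOne_pow_eq_zero (c i j)
  have hpow : ∀ m, ((idSubOne k A) ^ m) (c i j) = ((c - 1) ^ m) i j := fun m =>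
    congrFun (congrFun (idSubOne_pow_matrix (k := k) h3 h4 m) i) j
  have h5 := compLog_eq_sum (M := M + 1) fun m hm => hM m (by omega)
  rw [Finset.sum_range_succ', show ((-1 : k) ^ 0 / (((0 : ℕ) : k) + 1)) = 1 by simp, one_smul,
    zero_add, hpow, pow_one, Matrix.sub_apply, Matrix.one_apply_ne h.ne, sub_zero] at h5
  rw [← sub_eq_iff_eq_add'.2 h5]
  refine S.sub_mem (hS _) (S.sum_mem fun m _ => S.smul_mem ?_ _)
  rw [hpow]
  exact hlarge m

end Generation

/-! ### Logarithmic coordinates -/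

/-- The index set of a system of coordinates with `d n` coordinates of weight `n` for `n > 0`. -/
abbrev CoordIndex (d : ℕ+ → ℕ) : Type := Σ n : ℕ+, Fin (d n)

/-- The indices of weight at most `n`. -/
def indicesLE (d : ℕ+ → ℕ) (n : ℕ+) : Finset (CoordIndex d) :=
  (Finset.Iic n).sigma fun _ => Finset.univ

/-- The indices of weight less than `n`. -/
def indicesLT (d : ℕ+ → ℕ) (n : ℕ+) : Finset (CoordIndex d) :=
  (Finset.Iio n).sigma fun _ => Finset.univ

theorem mem_indicesLE {d : ℕ+ → ℕ} {n : ℕ+} {i : CoordIndex d} :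
    i ∈ indicesLE d n ↔ i.1 ≤ n := by simp [indicesLE]

theorem mem_indicesLT {d : ℕ+ → ℕ} {n : ℕ+} {i : CoordIndex d} :
    i ∈ indicesLT d n ↔ i.1 < n := by simp [indicesLT]

theorem sum_indicesLE {d : ℕ+ → ℕ} {M : Type*} [AddCommMonoid M] (n : ℕ+) (f : CoordIndex d → M) :
    ∑ i ∈ indicesLE d n, f i = ∑ j, f ⟨n, j⟩ + ∑ i ∈ indicesLT d n, f i := by
  rw [indicesLE, indicesLT, Finset.sum_sigma, Finset.sum_sigma, ← Finset.Iio_insert,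
    Finset.sum_insert (by simp)]

section Coordinates

variable {k : Type*} [Field k] {A : Type u} [CommRing A] [HopfAlgebra k A]

/-- Logarithmic coordinates on `U` adapted to the filtration `F`: coordinates `x i = compLog (β i)`
with `β i ∈ J (n + 1)` for `i` of weight `n`, and the dual elements `D i ∈ W_{-n} Lie(U)`. -/
structure LogCoordinates (F : GroupFiltration k A) where
  d : ℕ+ → ℕ
  β : CoordIndex d → A
  D : CoordIndex d → Module.Dual k A
  β_mem : ∀ i, β i ∈ F.J (i.1 + 1)
  D_mem : ∀ i, D i ∈ F.lie i.1
  D_β : ∀ i j, D i (β j) = if i = j then 1 else 0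
  compLog_eq : ∀ (n : ℕ+) (a : A), a ∈ F.J (n + 1) →
    compLog k A a = ∑ i ∈ indicesLE d n, D i a • compLog k A (β i)
  compLog_mem_span : ∀ a : A, compLog k A a ∈
    Submodule.span k (Set.range fun i => compLog k A (β i))
  lie_eq_zero : ∀ (n : ℕ+) (E : Module.Dual k A), E ∈ F.lie n → (∀ j, E (β ⟨n, j⟩) = 0) →
    E ∈ F.lie (n + 1)

/-- The coordinate function `x i`. -/
def LogCoordinates.x {F : GroupFiltration k A} (X : LogCoordinates F) (i : CoordIndex X.d) : A :=
  compLog k A (X.β i)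

theorem IsProunipotent.compLog_add (hA : IsProunipotent k A) (a b : A) :
    compLog k A (a + b) = compLog k A a + compLog k A b := by
  obtain ⟨M, hM⟩ := hA.exists_idSubOne_pow_eq_zero a
  obtain ⟨N, hN⟩ := hA.exists_idSubOne_pow_eq_zero b
  have hadd : ∀ m, ((idSubOne k A) ^ m) (a + b) = ((idSubOne k A) ^ m) a + ((idSubOne k A) ^ m) b :=
    fun m => map_add ((idSubOne k A) ^ m).ofConv a b
  rw [compLog_eq_sum (M := max M N) fun m hm => hM m ((le_max_left _ _).trans hm),
    compLog_eq_sum (M := max M N) fun m hm => hN m ((le_max_right _ _).trans hm),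
    compLog_eq_sum (M := max M N) fun m hm => by
      rw [hadd, hM m ((le_max_left _ _).trans hm), hN m ((le_max_right _ _).trans hm), add_zero],
    ← Finset.sum_add_distrib]
  exact Finset.sum_congr rfl fun m _ => by rw [hadd, smul_add]

theorem IsProunipotent.compLog_smul (hA : IsProunipotent k A) (c : k) (a : A) :
    compLog k A (c • a) = c • compLog k A a := by
  obtain ⟨M, hM⟩ := hA.exists_idSubOne_pow_eq_zero a
  have hsmul : ∀ m, ((idSubOne k A) ^ m) (c • a) = c • ((idSubOne k A) ^ m) a :=
    fun m => map_smul ((idSubOne k A) ^ m).ofConv c a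
  rw [compLog_eq_sum hM, compLog_eq_sum (M := M) fun m hm => by rw [hsmul, hM m hm, smul_zero],
    Finset.smul_sum]
  exact Finset.sum_congr rfl fun m _ => by rw [hsmul, smul_comm]

variable (k A) in
/-- The subspace `k + m²` of `A`, where `m` is the ideal of the identity of `U`. The quotient by it
is the cotangent space of `U` at the identity. -/
def cotangentKernel : Submodule k A :=
  Submodule.span k {1} ⊔ ((RingHom.ker (Bialgebra.counitAlgHom k A)) ^ 2).restrictScalars k

theorem cotangentKernel_le_ker {M : Type*} [AddCommGroup M] [Module k M] (f : A →ₗ[k] M)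
    (h1 : f 1 = 0)
    (h2 : ∀ a b : A, Coalgebra.counit (R := k) a = 0 → Coalgebra.counit (R := k) b = 0 →
      f (a * b) = 0) : cotangentKernel k A ≤ LinearMap.ker f := by
  refine sup_le (Submodule.span_le.2 (by simpa using h1)) fun y hy => ?_
  rw [Submodule.restrictScalars_mem, pow_two] at hy
  induction hy using Submodule.mul_induction_on' with
  | mem_mul_mem a ha b hb => exact h2 a b ha hb
  | add a _ b _ ha hb => exact Submodule.add_mem _ ha hb

/-- The derivations at the identity are the functionals on the cotangent space. -/
theorem cotangentKernel_le_ker_iff (D : Module.Dual k A) :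
    cotangentKernel k A ≤ LinearMap.ker D ↔ ∀ a b : A, D (a * b) =
      Coalgebra.counit (R := k) a * D b + Coalgebra.counit (R := k) b * D a := by
  constructor
  · intro h a b
    have h1 : D 1 = 0 := h (Submodule.mem_sup_left (Submodule.subset_span rfl))
    have h2 := h (Submodule.mem_sup_right (T := ((RingHom.ker (Bialgebra.counitAlgHom k A)) ^ 2
      |>.restrictScalars k)) (x := (idSubOne k A a) * (idSubOne k A b)) (by
        rw [Submodule.restrictScalars_mem, pow_two]
        exact Ideal.mul_mem_mul (counit_idSubOne a) (counit_idSubOne b)))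
    have h3 : (idSubOne k A a) * (idSubOne k A b) = a * b -
        (Coalgebra.counit (R := k) a) • b - (Coalgebra.counit (R := k) b) • a +
        (Coalgebra.counit (R := k) a * Coalgebra.counit (R := k) b) • (1 : A) := by
      rw [idSubOne_apply_eq_sub, idSubOne_apply_eq_sub, Algebra.smul_def, Algebra.smul_def,
        Algebra.smul_def, map_mul]
      ring
    rw [h3, LinearMap.mem_ker] at h2
    simp only [map_add, map_sub, map_smul, h1, smul_eq_mul] at h2
    linear_combination h2
  · intro h
    refine cotangentKernel_le_ker D (by simpa using h 1 1) fun a b ha hb => ?_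
    rw [h, ha, hb, zero_mul, zero_mul, add_zero]

theorem finite_of_surjective_of_subquotient {V W : Type*} [AddCommGroup V] [Module k V]
    [AddCommGroup W] [Module k W] (S T : Submodule k V) (f : S →ₗ[k] W)
    (hf : Function.Surjective f) (hT : ∀ x : S, (x : V) ∈ T → f x = 0)
    [Module.Finite k (Subquotient S T)] : Module.Finite k W := by
  have : Module.Finite k (S ⧸ T.submoduleOf S) := ‹Module.Finite k (Subquotient S T)›
  refine Module.Finite.of_surjective ((T.submoduleOf S).liftQ f fun x hx => hT x hx) fun w => ?_
  obtain ⟨v, rfl⟩ := hf w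
  exact ⟨(T.submoduleOf S).mkQ v, rfl⟩

/-- The images of the ideals of `W_{-n-1}U` filter the cotangent space of `U` at the identity;
finite codimension makes the steps finite-dimensional and separatedness makes the filtration
exhaustive, so there is an adapted basis. The logarithm factors through the cotangent space. -/
theorem IsProunipotent.nonempty_logCoordinates [CharZero k] (hA : IsProunipotent k A)
    (F : GroupFiltration k A) (hsep : F.IsSeparated) (hcodim : F.FiniteCodim) :
    Nonempty (LogCoordinates F) := by
  let K := cotangentKernel k A
  let q : A →ₗ[k] A ⧸ K := K.mkQ
  let E : ℕ → Submodule k (A ⧸ K) := fun n => ((F.J (n + 1)).restrictScalars k).map q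
  have hEmono : Monotone E := fun m n h => Submodule.map_mono (F.mono (by omega))
  have hE0 : E 0 = ⊥ := by
    simp only [E, zero_add, F.J_one, Submodule.restrictScalars_bot, Submodule.map_bot]
  have hEtop : ∀ y, ∃ n, y ∈ E n := by
    intro y
    obtain ⟨a, rfl⟩ := K.mkQ_surjective y
    have h1 : q a = q (idSubOne k A a) := by
      rw [idSubOne_apply_eq_sub, map_sub, Algebra.algebraMap_eq_smul_one, map_smul]
      have : q 1 = 0 := (Submodule.Quotient.mk_eq_zero _).2
        (Submodule.mem_sup_left (Submodule.subset_span rfl))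
      rw [this, smul_zero, sub_zero]
    have h2 : (idSubOne k A a) ∈ ⨆ n, F.J n := by
      rw [hsep]
      exact counit_idSubOne a
    rw [Submodule.mem_iSup_of_directed _ F.mono.directed_le] at h2
    obtain ⟨n, hn⟩ := h2
    exact ⟨n, _, F.mono n.le_succ hn, h1.symm⟩
  -- a functional on the cotangent space is the same as a derivation at the identity
  have hlift : ∀ φ : Module.Dual k (A ⧸ K), ∀ n : ℕ, (∀ y ∈ E n, φ y = 0) →
      φ ∘ₗ q ∈ F.lie (n + 1) := by
    intro φ n hφ
    refine ⟨(cotangentKernel_le_ker_iff _).1 fun a ha => ?_, fun a ha => hφ _ ⟨a, ha, rfl⟩⟩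
    have h0 : q a = 0 := (Submodule.Quotient.mk_eq_zero K).2 ha
    rw [LinearMap.mem_ker, LinearMap.comp_apply, h0, map_zero]
  -- restriction to `E n` maps `Lie(U) / W_{-n-1} Lie(U)` onto the dual of `E n`
  have hEfin : ∀ n, FiniteDimensional k (E n) := by
    intro n
    let f : F.lie 0 →ₗ[k] Module.Dual k (E n) :=
      { toFun := fun D => (K.liftQ D.1 ((cotangentKernel_le_ker_iff D.1).2 D.2.1)).comp (E n).subtype
        map_add' := by
          intro D D'
          ext ⟨y, hy⟩
          obtain ⟨a, rfl⟩ := K.mkQ_surjective y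
          simp
        map_smul' := by
          intro c D
          ext ⟨y, hy⟩
          obtain ⟨a, rfl⟩ := K.mkQ_surjective y
          simp }
    have hf : ∀ D : F.lie 0, (D : Module.Dual k A) ∈ F.lie (n + 1) → f D = 0 := by
      intro D hD
      ext ⟨y, a, ha, rfl⟩
      exact hD.2 a ha
    have hsurj : Function.Surjective f := by
      intro φ
      obtain ⟨φ', hφ'⟩ := LinearMap.exists_extend φ
      have h0 : φ' ∘ₗ q ∈ F.lie 0 := by
        have := hlift φ' 0 (by rw [hE0]; intro y hy; rw [(Submodule.mem_bot k).1 hy, map_zero])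
        exact ⟨this.1, fun a ha => this.2 a (F.mono (Nat.zero_le _) ha)⟩
      refine ⟨⟨_, h0⟩, ?_⟩
      rw [← hφ']
      ext ⟨y, hy⟩
      obtain ⟨a, rfl⟩ := K.mkQ_surjective y
      rfl
    have := hcodim (n + 1)
    have := finite_of_surjective_of_subquotient (F.lie 0) (F.lie (n + 1)) f hsurj hf
    exact Module.finite_dual_iff k |>.1 this
  obtain ⟨d, b, hb⟩ := exists_adapted_basis E hEmono hE0 hEtop hEfin
  have hbmem : ∀ i, ∃ a ∈ F.J (i.1 + 1), q a = b i := by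
    intro i
    have : b i ∈ E i.1 := by
      rw [hb]
      exact Submodule.subset_span ⟨i, by simp, rfl⟩
    exact this
  choose β hβ hqβ using hbmem
  let D : CoordIndex d → Module.Dual k A := fun i => b.coord i ∘ₗ q
  let L : A →ₗ[k] A := ⟨⟨compLog k A, hA.compLog_add⟩, hA.compLog_smul⟩
  have hL : K ≤ LinearMap.ker L := by
    refine cotangentKernel_le_ker L ?_ fun a c ha hc => ?_
    · have := hA.compLog_mul 1 1
      simpa [L] using this
    · change compLog k A (a * c) = 0
      rw [hA.compLog_mul, ha, hc]
      simp
  let L' : A ⧸ K →ₗ[k] A := K.liftQ L hL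
  have hLb : ∀ i, L' (b i) = compLog k A (β i) := fun i => by rw [← hqβ]; rfl
  refine ⟨⟨d, β, D, hβ, fun i => ?_, fun i j => ?_, fun n a ha => ?_, fun a => ?_,
    fun n G hG hz => ?_⟩⟩
  · have h1 := hlift (b.coord i) i.1.natPred (fun y hy => ?_)
    · rwa [i.1.natPred_add_one] at h1
    · rw [hb, b.mem_span_image] at hy
      rw [Module.Basis.coord_apply]
      by_contra hne
      have h2 : (i.1 : ℕ) ≤ i.1.natPred := hy (Finsupp.mem_support_iff.2 hne)
      have := i.1.natPred_add_one
      omega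
  · simp only [D, LinearMap.comp_apply, hqβ, Module.Basis.coord_apply, Module.Basis.repr_self,
      Finsupp.single_apply, eq_comm]
  · have h1 : q a ∈ E n := ⟨a, ha, rfl⟩
    rw [hb, b.mem_span_image] at h1
    have h2 : compLog k A a = L' (q a) := rfl
    rw [h2, ← b.linearCombination_repr (q a), Finsupp.linearCombination_apply, map_finsuppSum,
      Finsupp.sum_of_support_subset _ (s := indicesLE d n)]
    · refine Finset.sum_congr rfl fun i _ => ?_
      rw [map_smul, hLb]
      simp [D]
    · exact fun i hi => mem_indicesLE.2 (h1 hi)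
    · simp
  · have h2 : compLog k A a = L' (q a) := rfl
    rw [h2, ← b.linearCombination_repr (q a), Finsupp.linearCombination_apply, map_finsuppSum]
    refine Submodule.sum_mem _ fun i _ => ?_
    simp only [map_smul, hLb]
    exact Submodule.smul_mem _ _ (Submodule.subset_span ⟨i, rfl⟩)
  · refine ⟨hG.1, fun a ha => ?_⟩
    have hGK := (cotangentKernel_le_ker_iff G).2 hG.1
    have h1 : q a ∈ E n := ⟨a, ha, rfl⟩
    have h2 : E n ≤ LinearMap.ker (K.liftQ G hGK) := by
      rw [hb, Submodule.span_le]
      rintro _ ⟨i, hi, rfl⟩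
      have h3 : K.liftQ G hGK (b i) = G (β i) := by rw [← hqβ]; rfl
      simp only [SetLike.mem_coe, LinearMap.mem_ker, h3]
      have hi' : (i.1 : ℕ) ≤ n := hi
      rcases hi'.lt_or_eq with h | h
      · exact hG.2 _ (F.mono h (hβ i))
      · obtain ⟨m, j⟩ := i
        obtain rfl : m = n := PNat.eq h
        exact hz j
    exact h2 h1

end Coordinates

/-! ### The coordinate ring as a polynomial ring -/

section LinearCoefficient

variable {k : Type*} [Field k] {B : Type*} [CommRing B] [Algebra k B] {I : Type*}
  {ε : B →ₐ[k] k} {x : I → B} {d : I → Derivation k B B}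

/-- The linear coefficients of a polynomial in the coordinates are its first derivatives at the base
point. -/
theorem coeff_single_eq_derivation [CharZero k] [DecidableEq I] (hx : ∀ i, ε (x i) = 0)
    (hd : ∀ i j, ε (d i (x j)) = if i = j then 1 else 0) (P : MvPolynomial I k) (v : I) :
    P.coeff (Finsupp.single v 1) = ε (d v (MvPolynomial.aeval x P)) := by
  induction P using MvPolynomial.induction_on' with
  | add p q hp hq => simp only [MvPolynomial.coeff_add, map_add, hp, hq]
  | monomial s c =>
    obtain ⟨e, -, h1, h2⟩ := exists_iterDerivation_multiset_prod hx hd [v]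
    have hprod : MvPolynomial.aeval x (MvPolynomial.monomial s (1 : k)) =
        ((Finsupp.toMultiset s).map x).prod := by
      rw [MvPolynomial.aeval_monomial, map_one, one_mul, Finsupp.toMultiset_map,
        Finsupp.prod_toMultiset, Finsupp.prod_mapDomain_index (by simp) (by intros; rw [pow_add])]
    rw [← mul_one c, ← smul_eq_mul, ← MvPolynomial.smul_monomial, MvPolynomial.coeff_smul, map_smul,
      Derivation.map_smul, map_smul, hprod, MvPolynomial.coeff_monomial]
    congr 1
    split_ifs with hs
    · subst hs
      rw [Finsupp.toMultiset_single, one_nsmul]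
      simp [hd]
    · by_cases h0 : s = 0
      · subst h0
        simp
      · refine (h2 _ ?_ ?_).symm
        · rw [List.length_singleton, Nat.one_le_iff_ne_zero, Ne, Multiset.card_eq_zero]
          intro h
          exact h0 (by simpa using congrArg Multiset.toFinsupp h)
        · intro h
          exact hs (by simpa [eq_comm] using congrArg Multiset.toFinsupp h)

end LinearCoefficient

section TensorDerivations

variable {k : Type*} [Field k] {A : Type*} [CommRing A] [Algebra k A]

/-- The derivation `d ⊗ 1` of `A ⊗ A`. -/
def derivationTensorLeft (d : Derivation k A A) : Derivation k (A ⊗[k] A) (A ⊗[k] A) :=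
  Derivation.mk' ((d : A →ₗ[k] A).rTensor A) fun s t => by
    induction s using TensorProduct.induction_on with
    | zero => simp
    | add s s' hs hs' => simp only [add_mul, map_add, hs, hs', add_smul, smul_add]; abel
    | tmul a b =>
      induction t using TensorProduct.induction_on with
      | zero => simp
      | add s s' hs hs' => simp only [mul_add, map_add, hs, hs', add_smul, smul_add]; abel
      | tmul a' b' =>
        simp [TensorProduct.add_tmul, mul_comm b b']

/-- The derivation `1 ⊗ d` of `A ⊗ A`. -/
def derivationTensorRight (d : Derivation k A A) : Derivation k (A ⊗[k] A) (A ⊗[k] A) :=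
  Derivation.mk' ((d : A →ₗ[k] A).lTensor A) fun s t => by
    induction s using TensorProduct.induction_on with
    | zero => simp
    | add s s' hs hs' => simp only [add_mul, map_add, hs, hs', add_smul, smul_add]; abel
    | tmul a b =>
      induction t using TensorProduct.induction_on with
      | zero => simp
      | add s s' hs hs' => simp only [mul_add, map_add, hs, hs', add_smul, smul_add]; abel
      | tmul a' b' =>
        simp [TensorProduct.tmul_add, mul_comm a a']

/-- The derivations `d i ⊗ 1` and `1 ⊗ d i`. -/
def tensorDerivation {I : Type*} (d : I → Derivation k A A) :
    I ⊕ I → Derivation k (A ⊗[k] A) (A ⊗[k] A) :=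
  Sum.elim (fun i => derivationTensorLeft (d i)) fun i => derivationTensorRight (d i)

theorem iterDerivation_tensorDerivation {I : Type*} (d : I → Derivation k A A) (l : List (I ⊕ I)) :
    iterDerivation (tensorDerivation d) l =
      TensorProduct.map (iterDerivation d (l.filterMap Sum.getLeft?))
        (iterDerivation d (l.filterMap Sum.getRight?)) := by
  induction l with
  | nil => simp [iterDerivation]
  | cons i l ih =>
    refine TensorProduct.ext' fun a b => ?_
    cases i with
    | inl i =>
      have h : iterDerivation (tensorDerivation d) (Sum.inl i :: l) (a ⊗ₜ[k] b) =
        iterDerivation (tensorDerivation d) l (d i a ⊗ₜ[k] b) := rfl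
      rw [h, ih]
      rfl
    | inr i =>
      have h : iterDerivation (tensorDerivation d) (Sum.inr i :: l) (a ⊗ₜ[k] b) =
        iterDerivation (tensorDerivation d) l (a ⊗ₜ[k] d i b) := rfl
      rw [h, ih]
      rfl

end TensorDerivations

section CoordinateRing

variable {k : Type*} [Field k] {A : Type u} [CommRing A] [HopfAlgebra k A]
  {F : GroupFiltration k A}

namespace LogCoordinates

/-- The left-invariant derivation extending `D i`. -/
def derivation (X : LogCoordinates F) (i : CoordIndex X.d) : Derivation k A A :=
  Derivation.mk' (leftInvariant (X.D i)) fun a b => leftInvariant_mul (X.D_mem i).1 a b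

theorem iterDerivation_eq (X : LogCoordinates F) (l : List (CoordIndex X.d)) :
    iterDerivation X.derivation l = iterLeftInvariant (l.reverse.map X.D) := by
  induction l with
  | nil => rfl
  | cons i l ih =>
    have h : ∀ (L : List (Module.Dual k A)) (E : Module.Dual k A),
        iterLeftInvariant (L ++ [E]) = iterLeftInvariant L ∘ₗ leftInvariant E := by
      intro L E
      induction L with
      | nil => rfl
      | cons E' L ihL => simp only [List.cons_append, iterLeftInvariant, ihL]; rfl
    rw [List.reverse_cons, List.map_append, List.map_cons, List.map_nil, h, ← ih]
    rfl

theorem counit_iterDerivation (X : LogCoordinates F) (l : List (CoordIndex X.d)) (a : A) :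
    Coalgebra.counit (R := k) (iterDerivation X.derivation l a) =
      convProd (l.reverse.map X.D) a := by
  rw [iterDerivation_eq, counit_iterLeftInvariant]

theorem convProd_x_eq_zero [CharZero k] (hA : IsProunipotent k A) (X : LogCoordinates F)
    (l : List (CoordIndex X.d)) (j : CoordIndex X.d)
    (hl : (j.1 : ℕ) < (l.map fun i => (i.1 : ℕ)).sum) : convProd (l.map X.D) (X.x j) = 0 := by
  have := hA.convProd_compLog_eq_zero F (X.β_mem j) (l.map fun i => ((i.1 : ℕ), X.D i)) ?_ ?_
  · rw [List.map_map] at this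
    exact this
  · intro q hq
    obtain ⟨i, _, rfl⟩ := List.mem_map.1 hq
    exact ⟨i.1.pos, X.D_mem i⟩
  · simpa [List.map_map, Function.comp_def] using hl

theorem D_x (hA : IsProunipotent k A) (X : LogCoordinates F) (i j : CoordIndex X.d) :
    X.D i (X.x j) = if i = j then 1 else 0 :=
  (hA.apply_compLog (X.D_mem i).1 _).trans (X.D_β i j)

theorem counit_x (hA : IsProunipotent k A) (X : LogCoordinates F) (i : CoordIndex X.d) :
    Bialgebra.counitAlgHom k A (X.x i) = 0 := hA.counit_compLog _

theorem aeval_x_surjective (hA : IsProunipotent k A) (X : LogCoordinates F) :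
    Function.Surjective (MvPolynomial.aeval X.x : MvPolynomial _ k →ₐ[k] A) := by
  intro a
  refine hA.mem_of_forall_compLog_mem (MvPolynomial.aeval X.x : MvPolynomial _ k →ₐ[k] A).range
    (fun b => ?_) a
  refine (Submodule.span_le (p := Subalgebra.toSubmodule
    (MvPolynomial.aeval X.x : MvPolynomial _ k →ₐ[k] A).range)).2 ?_ (X.compLog_mem_span b)
  rintro _ ⟨i, rfl⟩
  exact ⟨MvPolynomial.X i, by simp [x]⟩

theorem derivation_x (hA : IsProunipotent k A) (X : LogCoordinates F) (i j : CoordIndex X.d) :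
    Bialgebra.counitAlgHom k A (X.derivation i (X.x j)) = if i = j then 1 else 0 :=
  (counit_leftInvariant _ _).trans (X.D_x hA i j)

/-- The coordinate `x j` is killed at the identity by products of derivations of total weight
greater than `j.1`. -/
theorem weight_iterDerivation_x [CharZero k] (hA : IsProunipotent k A) (X : LogCoordinates F)
    (l : List (CoordIndex X.d)) (j : CoordIndex X.d)
    (hl : (j.1 : ℕ) < (l.map fun i => (i.1 : ℕ)).sum) :
    Bialgebra.counitAlgHom k A (iterDerivation X.derivation l (X.x j)) = 0 := by
  refine (X.counit_iterDerivation l _).trans (X.convProd_x_eq_zero hA _ _ ?_)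
  rwa [List.map_reverse, List.sum_reverse]

theorem aeval_x_injective [CharZero k] (hA : IsProunipotent k A) (X : LogCoordinates F) :
    Function.Injective (MvPolynomial.aeval X.x : MvPolynomial _ k →ₐ[k] A) := by
  rw [injective_iff_map_eq_zero]
  intro P hP
  have h := weight_le_of_iterDerivation_eq_zero (X.counit_x hA) (X.derivation_x hA)
    (w := fun i => (i.1 : ℕ)) (X.weight_iterDerivation_x hA) P 0 (fun l _ => by simp [hP])
  have h0 : ∀ s ∈ P.support, s = 0 := by
    intro s hs
    have h1 := Nat.le_zero.1 (h s hs)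
    rw [Finsupp.weight_apply, Finsupp.sum, Finset.sum_eq_zero_iff] at h1
    by_contra hne
    obtain ⟨i, hi⟩ := Finsupp.support_nonempty_iff.2 hne
    have h2 := h1 i hi
    rw [smul_eq_mul, mul_eq_zero] at h2
    exact h2.elim (Finsupp.mem_support_iff.1 hi) i.1.ne_zero
  have hC : P = MvPolynomial.C (P.coeff 0) := by
    ext s
    rw [MvPolynomial.coeff_C]
    split_ifs with hs
    · rw [hs]
    · exact MvPolynomial.notMem_support_iff.1 fun h => hs (h0 s h).symm
  rw [hC] at hP ⊢
  have := congrArg (Bialgebra.counitAlgHom k A) hP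
  rw [MvPolynomial.aeval_C, AlgHom.commutes, map_zero] at this
  rw [show P.coeff 0 = 0 from this, map_zero]

/-- Points of `U` are the same as families of values of the coordinates. -/
theorem exists_point [CharZero k] (hA : IsProunipotent k A) (X : LogCoordinates F)
    {Λ : Type*} [CommRing Λ] [Algebra k Λ] (c : CoordIndex X.d → Λ) :
    ∃ f : WithConv (A →ₐ[k] Λ), ∀ i, f (X.x i) = c i := by
  let e : MvPolynomial (CoordIndex X.d) k ≃ₐ[k] A :=
    AlgEquiv.ofBijective (MvPolynomial.aeval X.x)
      ⟨X.aeval_x_injective hA, X.aeval_x_surjective hA⟩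
  refine ⟨WithConv.toConv ((MvPolynomial.aeval c).comp e.symm.toAlgHom), fun i => ?_⟩
  have h : e.symm (X.x i) = MvPolynomial.X i := by
    rw [AlgEquiv.symm_apply_eq]
    exact (MvPolynomial.aeval_X X.x i).symm
  change MvPolynomial.aeval c (e.symm (X.x i)) = c i
  rw [h, MvPolynomial.aeval_X]

theorem point_ext (hA : IsProunipotent k A) (X : LogCoordinates F)
    {Λ : Type*} [CommRing Λ] [Algebra k Λ] {f g : WithConv (A →ₐ[k] Λ)}
    (h : ∀ i, f (X.x i) = g (X.x i)) : f = g := by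
  apply WithConv.ofConv_injective
  refine AlgHom.ext fun a => ?_
  obtain ⟨P, rfl⟩ := X.aeval_x_surjective hA a
  have : (f.ofConv.comp (MvPolynomial.aeval X.x)) = g.ofConv.comp (MvPolynomial.aeval X.x) :=
    MvPolynomial.algHom_ext fun i => by simpa using h i
  exact congrArg (fun F : _ →ₐ[k] Λ => F P) this

end LogCoordinates

end CoordinateRing

/-! ### The group law and the action in logarithmic coordinates -/

section GroupLaw

variable {k : Type*} [Field k] {A : Type u} [CommRing A] [HopfAlgebra k A]
  {F : GroupFiltration k A}

section FilterMap

variable {α β : Type*} (a : α) (b : β) (l : List (α ⊕ β))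

theorem filterMap_getLeft_inl : (Sum.inl a :: l).filterMap Sum.getLeft? =
    a :: l.filterMap Sum.getLeft? := rfl

theorem filterMap_getLeft_inr : (Sum.inr b :: l).filterMap Sum.getLeft? =
    l.filterMap Sum.getLeft? := rfl

theorem filterMap_getRight_inl : (Sum.inl a :: l).filterMap Sum.getRight? =
    l.filterMap Sum.getRight? := rfl

theorem filterMap_getRight_inr : (Sum.inr b :: l).filterMap Sum.getRight? =
    b :: l.filterMap Sum.getRight? := rfl

end FilterMap

namespace LogCoordinates

/-- The coordinates `x i ⊗ 1` and `1 ⊗ x i` on `U × U`. -/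
def tensorX (X : LogCoordinates F) : CoordIndex X.d ⊕ CoordIndex X.d → A ⊗[k] A :=
  Sum.elim (fun i => X.x i ⊗ₜ 1) fun i => 1 ⊗ₜ X.x i

/-- The weight of an index of one of the two factors of `U × U`. -/
def tensorWeight {d : ℕ+ → ℕ} : CoordIndex d ⊕ CoordIndex d → ℕ :=
  Sum.elim (fun i => (i.1 : ℕ)) fun i => (i.1 : ℕ)

variable (k A) in
/-- The identity of `U × U`. -/
def tensorCounit : A ⊗[k] A →ₐ[k] k :=
  Algebra.TensorProduct.lift (Bialgebra.counitAlgHom k A) (Bialgebra.counitAlgHom k A)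
    fun _ _ => Commute.all _ _

theorem tensorCounit_tmul (a b : A) : tensorCounit k A (a ⊗ₜ b) =
    Coalgebra.counit (R := k) a * Coalgebra.counit (R := k) b := rfl

theorem tensorCounit_iterDerivation_tmul (X : LogCoordinates F)
    (l : List (CoordIndex X.d ⊕ CoordIndex X.d)) (a b : A) :
    tensorCounit k A (iterDerivation (tensorDerivation X.derivation) l (a ⊗ₜ b)) =
      Coalgebra.counit (R := k) (iterDerivation X.derivation (l.filterMap Sum.getLeft?) a) *
      Coalgebra.counit (R := k) (iterDerivation X.derivation (l.filterMap Sum.getRight?) b) := by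
  rw [iterDerivation_tensorDerivation, TensorProduct.map_tmul, tensorCounit_tmul]

theorem sum_tensorWeight {d : ℕ+ → ℕ} (l : List (CoordIndex d ⊕ CoordIndex d)) :
    (l.map tensorWeight).sum = ((l.filterMap Sum.getLeft?).map fun i => (i.1 : ℕ)).sum +
      ((l.filterMap Sum.getRight?).map fun i => (i.1 : ℕ)).sum := by
  induction l with
  | nil => rfl
  | cons i l ih =>
    cases i <;> simp only [List.map_cons, List.sum_cons, ih, filterMap_getLeft_inl, filterMap_getLeft_inr,
      filterMap_getRight_inl, filterMap_getRight_inr] <;>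
      simp only [tensorWeight, Sum.elim_inl, Sum.elim_inr] <;> omega

/-- Derivatives of a pulled back function at the identity of `U × U` are values of products in the
universal enveloping algebra, the derivations on the first factor coming first. -/
theorem tensorCounit_iterDerivation_comul (X : LogCoordinates F)
    (l : List (CoordIndex X.d ⊕ CoordIndex X.d)) (a : A) :
    tensorCounit k A (iterDerivation (tensorDerivation X.derivation) l (Coalgebra.comul a)) =
      convProd (((l.filterMap Sum.getLeft?).reverse ++
        (l.filterMap Sum.getRight?).reverse).map X.D) a := by
  have h : ∀ t : A ⊗[k] A,
      tensorCounit k A (iterDerivation (tensorDerivation X.derivation) l t) =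
      LinearMap.mul' k k (TensorProduct.map
        (convProd ((l.filterMap Sum.getLeft?).reverse.map X.D)).ofConv
        (convProd ((l.filterMap Sum.getRight?).reverse.map X.D)).ofConv t) := by
    intro t
    induction t using TensorProduct.induction_on with
    | zero => simp
    | add s t hs ht => simp only [map_add, hs, ht]
    | tmul a b =>
      rw [tensorCounit_iterDerivation_tmul, counit_iterDerivation, counit_iterDerivation]
      rfl
  rw [h, List.map_append, convProd_append]
  rfl

theorem aeval_tensorX_surjective (hA : IsProunipotent k A) (X : LogCoordinates F) :
    Function.Surjective (MvPolynomial.aeval X.tensorX : MvPolynomial _ k →ₐ[k] A ⊗[k] A) := by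
  intro t
  induction t using TensorProduct.induction_on with
  | zero => exact ⟨0, map_zero _⟩
  | add s t hs ht =>
    obtain ⟨P, rfl⟩ := hs
    obtain ⟨Q, rfl⟩ := ht
    exact ⟨P + Q, map_add _ _ _⟩
  | tmul a b =>
    obtain ⟨P, rfl⟩ := X.aeval_x_surjective hA a
    obtain ⟨Q, rfl⟩ := X.aeval_x_surjective hA b
    refine ⟨MvPolynomial.rename Sum.inl P * MvPolynomial.rename Sum.inr Q, ?_⟩
    rw [map_mul, MvPolynomial.aeval_rename, MvPolynomial.aeval_rename]
    have h1 : (MvPolynomial.aeval (X.tensorX ∘ Sum.inl) : MvPolynomial _ k →ₐ[k] A ⊗[k] A) =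
        Algebra.TensorProduct.includeLeft.comp (MvPolynomial.aeval X.x) :=
      MvPolynomial.algHom_ext fun i => by simp [tensorX]
    have h2 : (MvPolynomial.aeval (X.tensorX ∘ Sum.inr) : MvPolynomial _ k →ₐ[k] A ⊗[k] A) =
        Algebra.TensorProduct.includeRight.comp (MvPolynomial.aeval X.x) :=
      MvPolynomial.algHom_ext fun i => by simp [tensorX]
    rw [h1, h2]
    simp

theorem tensorCounit_tensorX (hA : IsProunipotent k A) (X : LogCoordinates F)
    (i : CoordIndex X.d ⊕ CoordIndex X.d) : tensorCounit k A (X.tensorX i) = 0 := by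
  have h := X.counit_x hA
  simp only [Bialgebra.counitAlgHom_apply] at h
  cases i <;> simp [tensorX, tensorCounit_tmul, h]

theorem tensorDerivation_tensorX (hA : IsProunipotent k A) (X : LogCoordinates F)
    (i j : CoordIndex X.d ⊕ CoordIndex X.d) :
    tensorCounit k A (tensorDerivation X.derivation i (X.tensorX j)) = if i = j then 1 else 0 := by
  have h1 := X.derivation_x hA
  simp only [Bialgebra.counitAlgHom_apply] at h1
  have h := X.tensorCounit_iterDerivation_tmul [i]
  simp only [iterDerivation, LinearMap.comp_apply, LinearMap.id_apply] at h
  cases i <;> cases j <;> refine (h _ _).trans ?_ <;>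
    simp [iterDerivation, h1, filterMap_getLeft_inr, filterMap_getRight_inl]

theorem iterDerivation_one_eq_zero {B : Type*} [CommRing B] [Algebra k B] {I : Type*}
    (d : I → Derivation k B B) {l : List I} (hl : l ≠ []) : iterDerivation d l 1 = 0 := by
  match l, hl with
  | i :: l, _ =>
    change iterDerivation d l (d i 1) = 0
    simp

theorem weight_iterDerivation_tensorX [CharZero k] (hA : IsProunipotent k A)
    (X : LogCoordinates F) (l : List (CoordIndex X.d ⊕ CoordIndex X.d))
    (j : CoordIndex X.d ⊕ CoordIndex X.d) (hl : tensorWeight j < (l.map tensorWeight).sum) :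
    tensorCounit k A (iterDerivation (tensorDerivation X.derivation) l (X.tensorX j)) = 0 := by
  have h1 := X.weight_iterDerivation_x hA
  simp only [Bialgebra.counitAlgHom_apply] at h1
  rw [sum_tensorWeight] at hl
  cases j with
  | inl j =>
    refine (X.tensorCounit_iterDerivation_tmul _ _ _).trans ?_
    by_cases h : l.filterMap Sum.getRight? = []
    · rw [h] at hl
      rw [h1 _ _ (by simpa [tensorWeight] using hl), zero_mul]
    · rw [iterDerivation_one_eq_zero _ h, map_zero, mul_zero]
  | inr j =>
    refine (X.tensorCounit_iterDerivation_tmul _ _ _).trans ?_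
    by_cases h : l.filterMap Sum.getLeft? = []
    · rw [h] at hl
      rw [h1 _ _ (by simpa [tensorWeight] using hl), mul_zero]
    · rw [iterDerivation_one_eq_zero _ h, map_zero, zero_mul]

/-- The group law in logarithmic coordinates is the sum of the coordinates and a polynomial in the
coordinates of smaller weight, whose monomials have at most the weight of the coordinate. -/
theorem exists_groupLaw [CharZero k] (hA : IsProunipotent k A) (X : LogCoordinates F)
    (i : CoordIndex X.d) : ∃ R : MvPolynomial (CoordIndex X.d ⊕ CoordIndex X.d) k,
      (∀ s ∈ R.support, Finsupp.weight tensorWeight s ≤ (i.1 : ℕ) ∧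
        ∀ v ∈ s.support, tensorWeight v < (i.1 : ℕ)) ∧
      Coalgebra.comul (X.x i) = X.x i ⊗ₜ 1 + 1 ⊗ₜ X.x i + MvPolynomial.aeval X.tensorX R := by
  obtain ⟨R, hR⟩ := X.aeval_tensorX_surjective hA
    (Coalgebra.comul (X.x i) - X.x i ⊗ₜ 1 - 1 ⊗ₜ X.x i)
  have hxl := X.weight_iterDerivation_tensorX hA
  have hw := weight_le_of_iterDerivation_eq_zero (X.tensorCounit_tensorX hA)
    (X.tensorDerivation_tensorX hA) hxl R (i.1 : ℕ) (fun l hl => by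
      have e1 : tensorCounit k A (iterDerivation (tensorDerivation X.derivation) l
        (X.x i ⊗ₜ 1)) = 0 := hxl l (Sum.inl i) hl
      have e2 : tensorCounit k A (iterDerivation (tensorDerivation X.derivation) l
        (1 ⊗ₜ X.x i)) = 0 := hxl l (Sum.inr i) hl
      rw [hR, map_sub, map_sub, map_sub, map_sub, tensorCounit_iterDerivation_comul, e1, e2,
        X.convProd_x_eq_zero hA, sub_zero, sub_zero]
      rw [sum_tensorWeight] at hl
      simpa [List.sum_reverse] using hl)
  refine ⟨R, fun s hs => ⟨hw s hs, fun v hv => ?_⟩, by rw [hR]; abel⟩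
  by_contra hlt
  rw [not_lt] at hlt
  have h1 : ∀ u : CoordIndex X.d ⊕ CoordIndex X.d, 0 < tensorWeight u := by
    rintro (u | u)
    exacts [u.1.pos, u.1.pos]
  have hsum := hw s hs
  rw [Finsupp.weight_apply, Finsupp.sum] at hsum
  -- by the bound on the weight, a monomial with a variable of weight at least `i.1` is that variable;
  -- its coefficient vanishes because the linear part of the comultiplication has been subtracted
  have hs1 : s = Finsupp.single v 1 := by
    have h2 : s v = 1 := by
      have h3 := (Finset.single_le_sum (f := fun u => s u • tensorWeight u)
        (fun _ _ => Nat.zero_le _) hv).trans hsum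
      have h4 : s v ≠ 0 := Finsupp.mem_support_iff.1 hv
      rw [smul_eq_mul] at h3
      by_contra h5
      have h6 : 2 ≤ s v := by omega
      have h7 := Nat.mul_le_mul_right (tensorWeight v) h6
      have := h1 v
      omega
    ext u
    rw [Finsupp.single_apply]
    split_ifs with hu
    · rw [← hu, h2]
    · by_contra h0
      have h3 := (Finset.add_le_sum (f := fun u => s u • tensorWeight u)
        (fun _ _ => Nat.zero_le _) hv (Finsupp.mem_support_iff.2 h0) hu).trans hsum
      have h5 : 0 < s u * tensorWeight u := Nat.mul_pos (Nat.pos_of_ne_zero h0) (h1 u)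
      simp only [smul_eq_mul, h2, one_mul] at h3
      omega
  have hc := MvPolynomial.mem_support_iff.1 hs
  rw [hs1, coeff_single_eq_derivation (X.tensorCounit_tensorX hA)
    (X.tensorDerivation_tensorX hA), hR] at hc
  refine hc ?_
  have hcom := X.tensorCounit_iterDerivation_comul [v] (X.x i)
  simp only [iterDerivation, LinearMap.comp_apply, LinearMap.id_apply] at hcom
  have hl := X.tensorDerivation_tensorX hA v (Sum.inl i)
  have hr := X.tensorDerivation_tensorX hA v (Sum.inr i)
  rw [map_sub, map_sub, map_sub, map_sub]
  refine (congrArg₂ _ (congrArg₂ _ hcom hl) hr).trans ?_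
  have hD := X.D_x hA
  cases v <;> simp [convProd, hD, filterMap_getLeft_inr, filterMap_getRight_inl]

/-- The correction term in the group law in logarithmic coordinates. -/
def groupLaw [CharZero k] (hA : IsProunipotent k A) (X : LogCoordinates F) (i : CoordIndex X.d) :
    MvPolynomial (CoordIndex X.d ⊕ CoordIndex X.d) k := (X.exists_groupLaw hA i).choose

/-- The group law on points in logarithmic coordinates. -/
theorem mul_apply_x [CharZero k] (hA : IsProunipotent k A) (X : LogCoordinates F)
    {Λ : Type*} [CommRing Λ] [Algebra k Λ] (f g : WithConv (A →ₐ[k] Λ)) (i : CoordIndex X.d) :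
    (f * g) (X.x i) = f (X.x i) + g (X.x i) +
      MvPolynomial.aeval (Sum.elim (fun i => f (X.x i)) fun i => g (X.x i)) (X.groupLaw hA i) := by
  have h := (X.exists_groupLaw hA i).choose_spec.2
  let Φ : A ⊗[k] A →ₐ[k] Λ := Algebra.TensorProduct.lift f.ofConv g.ofConv fun _ _ => Commute.all _ _
  have h1 : (f * g) (X.x i) = Φ (Coalgebra.comul (X.x i)) := by
    rw [AlgHom.convMul_apply]
  have h2 : Φ.comp (MvPolynomial.aeval X.tensorX) =
      MvPolynomial.aeval (Sum.elim (fun i => f (X.x i)) fun i => g (X.x i)) :=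
    MvPolynomial.algHom_ext fun j => by cases j <;> simp [tensorX, Φ]
  rw [h1, h, map_add, map_add, ← h2]
  simp [Φ, groupLaw]

/-- A point of `U` is filtered if and only if its coordinates of weight `n` have filtration degree
`n`. -/
theorem isFiltered_iff (hA : IsProunipotent k A) (X : LogCoordinates F)
    {Λ : Type*} [CommRing Λ] [Algebra k Λ] (W : AlgFiltration k Λ) (f : A →ₐ[k] Λ) :
    IsFiltered F.algFiltration W f ↔ ∀ i, f (X.x i) ∈ W.W i.1 := by
  constructor
  · intro h i
    exact h _ _ (Submodule.subset_span ⟨[((i.1 : ℕ), X.x i)],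
      by simpa using ⟨X.β i, X.β_mem i, rfl⟩, by simp, by simp⟩)
  · intro h n
    have hlog : ∀ (m : ℕ) (a : A), a ∈ F.J (m + 1) → f (compLog k A a) ∈ W.W m := by
      intro m a ha
      rcases Nat.eq_zero_or_pos m with rfl | hm
      · rw [zero_add, F.J_one] at ha
        have : compLog k A a = 0 := by
          rw [(Submodule.mem_bot A).1 ha]
          simpa using hA.compLog_smul 0 0
        rw [this, map_zero]
        exact Submodule.zero_mem _
      · rw [X.compLog_eq ⟨m, hm⟩ a ha, map_sum]
        refine Submodule.sum_mem _ fun i hi => ?_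
        rw [map_smul]
        exact Submodule.smul_mem _ _ (W.mono (mem_indicesLE.1 hi) (h i))
    refine (Submodule.span_le (p := (W.W n).comap f.toLinearMap)).2 ?_
    rintro _ ⟨l, hl, hle, rfl⟩
    refine W.mono hle ?_
    change f (l.map Prod.snd).prod ∈ _
    clear hle
    induction l with
    | nil => simpa using W.one_mem
    | cons q l ih =>
      simp only [List.map_cons, List.prod_cons, map_mul, List.sum_cons]
      obtain ⟨a, ha, hq⟩ := hl q (by simp)
      refine W.mul_mem ?_ (ih fun q hq => hl q (by simp [hq]))
      rw [← hq]
      exact hlog _ a ha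

variable {G : Type u} [Group G]

/-- The matrix of the linear action of `g` on the coordinates of points. -/
def actMatrix (X : LogCoordinates F) (ρ : G →* (A →ₐc[k] A)) (g : G) (i j : CoordIndex X.d) : k :=
  X.D j (ρ g⁻¹ (X.β i))

theorem map_x (hA : IsProunipotent k A) (X : LogCoordinates F) {ρ : G →* (A →ₐc[k] A)}
    (hF : F.IsStable ρ) (g : G) (i : CoordIndex X.d) :
    ρ g⁻¹ (X.x i) = ∑ j ∈ indicesLE X.d i.1, X.actMatrix ρ g i j • X.x j := by
  rw [x, hA.map_compLog, X.compLog_eq i.1 _ (hF _ _ _ (X.β_mem i))]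
  rfl

theorem actPoint_apply_x (hA : IsProunipotent k A) (X : LogCoordinates F) {ρ : G →* (A →ₐc[k] A)}
    (hF : F.IsStable ρ) {Λ : Type*} [CommRing Λ] [Algebra k Λ] (g : G)
    (f : WithConv (A →ₐ[k] Λ)) (i : CoordIndex X.d) :
    actPoint ρ g f (X.x i) = ∑ j ∈ indicesLE X.d i.1, X.actMatrix ρ g i j • f (X.x j) := by
  change f.ofConv (ρ g⁻¹ (X.x i)) = _
  rw [X.map_x hA hF, map_sum]
  exact Finset.sum_congr rfl fun j _ => map_smul _ _ _

/-- The entries of the matrix of the action are recovered from the orbit of the point with a single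
non-zero coordinate, equal to `1`. -/
theorem continuous_actMatrix [CharZero k] [TopologicalSpace k] [TopologicalSpace G]
    (hA : IsProunipotent k A) (X : LogCoordinates F)
    {ρ : G →* (A →ₐc[k] A)} (hF : F.IsStable ρ) (hρ : IsContinuousAction ρ)
    (i j : CoordIndex X.d) (hij : j.1 ≤ i.1) : Continuous fun g => X.actMatrix ρ g i j := by
  obtain ⟨y, hy⟩ := X.exists_point hA (Λ := k) fun l => if l = j then 1 else 0
  let t : TopologicalSpace (WithConv (A →ₐ[k] k)) := pointTopology A k inferInstance
  have h1 : Continuous fun q : G × WithConv (A →ₐ[k] k) => actPoint ρ q.1 q.2 := hρ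
  have h2 : Continuous fun g : G => actPoint ρ g y :=
    h1.comp (continuous_id.prodMk continuous_const)
  have h3 := (continuous_point_iff _ _).1 h2 (X.x i)
  convert h3 using 2 with g
  rw [X.actPoint_apply_x hA hF, Finset.sum_eq_single j]
  · simp [hy]
  · intro l _ hl
    simp [hy, hl]
  · intro h
    exact absurd (mem_indicesLE.2 hij) h

end LogCoordinates

end GroupLaw

/-! ### Continuous functions with values in the direct limit topology -/

section ContinuousFunctions

variable {k : Type*} [Field k] [TopologicalSpace k] [IsTopologicalRing k]

/-- The functions `∑ᵢ pᵢ • lᵢ` on `X` with continuous scalar functions `pᵢ` and `lᵢ ∈ Λ`: the image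
of `C(X, k) ⊗ Λ` in the algebra of functions from `X` to `Λ`. -/
def tensorFunctions (k : Type*) [Field k] [TopologicalSpace k] [IsTopologicalRing k]
    (X : Type*) [TopologicalSpace X] (Λ : Type*) [CommRing Λ] [Algebra k Λ] :
    Subalgebra k (X → Λ) :=
  (Algebra.TensorProduct.lift
    ((AlgHom.pi (R := k) (A := fun _ : X => Λ) fun x => (Algebra.ofId k Λ).comp (Pi.evalAlgHom k (fun _ => k) x)).comp
      (continuousSubalgebra (α := X) (R := k) (A := k)).val)
    (Pi.constAlgHom k X Λ) fun _ _ => Commute.all _ _).range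

variable {X Y : Type*} [TopologicalSpace X] [TopologicalSpace Y] {Λ : Type*} [CommRing Λ]
  [Algebra k Λ]

theorem smul_mem_tensorFunctions {p : X → k} (hp : Continuous p) (l : Λ) :
    (fun x => p x • l) ∈ tensorFunctions k X Λ := by
  refine ⟨(⟨p, hp⟩ : continuousSubalgebra (α := X) (R := k) (A := k)) ⊗ₜ l, ?_⟩
  ext x
  simp [Algebra.smul_def, Algebra.ofId_apply]

theorem tensorFunctions_induction {Q : (X → Λ) → Prop}
    (smul : ∀ (p : X → k) (l : Λ), Continuous p → Q fun x => p x • l)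
    (add : ∀ f g, Q f → Q g → Q (f + g)) {f : X → Λ} (hf : f ∈ tensorFunctions k X Λ) : Q f := by
  obtain ⟨t, rfl⟩ := hf
  have h0 := smul 0 0 continuous_const
  induction t using TensorProduct.induction_on with
  | zero =>
    convert h0 using 1
    rw [map_zero]
    ext x
    simp
  | add s t hs ht =>
    rw [map_add]
    exact add _ _ hs ht
  | tmul p l =>
    convert smul p.1 l p.2 using 1
    ext x
    simp [Algebra.smul_def, Algebra.ofId_apply]

theorem const_mem_tensorFunctions (l : Λ) : (fun _ => l) ∈ tensorFunctions k X Λ := by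
  simpa using smul_mem_tensorFunctions (k := k) (X := X) (p := fun _ => 1) continuous_const l

theorem comp_mem_tensorFunctions {f : X → Λ} (hf : f ∈ tensorFunctions k X Λ) {τ : Y → X}
    (hτ : Continuous τ) : (fun y => f (τ y)) ∈ tensorFunctions k Y Λ := by
  refine tensorFunctions_induction (Q := fun f => (fun y => f (τ y)) ∈ tensorFunctions k Y Λ)
    (fun p l hp => smul_mem_tensorFunctions (hp.comp hτ) l) (fun f g hf hg => ?_) hf
  exact add_mem hf hg

theorem smul_fun_mem_tensorFunctions {p : X → k} (hp : Continuous p) {f : X → Λ}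
    (hf : f ∈ tensorFunctions k X Λ) : (fun x => p x • f x) ∈ tensorFunctions k X Λ := by
  convert mul_mem (smul_mem_tensorFunctions hp (1 : Λ)) hf using 1
  ext x
  simp

theorem map_mem_tensorFunctions {Λ' : Type*} [CommRing Λ'] [Algebra k Λ'] (φ : Λ →ₗ[k] Λ')
    {f : X → Λ} (hf : f ∈ tensorFunctions k X Λ) :
    (fun x => φ (f x)) ∈ tensorFunctions k X Λ' := by
  refine tensorFunctions_induction (Q := fun f => (fun x => φ (f x)) ∈ tensorFunctions k X Λ')
    (fun p l hp => ?_) (fun f g hf hg => ?_) hf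
  · simpa using smul_mem_tensorFunctions hp (φ l)
  · convert add_mem hf hg using 1
    ext x
    simp

theorem continuous_of_mem_tensorFunctions {f : X → k} (hf : f ∈ tensorFunctions k X k) :
    Continuous f :=
  tensorFunctions_induction (Q := Continuous) (fun _ _ hp => hp.mul continuous_const)
    (fun _ _ hf hg => hf.add hg) hf

theorem aeval_mem_tensorFunctions {I : Type*} {c : X → I → Λ}
    (P : MvPolynomial I k) (hc : ∀ i ∈ P.vars, (fun x => c x i) ∈ tensorFunctions k X Λ) :
    (fun x => MvPolynomial.aeval (c x) P) ∈ tensorFunctions k X Λ := by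
  have h : (fun x => MvPolynomial.aeval (c x) P) =
      ∑ s ∈ P.support, P.coeff s • ∏ i ∈ s.support, (fun x => c x i) ^ s i := by
    ext x
    rw [MvPolynomial.aeval_def, MvPolynomial.eval₂_eq]
    simp [Finset.sum_apply, Finset.prod_apply, Algebra.smul_def]
  rw [h]
  refine sum_mem fun s hs => Subalgebra.smul_mem _ (prod_mem fun i hi => pow_mem (hc i ?_) _) _
  exact (MvPolynomial.mem_vars_iff_mem_support _).2 ⟨s, hs, hi⟩

theorem mem_tensorFunctions_prod_fin {n : ℕ} {f : X × Fin n → Λ}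
    (hf : ∀ j, (fun x => f (x, j)) ∈ tensorFunctions k X Λ) : f ∈ tensorFunctions k (X × Fin n) Λ := by
  have h : f = ∑ j, fun q : X × Fin n => (if q.2 = j then (1 : k) else 0) • f (q.1, j) := by
    ext ⟨x, i⟩
    simp [Finset.sum_apply]
  rw [h]
  refine sum_mem fun j _ => smul_fun_mem_tensorFunctions (f := fun q : X × Fin n => f (q.1, j)) ?_
    (comp_mem_tensorFunctions (hf j) continuous_fst)
  exact (continuous_of_discreteTopology (f := fun i : Fin n => if i = j then (1 : k) else 0)).comp
    continuous_snd

theorem continuous_linearMap_finiteTopology (θ : Module.Dual k Λ) :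
    @Continuous _ _ (finiteTopology k Λ) _ θ := by
  unfold finiteTopology
  rw [continuous_iSup_dom]
  rintro ⟨S, hS⟩
  rw [continuous_coinduced_dom]
  let _ := moduleTopology k S
  have _ : IsModuleTopology k S := ⟨rfl⟩
  exact IsModuleTopology.continuous_of_linearMap (θ.comp S.subtype)

/-- A linearly independent set meets every finite-dimensional subspace in a finite set. -/
theorem isClosed_finiteTopology_of_linearIndependent [T1Space k] {b s : Set Λ}
    (hb : LinearIndependent k ((↑) : b → Λ)) (hs : s ⊆ b) : @IsClosed _ (finiteTopology k Λ) s := by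
  unfold finiteTopology
  rw [isClosed_iSup_iff]
  rintro ⟨S, hS⟩
  rw [isClosed_coinduced]
  let _ := moduleTopology k S
  have _ : IsModuleTopology k S := ⟨rfl⟩
  have hfin : ((↑) ⁻¹' s : Set S).Finite := by
    have h1 : LinearIndependent k ((↑) : ((↑) ⁻¹' s : Set S) → S) := by
      have h2 := LinearIndependent.comp hb (fun x : (Subtype.val ⁻¹' s : Set S) => (⟨x.1.1, hs x.2⟩ : b))
        fun x y h => Subtype.ext (Subtype.ext (congrArg (fun z : b => (z : Λ)) h))
      exact h2.of_comp S.subtype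
    exact h1.setFinite
  have h1 : ∀ x : S, IsClosed ({x} : Set S) := by
    intro x
    have h2 : ({x} : Set S) = ⋂ θ : Module.Dual k S, θ ⁻¹' {θ x} := by
      ext y
      simp only [Set.mem_singleton_iff, Set.mem_iInter, Set.mem_preimage]
      refine ⟨fun h θ => by rw [h], fun h => ?_⟩
      rw [← sub_eq_zero, ← Module.forall_dual_apply_eq_zero_iff k]
      intro θ
      rw [map_sub, h, sub_self]
    rw [h2]
    exact isClosed_iInter fun θ => isClosed_singleton.preimage
      (IsModuleTopology.continuous_of_linearMap θ)
  rw [← Set.biUnion_of_singleton ((↑) ⁻¹' s : Set S)]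
  exact hfin.isClosed_biUnion fun x _ => h1 x

/-- A continuous map from a compact space to the direct limit of the finite-dimensional subspaces of
`Λ` has values in one of them: an infinite linearly independent subset of the image would be
closed and discrete. -/
theorem finiteDimensional_span_range [T1Space k] [CompactSpace X] {f : X → Λ}
    (hf : @Continuous _ _ _ (finiteTopology k Λ) f) :
    FiniteDimensional k (Submodule.span k (Set.range f)) := by
  let _ := finiteTopology k Λ
  obtain ⟨b, hb, hspan, hli⟩ := exists_linearIndependent k (Set.range f)
  rw [← hspan]
  have hcl : ∀ s ⊆ b, IsClosed s := fun s hs =>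
    isClosed_finiteTopology_of_linearIndependent hli hs
  have hcomp : IsCompact b := (isCompact_range hf).of_isClosed_subset (hcl b subset_rfl) hb
  have hfin : b.Finite := by
    refine hcomp.finite ⟨?_⟩
    refine discreteTopology_iff_forall_isClosed.2 fun s => ?_
    exact isClosed_induced_iff.2 ⟨(↑) '' s, hcl _ (by simp),
      Set.preimage_image_eq s Subtype.val_injective⟩
  exact FiniteDimensional.span_of_finite k hfin

/-- A continuous map from a compact space to `Λ` is a finite sum of continuous scalar functions
times elements of `Λ`. -/
theorem mem_tensorFunctions_of_continuous [T1Space k] [CompactSpace X] {f : X → Λ}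
    (hf : @Continuous _ _ _ (finiteTopology k Λ) f) : f ∈ tensorFunctions k X Λ := by
  have hfin := finiteDimensional_span_range hf
  let b := Module.finBasis k (Submodule.span k (Set.range f))
  choose θ hθ using fun i => LinearMap.exists_extend (b.coord i)
  have h : f = ∑ i, fun x => θ i (f x) • (b i : Λ) := by
    ext x
    let y : Submodule.span k (Set.range f) := ⟨f x, Submodule.subset_span ⟨x, rfl⟩⟩
    have h1 := congrArg Subtype.val (b.sum_repr y)
    rw [Finset.sum_apply]
    refine Eq.trans h1.symm ?_
    rw [AddSubmonoidClass.coe_finsetSum]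
    refine Finset.sum_congr rfl fun i _ => ?_
    have h2 := LinearMap.congr_fun (hθ i) y
    simp only [LinearMap.comp_apply, Submodule.subtype_apply, Module.Basis.coord_apply] at h2
    rw [Submodule.coe_smul, ← h2]
  rw [h]
  exact sum_mem fun i _ => smul_mem_tensorFunctions
    (@Continuous.comp _ _ _ _ (finiteTopology k Λ) _ _ _ (continuous_linearMap_finiteTopology (θ i)) hf) _

/-- The converse of `mem_tensorFunctions_of_continuous`, for arbitrary spaces. -/
theorem continuous_finiteTopology_of_mem {f : X → Λ} (hf : f ∈ tensorFunctions k X Λ) :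
    @Continuous _ _ _ (finiteTopology k Λ) f := by
  have h : ∃ (ι : Type) (_ : Fintype ι) (p : X → ι → k) (l : ι → Λ), Continuous p ∧
      f = fun x => ∑ i, p x i • l i := by
    refine tensorFunctions_induction (Q := fun f => ∃ (ι : Type) (_ : Fintype ι) (p : X → ι → k)
      (l : ι → Λ), Continuous p ∧ f = fun x => ∑ i, p x i • l i) (fun p l hp => ?_) (fun f g hf hg => ?_) hf
    · exact ⟨Unit, inferInstance, fun x _ => p x, fun _ => l, by fun_prop, by simp⟩
    · obtain ⟨ι, _, p, l, hp, rfl⟩ := hf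
      obtain ⟨ι', _, p', l', hp', rfl⟩ := hg
      refine ⟨ι ⊕ ι', inferInstance, fun x => Sum.elim (p x) (p' x), Sum.elim l l', ?_, ?_⟩
      · refine continuous_pi fun i => ?_
        cases i
        · exact (continuous_apply _).comp hp
        · exact (continuous_apply _).comp hp'
      · ext x
        simp
  obtain ⟨ι, _, p, l, hp, rfl⟩ := h
  let L : (ι → k) →ₗ[k] Λ := Fintype.linearCombination k l
  let T : {S : Submodule k Λ // FiniteDimensional k S} := ⟨LinearMap.range L, inferInstance⟩
  unfold finiteTopology
  refine continuous_iSup_rng (i := T) ?_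
  let _ : TopologicalSpace (LinearMap.range L) := moduleTopology k (LinearMap.range L)
  have _ : IsModuleTopology k (LinearMap.range L) := ⟨rfl⟩
  have _ := IsModuleTopology.toContinuousAdd k (LinearMap.range L)
  have _ := IsModuleTopology.toContinuousSMul k (LinearMap.range L)
  have h : Continuous L.rangeRestrict := IsModuleTopology.continuous_of_linearMap _
  let _ : TopologicalSpace Λ :=
    TopologicalSpace.coinduced (Subtype.val : LinearMap.range L → Λ) inferInstance
  have h' : Continuous (Subtype.val : LinearMap.range L → Λ) := continuous_coinduced_rng
  exact (h'.comp h).comp hp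

end ContinuousFunctions

/-! ### Extension of linear operators -/

section Extension

variable {k : Type*} [Field k] {X Y : Type*} {Λ : Type*} [AddCommGroup Λ] [Module k Λ]

/-- The function `ψ` with values in `Λ` is obtained from `φ` by the linear operator `L` on scalar
functions: this holds after composition with every linear form on `Λ`. -/
def IsExtension (L : (X → k) →ₗ[k] (Y → k)) (φ : X → Λ) (ψ : Y → Λ) : Prop :=
  ∀ θ : Module.Dual k Λ, (fun y => θ (ψ y)) = L fun x => θ (φ x)

theorem funext_dual {φ ψ : X → Λ} (h : ∀ θ : Module.Dual k Λ, (fun x => θ (φ x)) = fun x => θ (ψ x)) :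
    φ = ψ := by
  ext x
  rw [← sub_eq_zero, ← Module.forall_dual_apply_eq_zero_iff k]
  intro θ
  rw [map_sub, sub_eq_zero]
  exact congrFun (h θ) x

theorem IsExtension.unique {L : (X → k) →ₗ[k] (Y → k)} {φ : X → Λ} {ψ ψ' : Y → Λ}
    (h : IsExtension L φ ψ) (h' : IsExtension L φ ψ') : ψ = ψ' :=
  funext_dual fun θ => (h θ).trans (h' θ).symm

/-- Extensions preserve subspaces, because a subspace is an intersection of kernels of linear forms.
-/
theorem IsExtension.mem {L : (X → k) →ₗ[k] (Y → k)} {φ : X → Λ} {ψ : Y → Λ}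
    (h : IsExtension L φ ψ) {W : Submodule k Λ} (hφ : ∀ x, φ x ∈ W) (y : Y) : ψ y ∈ W := by
  by_contra hy
  obtain ⟨θ, hθ, hle⟩ := Submodule.exists_le_ker_of_notMem hy
  refine hθ ?_
  have h1 : (fun x => θ (φ x)) = 0 := funext fun x => hle (hφ x)
  have := congrFun (h θ) y
  rw [h1, map_zero] at this
  exact this

open Classical in
/-- The extension of a linear operator on scalar functions to functions with values in `Λ`; it is
zero if there is none. -/
def extend (L : (X → k) →ₗ[k] (Y → k)) (φ : X → Λ) : Y → Λ :=
  if h : ∃ ψ, IsExtension L φ ψ then h.choose else 0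

theorem extend_mem {L : (X → k) →ₗ[k] (Y → k)} {φ : X → Λ} {W : Submodule k Λ}
    (hφ : ∀ x, φ x ∈ W) (y : Y) : extend L φ y ∈ W := by
  unfold extend
  split_ifs with h
  · exact h.choose_spec.mem hφ y
  · exact W.zero_mem

end Extension

section Extension

variable {k : Type*} [Field k] [TopologicalSpace k] [IsTopologicalRing k] {X Y : Type*}
  [TopologicalSpace X] [TopologicalSpace Y] {Λ : Type*} [CommRing Λ] [Algebra k Λ]

/-- A finite sum `∑ p • l` extends `L` by `∑ L p • l`. -/
theorem exists_isExtension (L : (X → k) →ₗ[k] (Y → k)) {φ : X → Λ}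
    (hφ : φ ∈ tensorFunctions k X Λ) : ∃ ψ, IsExtension L φ ψ ∧
      ((∀ p, Continuous (L p)) → ψ ∈ tensorFunctions k Y Λ) := by
  refine tensorFunctions_induction (Q := fun φ => ∃ ψ, IsExtension L φ ψ ∧
      ((∀ p, Continuous (L p)) → ψ ∈ tensorFunctions k Y Λ)) (fun p l _ => ?_)
      (fun f g hf hg => ?_) hφ
  · refine ⟨fun y => L p y • l, fun θ => ?_, fun hL => smul_mem_tensorFunctions (hL p) l⟩
    have h1 : (fun x => θ (p x • l)) = θ l • p := by
      ext x
      simp [mul_comm]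
    rw [h1, map_smul]
    ext y
    simp [mul_comm]
  · obtain ⟨ψ, h, hc⟩ := hf
    obtain ⟨ψ', h', hc'⟩ := hg
    refine ⟨ψ + ψ', fun θ => ?_, fun hL => add_mem (hc hL) (hc' hL)⟩
    have h1 : (fun x => θ ((f + g) x)) = (fun x => θ (f x)) + fun x => θ (g x) := by
      ext x
      simp
    rw [h1, map_add, ← h θ, ← h' θ]
    ext y
    simp

theorem isExtension_extend (L : (X → k) →ₗ[k] (Y → k)) {φ : X → Λ}
    (hφ : φ ∈ tensorFunctions k X Λ) : IsExtension L φ (extend L φ) := by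
  obtain ⟨ψ, h, -⟩ := exists_isExtension L hφ
  have h : ∃ ψ, IsExtension L φ ψ := ⟨ψ, h⟩
  unfold extend
  rw [dif_pos h]
  exact h.choose_spec

theorem extend_mem_tensorFunctions (L : (X → k) →ₗ[k] (Y → k)) (hL : ∀ p, Continuous (L p))
    {φ : X → Λ} (hφ : φ ∈ tensorFunctions k X Λ) : extend L φ ∈ tensorFunctions k Y Λ := by
  obtain ⟨ψ, h, hψ⟩ := exists_isExtension L hφ
  rw [(isExtension_extend L hφ).unique h]
  exact hψ hL

end Extension

/-! ### Splitting of the complex of continuous cochains -/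

section Splitting

variable {k : Type*} [Field k]

/-- Projection to the kernel of `δ` on `K`, and an inverse of `δ` on the complement of this kernel
that is cut out by the projection. -/
theorem exists_splitting {E E' : Type*} [AddCommGroup E] [Module k E] [AddCommGroup E']
    [Module k E'] (δ : E →ₗ[k] E') (K : Submodule k E) {h : ℕ}
    (b : Module.Basis (Fin h) k (K ⊓ LinearMap.ker δ : Submodule k E)) :
    ∃ (π : E →ₗ[k] (Fin h → k)) (s : E' →ₗ[k] E), (∀ a, π (b a) = Pi.single a 1) ∧
      (∀ y, s y ∈ K) ∧ (∀ y, π (s y) = 0) ∧ ∀ c ∈ K, c = s (δ c) + ∑ a, π c a • (b a : E) := by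
  obtain ⟨π, hπ⟩ := LinearMap.exists_extend b.equivFun.toLinearMap
  have hπ' : ∀ c : (K ⊓ LinearMap.ker δ : Submodule k E), π c = b.equivFun c := fun c =>
    LinearMap.congr_fun hπ c
  have hb : ∀ a, π (b a) = Pi.single a 1 := fun a => by
    rw [hπ']
    ext a'
    simp [Pi.single_apply, eq_comm]
  let K' : Submodule k E := K ⊓ LinearMap.ker π
  have hinj : LinearMap.ker (δ.comp K'.subtype) = ⊥ := by
    refine LinearMap.ker_eq_bot'.2 fun c hc => ?_
    have h1 := hπ' ⟨c.1, c.2.1, hc⟩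
    have h2 : π c = 0 := c.2.2
    change π c = _ at h1
    rw [h2] at h1
    have h3 := (LinearEquiv.map_eq_zero_iff _).1 h1.symm
    exact Subtype.ext (congrArg (fun z => z.1) h3)
  obtain ⟨t, ht⟩ := LinearMap.exists_leftInverse_of_injective _ hinj
  refine ⟨π, K'.subtype.comp t, hb, fun y => (t y).2.1, fun y => (t y).2.2, fun c hc => ?_⟩
  have hδ : δ (∑ a, π c a • (b a : E)) = 0 := by
    rw [map_sum]
    refine Finset.sum_eq_zero fun a _ => ?_
    rw [map_smul, show δ (b a) = 0 from (b a).2.2, smul_zero]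
  have hmem : c - ∑ a, π c a • (b a : E) ∈ K' := by
    refine ⟨sub_mem hc (sum_mem fun a _ => Submodule.smul_mem _ _ (b a).2.1), ?_⟩
    change π _ = 0
    rw [map_sub, map_sum, sub_eq_zero]
    simp only [map_smul, hb]
    ext a
    simp [Finset.sum_apply, Pi.single_apply]
  have h1 := LinearMap.congr_fun ht ⟨_, hmem⟩
  have h2 := congrArg Subtype.val h1
  simp only [LinearMap.comp_apply, Submodule.subtype_apply, map_sub, hδ, sub_zero,
    LinearMap.id_apply] at h2 ⊢
  rw [h2]
  abel

variable {G : Type*} [Group G] {d : ℕ}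

/-- The coboundary `g ↦ g v - v` of a vector, for a group acting on `kᵈ` by matrices; functions
with values in `kᵈ` are regarded as scalar functions with one more argument. -/
def vectorCoboundary (M : G → Matrix (Fin d) (Fin d) k) : (Fin d → k) →ₗ[k] (G × Fin d → k) where
  toFun v q := ∑ j, M q.1 q.2 j * v j - v q.2
  map_add' v w := by
    ext q
    simp only [Pi.add_apply, mul_add, Finset.sum_add_distrib]
    ring
  map_smul' r v := by
    ext q
    simp only [Pi.smul_apply, smul_eq_mul, RingHom.id_apply, mul_sub, Finset.mul_sum]
    exact congrArg₂ _ (Finset.sum_congr rfl fun _ _ => by ring) rfl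

/-- The differential `(g, h) ↦ c(gh) - c(g) - g c(h)` of a 1-cochain. -/
def cochainDifferential (M : G → Matrix (Fin d) (Fin d) k) :
    (G × Fin d → k) →ₗ[k] ((G × G) × Fin d → k) where
  toFun c q := c (q.1.1 * q.1.2, q.2) - c (q.1.1, q.2) - ∑ j, M q.1.1 q.2 j * c (q.1.2, j)
  map_add' v w := by
    ext q
    simp only [Pi.add_apply, mul_add, Finset.sum_add_distrib]
    ring
  map_smul' r v := by
    ext q
    simp only [Pi.smul_apply, smul_eq_mul, RingHom.id_apply, mul_sub, Finset.mul_sum]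
    exact congrArg₂ _ rfl (Finset.sum_congr rfl fun _ _ => by ring)

variable [TopologicalSpace k] [IsTopologicalRing k] [TopologicalSpace G]

/-- The continuous cochains annihilated by `lam`. -/
def normalizedCochains (lam : (G × Fin d → k) →ₗ[k] (Fin d → k)) :
    Submodule k (G × Fin d → k) where
  carrier := {c | Continuous c ∧ lam c = 0}
  add_mem' hc hc' := ⟨hc.1.add hc'.1, by rw [map_add, hc.2, hc'.2, add_zero]⟩
  zero_mem' := ⟨continuous_const, map_zero _⟩
  smul_mem' r c hc := ⟨hc.1.const_smul r, by rw [map_smul, hc.2, smul_zero]⟩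

/-- A splitting of the complex of continuous cochains of `G` with values in `kᵈ` in degree at most
one, for a group without non-zero invariants. A left inverse `lam` of the differential in degree
zero defines the normalized cochains; `eta` is a basis of the normalized cocycles, `pi` gives the
coordinates with respect to this basis and `s` inverts the differential. -/
structure CohomologySplitting (M : G → Matrix (Fin d) (Fin d) k) (h : ℕ) where
  lam : (G × Fin d → k) →ₗ[k] (Fin d → k)
  eta : Fin h → G × Fin d → k
  pi : (G × Fin d → k) →ₗ[k] (Fin h → k)
  s : ((G × G) × Fin d → k) →ₗ[k] (G × Fin d → k)
  lam_coboundary : ∀ v, lam (vectorCoboundary M v) = v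
  continuous_eta : ∀ a, Continuous (eta a)
  lam_eta : ∀ a, lam (eta a) = 0
  pi_eta : ∀ a, pi (eta a) = Pi.single a 1
  continuous_s : ∀ y, Continuous (s y)
  lam_s : ∀ y, lam (s y) = 0
  pi_s : ∀ y, pi (s y) = 0
  eq_add : ∀ c, Continuous c → lam c = 0 →
    c = s (cochainDifferential M c) + ∑ a, pi c a • eta a

theorem nonempty_cohomologySplitting {M : G → Matrix (Fin d) (Fin d) k} {h : ℕ}
    (lam : (G × Fin d → k) →ₗ[k] (Fin d → k)) (hlam : ∀ v, lam (vectorCoboundary M v) = v)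
    (b : Module.Basis (Fin h) k
      (normalizedCochains lam ⊓ LinearMap.ker (cochainDifferential M) : Submodule k _)) :
    Nonempty (CohomologySplitting M h) := by
  obtain ⟨π, s, h1, h2, h3, h4⟩ := exists_splitting (cochainDifferential M) (normalizedCochains lam) b
  exact ⟨{
    lam := lam
    eta := fun a => b a
    pi := π
    s := s
    lam_coboundary := hlam
    continuous_eta := fun a => (b a).2.1.1
    lam_eta := fun a => (b a).2.1.2
    pi_eta := h1
    continuous_s := fun y => (h2 y).1
    lam_s := fun y => (h2 y).2
    pi_s := h3
    eq_add := fun c hc hl => h4 c ⟨hc, hl⟩ }⟩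

/-- If a representation of `G` on `V` is given by the matrices `M` in the coordinates `Φ`, and has
no non-zero invariants, then every continuous cohomology class with values in `V` contains exactly
one normalized cocycle. -/
theorem nonempty_normalizedCocycles_equiv {M : G → Matrix (Fin d) (Fin d) k}
    {V : Type*} [AddCommGroup V] [Module k V] (σ : Representation k G V) (Φ : V ≃ₗ[k] (Fin d → k))
    (hΦ : ∀ g v i, Φ (σ g v) i = ∑ j, M g i j * Φ v j)
    (hM : ∀ i j, Continuous fun g => M g i j)
    (lam : (G × Fin d → k) →ₗ[k] (Fin d → k)) (hlam : ∀ v, lam (vectorCoboundary M v) = v) :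
    Nonempty ((normalizedCochains lam ⊓ LinearMap.ker (cochainDifferential M) : Submodule k _) ≃ₗ[k]
      ContH1 σ) := by
  have hcont : ∀ c : G → V, @Continuous G V _ (moduleTopology k V) c ↔
      Continuous fun q : G × Fin d => Φ (c q.1) q.2 := by
    intro c
    let _ := moduleTopology k V
    have _ : IsModuleTopology k V := ⟨rfl⟩
    have _ := IsModuleTopology.toContinuousAdd k V
    have _ := IsModuleTopology.toContinuousSMul k V
    have h1 : Continuous Φ := IsModuleTopology.continuous_of_linearMap Φ.toLinearMap
    have h2 : Continuous Φ.symm := IsModuleTopology.continuous_of_linearMap Φ.symm.toLinearMap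
    constructor
    · intro h
      refine continuous_prod_of_discrete_right.2 fun i => ?_
      exact (continuous_apply i).comp (h1.comp h)
    · intro h
      have h3 : Continuous fun g => Φ (c g) :=
        continuous_pi fun i => h.comp (continuous_id.prodMk continuous_const)
      convert h2.comp h3 using 1
      exact funext fun g => (Φ.symm_apply_apply _).symm
  let Z : Submodule k (G × Fin d → k) :=
    normalizedCochains lam ⊓ LinearMap.ker (cochainDifferential M)
  have hΦ' : ∀ g v, Φ (σ g v) = fun i => ∑ j, M g i j * Φ v j := fun g v => funext (hΦ g v)
  have hΦs : ∀ g w, Φ.symm (fun i => ∑ j, M g i j * w j) = σ g (Φ.symm w) := fun g w => by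
    rw [LinearEquiv.symm_apply_eq, hΦ']
    simp
  let Ψ : Z →ₗ[k] contZ1 σ :=
    { toFun := fun c => ⟨fun g => Φ.symm fun i => c.1 (g, i), by
        refine ⟨(hcont _).2 (by simpa using c.2.1.1), fun g h => ?_⟩
        rw [← hΦs, ← map_add]
        refine congrArg Φ.symm (funext fun i => ?_)
        have h1 := congrFun (show cochainDifferential M c.1 = 0 from c.2.2) ((g, h), i)
        simp only [cochainDifferential, LinearMap.coe_mk, AddHom.coe_mk, Pi.zero_apply] at h1
        simp only [Pi.add_apply]
        linear_combination h1⟩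
      map_add' := fun c c' => Subtype.ext (funext fun g => map_add Φ.symm _ _)
      map_smul' := fun r c => Subtype.ext (funext fun g => map_smul Φ.symm _ _) }
  let q : contZ1 σ →ₗ[k] ContH1 σ := ((coboundaries σ).submoduleOf (contZ1 σ)).mkQ
  refine ⟨LinearEquiv.ofBijective (q.comp Ψ) ⟨?_, ?_⟩⟩
  · rw [← LinearMap.ker_eq_bot, LinearMap.ker_eq_bot']
    intro c hc
    obtain ⟨v, hv⟩ : (Ψ c : G → V) ∈ coboundaries σ := by
      have h1 := (Submodule.Quotient.mk_eq_zero _).1 hc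
      exact h1
    have h1 : c.1 = vectorCoboundary M (Φ v) := by
      ext ⟨g, i⟩
      have h2 := congrFun (congrArg Φ (congrFun hv g)) i
      simp only [LinearMap.pi_apply, LinearMap.sub_apply, LinearMap.id_apply, map_sub, hΦ'] at h2
      refine Eq.trans ?_ h2.symm
      simp [Ψ]
    have h2 := hlam (Φ v)
    rw [← h1, show lam c.1 = 0 from c.2.1.2] at h2
    refine Subtype.ext ?_
    rw [h1, ← h2, map_zero]
    rfl
  · intro y
    obtain ⟨⟨c, hc, hmul⟩, rfl⟩ := Submodule.mkQ_surjective _ y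
    let c' : G × Fin d → k := fun q => Φ (c q.1) q.2
    -- subtracting the coboundary of `lam c'` normalizes the cocycle
    let v := lam c'
    have hMc : Continuous (vectorCoboundary M v) := by
      refine continuous_prod_of_discrete_right.2 fun i => ?_
      simp only [vectorCoboundary, LinearMap.coe_mk, AddHom.coe_mk]
      fun_prop
    have hz : c' - vectorCoboundary M v =
        fun q => Φ (c q.1 - (σ q.1 (Φ.symm v) - Φ.symm v)) q.2 := by
      ext ⟨g, i⟩
      simp [c', hΦ', vectorCoboundary]
    let z : Z := ⟨c' - vectorCoboundary M v, ⟨((hcont c).1 hc).sub hMc, by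
      rw [map_sub, hlam, sub_self]⟩, by
      change cochainDifferential M _ = 0
      rw [hz]
      ext ⟨⟨g, h⟩, i⟩
      simp only [cochainDifferential, LinearMap.coe_mk, AddHom.coe_mk, Pi.zero_apply]
      rw [← hΦ, hmul, map_mul, Module.End.mul_apply, ← Pi.sub_apply, ← Pi.sub_apply, ← map_sub,
        ← map_sub]
      have h0 : c g + σ g (c h) - (σ g (σ h (Φ.symm v)) - Φ.symm v) -
          (c g - (σ g (Φ.symm v) - Φ.symm v)) - σ g (c h - (σ h (Φ.symm v) - Φ.symm v)) = 0 := by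
        simp only [map_sub]
        abel
      rw [h0, map_zero]
      rfl⟩
    refine ⟨z, (Submodule.Quotient.eq _).2 ⟨-Φ.symm v, ?_⟩⟩
    ext g
    apply Φ.injective
    ext i
    simp [Ψ, z, c', hΦ', vectorCoboundary]
    ring

end Splitting

/-! ### Coordinates on the graded pieces -/

/-- Coordinates on `S` that vanish exactly on `T` are coordinates on the subquotient, in which the
action is given by the same matrices. -/
theorem exists_subquotient_equiv {k : Type*} [Field k] {M : Type*} [AddCommGroup M] [Module k M]
    {G : Type*} [Group G] (σ : Representation k G M) (S T : Submodule k M)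
    (hS : ∀ g, S ≤ S.comap (σ g)) (hT : ∀ g, T ≤ T.comap (σ g)) {d : ℕ}
    (e : S →ₗ[k] (Fin d → k)) (he : Function.Surjective e) (hker : ∀ x : S, e x = 0 ↔ x.1 ∈ T)
    (N : G → Matrix (Fin d) (Fin d) k)
    (hN : ∀ g (x : S) i, e ⟨σ g x, hS g x.2⟩ i = ∑ j, N g i j * e x j) :
    ∃ Φ : Subquotient S T ≃ₗ[k] (Fin d → k),
      ∀ g v i, Φ (subquotientRep σ S T hS hT g v) i = ∑ j, N g i j * Φ v j := by
  have h1 : T.submoduleOf S = LinearMap.ker e := by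
    ext x
    exact (hker x).symm
  let Φ : Subquotient S T ≃ₗ[k] (Fin d → k) :=
    (Submodule.quotEquivOfEq _ _ h1).trans (e.quotKerEquivOfSurjective he)
  have hΦ : ∀ x : S, Φ (Submodule.Quotient.mk x : S ⧸ T.submoduleOf S) = e x := fun x => rfl
  refine ⟨Φ, fun g v i => ?_⟩
  obtain ⟨x, rfl⟩ := Submodule.Quotient.mk_surjective (T.submoduleOf S) v
  rw [hΦ, ← hN]
  rfl

section

variable {k : Type*} [Field k] {A : Type u} [CommRing A] [HopfAlgebra k A]
  {F : GroupFiltration k A} {G : Type u} [Group G]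

namespace LogCoordinates

/-- The matrix of the action of `g` on the coordinates of weight `n`. -/
def levelMatrix (X : LogCoordinates F) (ρ : G →* (A →ₐc[k] A)) (n : ℕ+) (g : G) :
    Matrix (Fin (X.d n)) (Fin (X.d n)) k := fun i j => X.actMatrix ρ g ⟨n, i⟩ ⟨n, j⟩

/-- The values of a tangent vector in `W_{-n} Lie(U)` on the coordinates of weight `n` are
coordinates on `V_n`. -/
theorem exists_levelEquiv (hA : IsProunipotent k A) (X : LogCoordinates F)
    {ρ : G →* (A →ₐc[k] A)} (hF : F.IsStable ρ) (n : ℕ+) :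
    ∃ Φ : F.V n ≃ₗ[k] (Fin (X.d n) → k),
      ∀ g v i, Φ (F.rep hF n g v) i = ∑ j, X.levelMatrix ρ n g i j * Φ v j := by
  let e : F.lie n →ₗ[k] (Fin (X.d n) → k) :=
    { toFun := fun D j => D.1 (X.β ⟨n, j⟩)
      map_add' := fun _ _ => rfl
      map_smul' := fun _ _ => rfl }
  refine exists_subquotient_equiv (dualRep ρ) (F.lie n) (F.lie (n + 1)) _ _ e ?_ ?_ _ ?_
  · intro v
    refine ⟨∑ j, v j • ⟨X.D ⟨n, j⟩, X.D_mem ⟨n, j⟩⟩, ?_⟩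
    ext i
    simp [e, X.D_β]
  · intro D
    constructor
    · intro h
      exact X.lie_eq_zero n D.1 D.2 fun j => congrFun h j
    · intro h
      ext j
      exact h.2 _ (X.β_mem ⟨n, j⟩)
  · intro g D i
    change D.1 (ρ g⁻¹ (X.β ⟨n, i⟩)) = ∑ j, X.actMatrix ρ g ⟨n, i⟩ ⟨n, j⟩ * D.1 (X.β ⟨n, j⟩)
    have h1 := X.compLog_eq n _ (hF g⁻¹ _ _ (X.β_mem ⟨n, i⟩))
    have h2 : ∀ a, D.1 (compLog k A a) = D.1 a := hA.apply_compLog D.2.1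
    have h3 := congrArg D.1 h1
    rw [h2, map_sum, sum_indicesLE] at h3
    rw [h3, Finset.sum_eq_zero (s := indicesLT X.d n), add_zero]
    · refine Finset.sum_congr rfl fun j _ => ?_
      rw [map_smul, h2]
      rfl
    · intro j hj
      have h4 : (j.1 : ℕ) + 1 ≤ n := mem_indicesLT.1 hj
      rw [map_smul, h2, D.2.2 _ (F.mono h4 (X.β_mem j)), smul_zero]

/-- The absence of invariants in `V_n` makes the differential of 0-cochains injective, so that it
has a left inverse. -/
theorem nonempty_splitting [CharZero k] [TopologicalSpace k] [IsTopologicalRing k]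
    [TopologicalSpace G] (hA : IsProunipotent k A)
    (X : LogCoordinates F) {ρ : G →* (A →ₐc[k] A)} (hρ : IsContinuousAction ρ) (hF : F.IsStable ρ)
    (n : ℕ+) (hH0 : (F.rep hF n).invariants = ⊥)
    (hH1 : FiniteDimensional k (ContH1 (F.rep hF n))) :
    Nonempty (CohomologySplitting (X.levelMatrix ρ n)
      (Module.finrank k (ContH1 (F.rep hF n)))) := by
  obtain ⟨Φ, hΦ⟩ := X.exists_levelEquiv hA hF n
  have hinj : LinearMap.ker (vectorCoboundary (X.levelMatrix ρ n)) = ⊥ := by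
    refine LinearMap.ker_eq_bot'.2 fun v hv => ?_
    have h1 : Φ.symm v ∈ (F.rep hF n).invariants := by
      intro g
      apply Φ.injective
      ext i
      rw [hΦ]
      have h2 := congrFun hv (g, i)
      simp only [vectorCoboundary, LinearMap.coe_mk, AddHom.coe_mk, Pi.zero_apply] at h2
      simpa [sub_eq_zero] using h2
    rw [hH0, Submodule.mem_bot] at h1
    simpa using h1
  obtain ⟨lam, hlam⟩ := LinearMap.exists_leftInverse_of_injective _ hinj
  have hlam' : ∀ v, lam (vectorCoboundary (X.levelMatrix ρ n) v) = v :=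
    fun v => LinearMap.congr_fun hlam v
  obtain ⟨e⟩ := nonempty_normalizedCocycles_equiv (F.rep hF n) Φ hΦ
    (fun i j => X.continuous_actMatrix hA hF hρ _ _ le_rfl) lam hlam'
  exact nonempty_cohomologySplitting lam hlam' ((Module.finBasis k _).map e.symm)

end LogCoordinates

end

/-! ### Recursion on the weight -/

section Recursion

variable {I M : Type*} {w : I → ℕ+} {T : (I → M) → I → M}

/-- An operator whose value at `i` only depends on the values at indices of smaller weight has a
fixed point. -/
theorem exists_fixedPoint [Nonempty M]
    (hT : ∀ c c' i, (∀ j, w j < w i → c j = c' j) → T c i = T c' i) : ∃ c, T c = c := by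
  classical
  -- an arbitrary value at the indices that are not of smaller weight, on which `T` does not depend
  let m : M := Classical.arbitrary M
  have hwf : WellFounded fun i j : I => w i < w j := InvImage.wf w wellFounded_lt
  let step : ∀ i, (∀ j, w j < w i → M) → M :=
    fun i rec => T (fun j => if h : w j < w i then rec j h else m) i
  refine ⟨hwf.fix step, funext fun i => ?_⟩
  rw [hwf.fix_eq]
  exact hT _ _ i fun j hj => by rw [dif_pos hj]

theorem fixedPoint_unique (hT : ∀ c c' i, (∀ j, w j < w i → c j = c' j) → T c i = T c' i)
    {c c' : I → M} (hc : T c = c) (hc' : T c' = c') : c = c' := by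
  have hwf : WellFounded fun i j : I => w i < w j := InvImage.wf w wellFounded_lt
  refine funext fun i => hwf.induction (C := fun i => c i = c' i) i fun i ih => ?_
  rw [← hc, ← hc']
  exact hT _ _ i ih

end Recursion

theorem weight_induction {d : ℕ+ → ℕ} {P : CoordIndex d → Prop}
    (h : ∀ i, (∀ j : CoordIndex d, j.1 < i.1 → P j) → P i) (i : CoordIndex d) : P i :=
  (InvImage.wf (fun i : CoordIndex d => i.1) wellFounded_lt).induction (C := P) i h

/-- A polynomial whose monomials have weight at most `n`, evaluated at elements of filtration
degrees equal to the weights, has filtration degree `n`. -/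
theorem aeval_mem_filtration {k : Type*} [Field k] {Λ : Type*} [CommRing Λ] [Algebra k Λ]
    {I : Type*} (W : AlgFiltration k Λ) (P : MvPolynomial I k) {w : I → ℕ}
    {n : ℕ} (hP : ∀ s ∈ P.support, Finsupp.weight w s ≤ n) {a : I → Λ}
    (ha : ∀ i ∈ P.vars, a i ∈ W.W (w i)) : MvPolynomial.aeval a P ∈ W.W n := by
  rw [MvPolynomial.aeval_def, MvPolynomial.eval₂_eq]
  refine sum_mem fun s hs => ?_
  rw [← Algebra.smul_def]
  refine Submodule.smul_mem _ _ (W.mono (hP s hs) ?_)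
  rw [Finsupp.weight_apply, Finsupp.sum]
  have hpow : ∀ (x : Λ) (m r : ℕ), x ∈ W.W m → x ^ r ∈ W.W (r * m) := by
    intro x m r hx
    induction r with
    | zero => simpa using W.one_mem
    | succ r ih =>
      rw [pow_succ, Nat.succ_mul]
      exact W.mul_mem ih hx
  have hv : ∀ i ∈ s.support, a i ∈ W.W (w i) := fun i hi =>
    ha i ((MvPolynomial.mem_vars_iff_mem_support _).2 ⟨s, hs, hi⟩)
  clear hs
  generalize s.support = t at hv
  induction t using Finset.cons_induction with
  | empty => simpa using W.one_mem
  | cons i t hi ih =>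
    rw [Finset.prod_cons, Finset.sum_cons]
    exact W.mul_mem (hpow _ _ _ (hv i (by simp))) (ih fun j hj => hv j (Finset.mem_cons_of_mem hj))

/-! ### The action and the group law on families of coordinates -/

section Coordinates

variable {k : Type*} [Field k] {A : Type u} [CommRing A] [HopfAlgebra k A]
  {F : GroupFiltration k A} {G : Type u} [Group G]

namespace LogCoordinates

section Action

variable (X : LogCoordinates F) (ρ : G →* (A →ₐc[k] A)) {Λ : Type*} [CommRing Λ] [Algebra k Λ]

/-- The coordinates of the translate by `g` of the point with coordinates `a`. -/
def actCoord (g : G) (a : CoordIndex X.d → Λ) (i : CoordIndex X.d) : Λ :=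
  ∑ j ∈ indicesLE X.d i.1, X.actMatrix ρ g i j • a j

/-- The contribution to `actCoord` of the coordinates of smaller weight. -/
def actLow (g : G) (a : CoordIndex X.d → Λ) (i : CoordIndex X.d) : Λ :=
  ∑ j ∈ indicesLT X.d i.1, X.actMatrix ρ g i j • a j

theorem actCoord_eq (g : G) (a : CoordIndex X.d → Λ) (n : ℕ+) (j : Fin (X.d n)) :
    X.actCoord ρ g a ⟨n, j⟩ = ∑ l, X.levelMatrix ρ n g j l • a ⟨n, l⟩ + X.actLow ρ g a ⟨n, j⟩ :=
  sum_indicesLE n _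

theorem actLow_congr (g : G) {a a' : CoordIndex X.d → Λ} {i : CoordIndex X.d}
    (ha : ∀ j, j.1 < i.1 → a j = a' j) : X.actLow ρ g a i = X.actLow ρ g a' i :=
  Finset.sum_congr rfl fun j hj => by rw [ha j (mem_indicesLT.1 hj)]

theorem actCoord_congr (g : G) {a a' : CoordIndex X.d → Λ} {i : CoordIndex X.d}
    (ha : ∀ j, j.1 ≤ i.1 → a j = a' j) : X.actCoord ρ g a i = X.actCoord ρ g a' i :=
  Finset.sum_congr rfl fun j hj => by rw [ha j (mem_indicesLE.1 hj)]

theorem map_actLow {Λ' : Type*} [CommRing Λ'] [Algebra k Λ'] (f : Λ →ₗ[k] Λ') (g : G)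
    (a : CoordIndex X.d → Λ) (i : CoordIndex X.d) :
    f (X.actLow ρ g a i) = X.actLow ρ g (fun j => f (a j)) i := by
  simp [actLow]

theorem map_actCoord {Λ' : Type*} [CommRing Λ'] [Algebra k Λ'] (f : Λ →ₗ[k] Λ') (g : G)
    (a : CoordIndex X.d → Λ) (i : CoordIndex X.d) :
    f (X.actCoord ρ g a i) = X.actCoord ρ g (fun j => f (a j)) i := by
  simp [actCoord]

theorem actLow_mem (W : AlgFiltration k Λ) (g : G) {a : CoordIndex X.d → Λ} {i : CoordIndex X.d}
    (ha : ∀ j, j.1 < i.1 → a j ∈ W.W j.1) : X.actLow ρ g a i ∈ W.W i.1 :=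
  sum_mem fun j hj => Submodule.smul_mem _ _
    (W.mono (le_of_lt (mem_indicesLT.1 hj)) (ha j (mem_indicesLT.1 hj)))

theorem actCoord_mem (W : AlgFiltration k Λ) (g : G) {a : CoordIndex X.d → Λ} {i : CoordIndex X.d}
    (ha : ∀ j, j.1 ≤ i.1 → a j ∈ W.W j.1) : X.actCoord ρ g a i ∈ W.W i.1 :=
  sum_mem fun j hj => Submodule.smul_mem _ _
    (W.mono (mem_indicesLE.1 hj) (ha j (mem_indicesLE.1 hj)))

end Action

section Law

variable [CharZero k] (hA : IsProunipotent k A) (X : LogCoordinates F) {Λ : Type*} [CommRing Λ]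
  [Algebra k Λ]

/-- The point of `U` with given coordinates. -/
def point (c : CoordIndex X.d → Λ) : WithConv (A →ₐ[k] Λ) := (X.exists_point hA c).choose

theorem point_apply_x (c : CoordIndex X.d → Λ) (i : CoordIndex X.d) :
    X.point hA c (X.x i) = c i := (X.exists_point hA c).choose_spec i

/-- The correction term in the product of the points with coordinates `a` and `b`. -/
def mulLow (a b : CoordIndex X.d → Λ) (i : CoordIndex X.d) : Λ :=
  MvPolynomial.aeval (Sum.elim a b) (X.groupLaw hA i)

theorem tensorWeight_lt_of_mem_vars {i : CoordIndex X.d} {v : CoordIndex X.d ⊕ CoordIndex X.d}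
    (hv : v ∈ (X.groupLaw hA i).vars) : tensorWeight v < (i.1 : ℕ) := by
  obtain ⟨s, hs, hvs⟩ := (MvPolynomial.mem_vars_iff_mem_support _).1 hv
  exact ((X.exists_groupLaw hA i).choose_spec.1 s hs).2 v hvs

theorem mulLow_congr {a a' b b' : CoordIndex X.d → Λ} {i : CoordIndex X.d}
    (ha : ∀ j, j.1 < i.1 → a j = a' j) (hb : ∀ j, j.1 < i.1 → b j = b' j) :
    X.mulLow hA a b i = X.mulLow hA a' b' i := by
  refine MvPolynomial.eval₂Hom_congr' rfl ?_ rfl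
  intro v hv _
  have h := X.tensorWeight_lt_of_mem_vars hA hv
  cases v with
  | inl j => exact ha j h
  | inr j => exact hb j h

theorem map_mulLow {Λ' : Type*} [CommRing Λ'] [Algebra k Λ'] (f : Λ →ₐ[k] Λ')
    (a b : CoordIndex X.d → Λ) (i : CoordIndex X.d) :
    f (X.mulLow hA a b i) = X.mulLow hA (fun j => f (a j)) (fun j => f (b j)) i := by
  unfold mulLow
  rw [← AlgHom.comp_apply, MvPolynomial.comp_aeval]
  congr 2
  ext v
  cases v <;> rfl

theorem mulLow_mem (W : AlgFiltration k Λ) {a b : CoordIndex X.d → Λ} {i : CoordIndex X.d}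
    (ha : ∀ j, j.1 < i.1 → a j ∈ W.W j.1) (hb : ∀ j, j.1 < i.1 → b j ∈ W.W j.1) :
    X.mulLow hA a b i ∈ W.W i.1 := by
  refine aeval_mem_filtration W _
    (fun s hs => ((X.exists_groupLaw hA i).choose_spec.1 s hs).1) fun v hv => ?_
  have h := X.tensorWeight_lt_of_mem_vars hA hv
  cases v with
  | inl j => exact ha j h
  | inr j => exact hb j h

variable [TopologicalSpace k] [IsTopologicalRing k] {Y : Type*} [TopologicalSpace Y]

theorem mulLow_mem_tensorFunctions {a b : CoordIndex X.d → Y → Λ} {i : CoordIndex X.d}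
    (ha : ∀ j, j.1 < i.1 → a j ∈ tensorFunctions k Y Λ)
    (hb : ∀ j, j.1 < i.1 → b j ∈ tensorFunctions k Y Λ) :
    (fun y => X.mulLow hA (fun j => a j y) (fun j => b j y) i) ∈ tensorFunctions k Y Λ := by
  refine aeval_mem_tensorFunctions (c := fun y => Sum.elim (fun j => a j y) fun j => b j y) _
    fun v hv => ?_
  have h := X.tensorWeight_lt_of_mem_vars hA hv
  cases v with
  | inl j => exact ha j h
  | inr j => exact hb j h

end Law

section Continuity

variable {ρ : G →* (A →ₐc[k] A)} {Λ : Type*} [CommRing Λ] [Algebra k Λ]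
  [TopologicalSpace k] [IsTopologicalRing k] {Y : Type*} [TopologicalSpace Y] [TopologicalSpace G]

theorem actLow_mem_tensorFunctions [CharZero k] (hA : IsProunipotent k A) (X : LogCoordinates F)
    (hF : F.IsStable ρ) (hρ : IsContinuousAction ρ)
    {a : CoordIndex X.d → Y → Λ} {i : CoordIndex X.d} {τ : Y → G} (hτ : Continuous τ)
    (ha : ∀ j, j.1 < i.1 → a j ∈ tensorFunctions k Y Λ) :
    (fun y => X.actLow ρ (τ y) (fun j => a j y) i) ∈ tensorFunctions k Y Λ := by
  have h : (fun y => X.actLow ρ (τ y) (fun j => a j y) i) =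
      ∑ j ∈ indicesLT X.d i.1, fun y => X.actMatrix ρ (τ y) i j • a j y := by
    ext y
    rw [Finset.sum_apply]
    rfl
  rw [h]
  exact sum_mem fun j hj => smul_fun_mem_tensorFunctions
    ((X.continuous_actMatrix hA hF hρ i j (le_of_lt (mem_indicesLT.1 hj))).comp hτ)
    (ha j (mem_indicesLT.1 hj))

theorem actCoord_mem_tensorFunctions [CharZero k] (hA : IsProunipotent k A) (X : LogCoordinates F)
    (hF : F.IsStable ρ) (hρ : IsContinuousAction ρ)
    {a : CoordIndex X.d → Y → Λ} {i : CoordIndex X.d} {τ : Y → G} (hτ : Continuous τ)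
    (ha : ∀ j, j.1 ≤ i.1 → a j ∈ tensorFunctions k Y Λ) :
    (fun y => X.actCoord ρ (τ y) (fun j => a j y) i) ∈ tensorFunctions k Y Λ := by
  have h : (fun y => X.actCoord ρ (τ y) (fun j => a j y) i) =
      ∑ j ∈ indicesLE X.d i.1, fun y => X.actMatrix ρ (τ y) i j • a j y := by
    ext y
    rw [Finset.sum_apply]
    rfl
  rw [h]
  exact sum_mem fun j hj => smul_fun_mem_tensorFunctions
    ((X.continuous_actMatrix hA hF hρ i j (mem_indicesLE.1 hj)).comp hτ)
    (ha j (mem_indicesLE.1 hj))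

end Continuity

end LogCoordinates

end Coordinates

/-! ### Normalized cochains -/

section Cochains

variable {k : Type*} [Field k] [CharZero k] {A : Type u} [CommRing A]
  [HopfAlgebra k A] {F : GroupFiltration k A} {G : Type u} [Group G]

namespace LogCoordinates

section Obstruction

variable (hA : IsProunipotent k A) (X : LogCoordinates F) (ρ : G →* (A →ₐc[k] A))
  {Λ : Type*} [CommRing Λ] [Algebra k Λ]

/-- The cocycle relation for a cochain with values in `U(Λ)`, given by its coordinates. -/
def IsCoordCocycle (c : CoordIndex X.d → G → Λ) : Prop :=
  ∀ g g' i, c i (g * g') = c i g + X.actCoord ρ g (fun j => c j g') i +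
    X.mulLow hA (fun j => c j g) (X.actCoord ρ g fun j => c j g') i

/-- For a cocycle `c`, the differential of its component of weight `n`: a polynomial in the
components of smaller weight. -/
def obstruction (c : CoordIndex X.d → G → Λ) (n : ℕ+) (q : (G × G) × Fin (X.d n)) : Λ :=
  X.actLow ρ q.1.1 (fun j => c j q.1.2) ⟨n, q.2⟩ +
    X.mulLow hA (fun j => c j q.1.1) (X.actCoord ρ q.1.1 fun j => c j q.1.2) ⟨n, q.2⟩

variable {ρ}

theorem obstruction_congr {c c' : CoordIndex X.d → G → Λ} {n : ℕ+}
    (h : ∀ j, j.1 < n → c j = c' j) : X.obstruction hA ρ c n = X.obstruction hA ρ c' n := by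
  ext q
  refine congrArg₂ _ (X.actLow_congr ρ _ fun j hj => by rw [h j hj]) ?_
  exact X.mulLow_congr hA (fun j hj => by rw [h j hj]) fun j hj =>
    X.actCoord_congr ρ _ fun l hl => by rw [h l (lt_of_le_of_lt hl hj)]

theorem map_obstruction {Λ' : Type*} [CommRing Λ'] [Algebra k Λ'] (f : Λ →ₐ[k] Λ')
    (c : CoordIndex X.d → G → Λ) (n : ℕ+) (q : (G × G) × Fin (X.d n)) :
    f (X.obstruction hA ρ c n q) = X.obstruction hA ρ (fun i g => f (c i g)) n q := by
  unfold obstruction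
  rw [map_add, X.map_mulLow hA, ← f.toLinearMap_apply, X.map_actLow ρ]
  congr 2
  ext j
  exact X.map_actCoord ρ f.toLinearMap _ _ j

theorem obstruction_mem (W : AlgFiltration k Λ) {c : CoordIndex X.d → G → Λ} {n : ℕ+}
    (h : ∀ j, j.1 < n → ∀ g, c j g ∈ W.W j.1) (q : (G × G) × Fin (X.d n)) :
    X.obstruction hA ρ c n q ∈ W.W n :=
  add_mem (X.actLow_mem ρ W (i := ⟨n, q.2⟩) _ fun j hj => h j hj _)
    (X.mulLow_mem hA W (i := ⟨n, q.2⟩) (fun j hj => h j hj _) fun _ hj =>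
      X.actCoord_mem ρ W _ fun l hl => h l (lt_of_le_of_lt hl hj) _)

/-- The component of weight `n` of the cocycle relation, after composition with a linear form. -/
theorem differential_of_isCoordCocycle {c : CoordIndex X.d → G → Λ}
    (hc : X.IsCoordCocycle hA ρ c) (n : ℕ+) (θ : Module.Dual k Λ) :
    (cochainDifferential (X.levelMatrix ρ n) fun q => θ (c ⟨n, q.2⟩ q.1)) =
      fun q => θ (X.obstruction hA ρ c n q) := by
  ext ⟨⟨g, g'⟩, i⟩
  simp only [cochainDifferential, LinearMap.coe_mk, AddHom.coe_mk, obstruction]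
  rw [hc g g' ⟨n, i⟩, X.actCoord_eq]
  simp only [map_add, map_sum, map_smul, smul_eq_mul]
  ring

theorem obstruction_mem_tensorFunctions [TopologicalSpace k] [IsTopologicalRing k]
    [TopologicalSpace G] (hF : F.IsStable ρ) (hρ : IsContinuousAction ρ)
    {c : CoordIndex X.d → G → Λ} {n : ℕ+} (h : ∀ j, j.1 < n → c j ∈ tensorFunctions k G Λ) :
    X.obstruction hA ρ c n ∈ tensorFunctions k ((G × G) × Fin (X.d n)) Λ := by
  refine mem_tensorFunctions_prod_fin fun i => ?_
  have h1 := X.actLow_mem_tensorFunctions hA hF hρ (i := ⟨n, i⟩)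
    (a := fun j (q : G × G) => c j q.2) (τ := Prod.fst) continuous_fst
    fun j hj => comp_mem_tensorFunctions (h j hj) continuous_snd
  have h2 := X.mulLow_mem_tensorFunctions hA (i := ⟨n, i⟩) (a := fun j (q : G × G) => c j q.1)
    (b := fun j (q : G × G) => X.actCoord ρ q.1 (fun l => c l q.2) j)
    (fun j hj => comp_mem_tensorFunctions (h j hj) continuous_fst) fun j hj =>
      X.actCoord_mem_tensorFunctions hA hF hρ (a := fun j (q : G × G) => c j q.2)
        (τ := Prod.fst) continuous_fst fun l hl =>
          comp_mem_tensorFunctions (h l (lt_of_le_of_lt hl hj)) continuous_snd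
  exact add_mem h1 h2

end Obstruction

section Universal

variable [TopologicalSpace k] [TopologicalSpace G]
  (hA : IsProunipotent k A) {X : LogCoordinates F} {ρ : G →* (A →ₐc[k] A)} {h : ℕ+ → ℕ}
  (S : ∀ n, CohomologySplitting (X.levelMatrix ρ n) (h n))
  {Λ : Type*} [CommRing Λ] [Algebra k Λ]

/-- A cochain with values in `U(Λ)` is normalized if its components of every weight are. -/
def IsNormalized (c : CoordIndex X.d → G → Λ) : Prop :=
  ∀ n (θ : Module.Dual k Λ), (S n).lam (fun q => θ (c ⟨n, q.2⟩ q.1)) = 0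

/-- The recursion that determines a normalized cochain by its coordinates `y` with respect to the
bases of the normalized cocycles of all weights. -/
def cochainStep (y : CoordIndex h → Λ) (c : CoordIndex X.d → G → Λ) (i : CoordIndex X.d) (g : G) : Λ :=
  extend (S i.1).s (X.obstruction hA ρ c i.1) (g, i.2) + ∑ a, (S i.1).eta a (g, i.2) • y ⟨i.1, a⟩

theorem cochainStep_congr (y : CoordIndex h → Λ) (c c' : CoordIndex X.d → G → Λ)
    (i : CoordIndex X.d) (hc : ∀ j, j.1 < i.1 → c j = c' j) :
    cochainStep hA S y c i = cochainStep hA S y c' i := by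
  ext g
  unfold cochainStep
  rw [X.obstruction_congr hA hc]

/-- The normalized cochain with coordinates `y`. It need not be a cocycle, but every normalized
cocycle is of this form. -/
def cochain (y : CoordIndex h → Λ) : CoordIndex X.d → G → Λ :=
  (exists_fixedPoint (cochainStep_congr hA S y)).choose

theorem cochain_eq (y : CoordIndex h → Λ) : cochainStep hA S y (cochain hA S y) = cochain hA S y :=
  (exists_fixedPoint (cochainStep_congr hA S y)).choose_spec

theorem cochain_mem (W : AlgFiltration k Λ) {y : CoordIndex h → Λ} (hy : ∀ a, y a ∈ W.W a.1)
    (i : CoordIndex X.d) (g : G) : cochain hA S y i g ∈ W.W i.1 := by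
  induction i using weight_induction generalizing g with
  | h i ih =>
    rw [← cochain_eq]
    exact add_mem (extend_mem (X.obstruction_mem hA W ih) _)
      (sum_mem fun a _ => Submodule.smul_mem _ _ (hy ⟨i.1, a⟩))

variable [IsTopologicalRing k] (hF : F.IsStable ρ) (hρ : IsContinuousAction ρ)

include hF hρ

theorem cochain_mem_tensorFunctions (y : CoordIndex h → Λ) (i : CoordIndex X.d) :
    cochain hA S y i ∈ tensorFunctions k G Λ := by
  induction i using weight_induction with
  | h i ih =>
    rw [← cochain_eq]
    have h1 : cochainStep hA S y (cochain hA S y) i =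
        (fun g => extend (S i.1).s (X.obstruction hA ρ (cochain hA S y) i.1) (g, i.2)) +
        ∑ a, fun g => (S i.1).eta a (g, i.2) • y ⟨i.1, a⟩ := by
      ext g
      simp [cochainStep, Finset.sum_apply]
    rw [h1]
    refine add_mem ?_ (sum_mem fun a _ => smul_mem_tensorFunctions
      (((S i.1).continuous_eta a).comp (by fun_prop)) _)
    exact comp_mem_tensorFunctions (extend_mem_tensorFunctions _ (S i.1).continuous_s
      (X.obstruction_mem_tensorFunctions hA hF hρ ih)) (τ := fun g => (g, i.2)) (by fun_prop)

/-- The recursion for `cochain` after composition with a linear form, where `extend` can be replaced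
by the scalar operator. -/
theorem dual_cochain (y : CoordIndex h → Λ) (n : ℕ+) (θ : Module.Dual k Λ) :
    (fun q : G × Fin (X.d n) => θ (cochain hA S y ⟨n, q.2⟩ q.1)) =
      (S n).s (fun q => θ (X.obstruction hA ρ (cochain hA S y) n q)) +
        ∑ a, θ (y ⟨n, a⟩) • (S n).eta a := by
  have h1 := isExtension_extend (S n).s (X.obstruction_mem_tensorFunctions hA hF hρ (n := n)
    fun j _ => cochain_mem_tensorFunctions hA S hF hρ y j) θ
  rw [← h1]
  ext q
  have h2 := congrFun (congrFun (cochain_eq hA S y) ⟨n, q.2⟩) q.1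
  rw [← h2]
  simp [cochainStep, Finset.sum_apply, mul_comm]

/-- A cochain is `cochain y` as soon as it satisfies the recursion after composition with all linear
forms. -/
theorem eq_cochain {y : CoordIndex h → Λ} {c : CoordIndex X.d → G → Λ}
    (hc : ∀ n (θ : Module.Dual k Λ), (fun q : G × Fin (X.d n) => θ (c ⟨n, q.2⟩ q.1)) =
      (S n).s (fun q => θ (X.obstruction hA ρ c n q)) + ∑ a, θ (y ⟨n, a⟩) • (S n).eta a) :
    c = cochain hA S y := by
  ext i g
  induction i using weight_induction generalizing g with
  | h i ih =>
    have h1 : (fun q : G × Fin (X.d i.1) => c ⟨i.1, q.2⟩ q.1) =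
        fun q => cochain hA S y ⟨i.1, q.2⟩ q.1 := by
      refine funext_dual (k := k) fun θ => ?_
      rw [hc, dual_cochain hA S hF hρ, X.obstruction_congr hA fun j hj => funext (ih j hj)]
    exact congrFun h1 (g, i.2)

/-- The formation of `cochain` is compatible with all homomorphisms of algebras. -/
theorem map_cochain {Λ' : Type*} [CommRing Λ'] [Algebra k Λ'] (f : Λ →ₐ[k] Λ')
    (y : CoordIndex h → Λ) :
    (fun i g => f (cochain hA S y i g)) = cochain hA S fun a => f (y a) := by
  refine eq_cochain hA S hF hρ fun n θ => ?_
  refine (dual_cochain hA S hF hρ y n (θ.comp f.toLinearMap)).trans ?_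
  simp only [← X.map_obstruction hA f]
  rfl

theorem isNormalized_cochain (y : CoordIndex h → Λ) : IsNormalized S (cochain hA S y) := by
  intro n θ
  rw [dual_cochain hA S hF hρ, map_add, map_sum, (S n).lam_s, zero_add]
  exact Finset.sum_eq_zero fun a _ => by rw [map_smul, (S n).lam_eta, smul_zero]

/-- The coordinates `y` are recovered from `cochain y`. -/
theorem pi_cochain (y : CoordIndex h → Λ) (n : ℕ+) (θ : Module.Dual k Λ) (a : Fin (h n)) :
    (S n).pi (fun q => θ (cochain hA S y ⟨n, q.2⟩ q.1)) a = θ (y ⟨n, a⟩) := by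
  rw [dual_cochain hA S hF hρ, map_add, map_sum, (S n).pi_s, zero_add]
  simp [Finset.sum_apply, (S n).pi_eta, Pi.single_apply]

theorem cochain_injective : Function.Injective
    (cochain hA S : (CoordIndex h → Λ) → CoordIndex X.d → G → Λ) := by
  intro y y' hy
  ext ⟨n, a⟩
  have h1 : (fun _ : Unit => y ⟨n, a⟩) = fun _ => y' ⟨n, a⟩ := funext_dual (k := k) fun θ => by
    rw [← pi_cochain hA S hF hρ, ← pi_cochain hA S hF hρ, hy]
  exact congrFun h1 ()

/-- Every normalized cocycle has coordinates with respect to the bases of the normalized cocycles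
of all weights. -/
theorem exists_eq_cochain (W : AlgFiltration k Λ) {c : CoordIndex X.d → G → Λ}
    (hc : X.IsCoordCocycle hA ρ c) (hn : IsNormalized S c)
    (ht : ∀ i, c i ∈ tensorFunctions k G Λ) (hW : ∀ i g, c i g ∈ W.W i.1) :
    ∃ y : CoordIndex h → Λ, (∀ a, y a ∈ W.W a.1) ∧ c = cochain hA S y := by
  have ht' : ∀ n, (fun q : G × Fin (X.d n) => c ⟨n, q.2⟩ q.1) ∈
      tensorFunctions k (G × Fin (X.d n)) Λ := fun n =>
    mem_tensorFunctions_prod_fin fun j => ht ⟨n, j⟩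
  refine ⟨fun a => extend (S a.1).pi (fun q => c ⟨a.1, q.2⟩ q.1) a.2,
    fun a => extend_mem (fun q => hW ⟨a.1, q.2⟩ q.1) a.2, eq_cochain hA S hF hρ fun n θ => ?_⟩
  have h1 := continuous_of_mem_tensorFunctions (map_mem_tensorFunctions θ (ht' n))
  refine ((S n).eq_add _ h1 (hn n θ)).trans ?_
  rw [X.differential_of_isCoordCocycle hA hc]
  refine congrArg₂ _ rfl (Finset.sum_congr rfl fun a _ => ?_)
  rw [← isExtension_extend (S n).pi (ht' n) θ]

end Universal

end LogCoordinates

end Cochains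

/-! ### Gauge transformations -/

section Gauge

variable {k : Type*} [Field k]

/-- For `w` equal to `s` plus the coboundary of `v`, the cochain `w` is normalized exactly for one
`v`, namely minus the extension of `lam` applied to `s`. -/
theorem extend_lam_eq_neg_iff [TopologicalSpace k] [IsTopologicalRing k] {G : Type*} [Group G]
    [TopologicalSpace G] {d h : ℕ} {M : G → Matrix (Fin d) (Fin d) k}
    (S : CohomologySplitting M h) {Λ : Type*} [CommRing Λ] [Algebra k Λ] {s w : G × Fin d → Λ}
    (hs : s ∈ tensorFunctions k (G × Fin d) Λ) (v : Fin d → Λ)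
    (hw : ∀ q, w q = s q + ∑ l, M q.1 q.2 l • v l - v q.2) :
    extend S.lam s = (fun j => -v j) ↔
      ∀ θ : Module.Dual k Λ, S.lam (fun q => θ (w q)) = 0 := by
  have h1 : ∀ θ : Module.Dual k Λ, S.lam (fun q => θ (w q)) =
      S.lam (fun q => θ (s q)) + fun j => θ (v j) := by
    intro θ
    have h2 : (fun q => θ (w q)) = (fun q => θ (s q)) + vectorCoboundary M fun j => θ (v j) := by
      ext q
      simp only [hw, vectorCoboundary, map_add, map_sub, map_sum, map_smul, smul_eq_mul,
        Pi.add_apply, LinearMap.coe_mk, AddHom.coe_mk]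
      ring
    rw [h2, map_add, S.lam_coboundary]
  have h3 := isExtension_extend S.lam hs
  constructor
  · intro h θ
    rw [h1, ← h3 θ, h]
    ext j
    simp
  · intro h
    refine h3.unique fun θ => ?_
    have h4 := h θ
    rw [h1] at h4
    rw [eq_neg_of_add_eq_zero_left h4]
    ext j
    simp

variable [CharZero k] {A : Type u} [CommRing A]
  [HopfAlgebra k A] {F : GroupFiltration k A} {G : Type u} [Group G]

namespace LogCoordinates

variable (hA : IsProunipotent k A) {X : LogCoordinates F} {ρ : G →* (A →ₐc[k] A)}
  {Λ : Type*} [CommRing Λ] [Algebra k Λ]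

section

variable (X ρ)

/-- The relation `u · c'(g) = c(g) · g(u)` in coordinates. -/
def IsGauge (c : CoordIndex X.d → G → Λ) (u : CoordIndex X.d → Λ) (c' : CoordIndex X.d → G → Λ) :
    Prop :=
  ∀ g i, u i + c' i g + X.mulLow hA u (fun j => c' j g) i =
    c i g + X.actCoord ρ g u i + X.mulLow hA (fun j => c j g) (X.actCoord ρ g u) i

/-- The contribution of the components of smaller weight to the component of weight `n` of
`u⁻¹ · c(g) · g(u) = c'(g)`. -/
def gaugeLow (c : CoordIndex X.d → G → Λ) (u : CoordIndex X.d → Λ) (c' : CoordIndex X.d → G → Λ)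
    (n : ℕ+) (q : G × Fin (X.d n)) : Λ :=
  c ⟨n, q.2⟩ q.1 + X.actLow ρ q.1 u ⟨n, q.2⟩ +
    X.mulLow hA (fun j => c j q.1) (X.actCoord ρ q.1 u) ⟨n, q.2⟩ -
    X.mulLow hA u (fun j => c' j q.1) ⟨n, q.2⟩

end

/-- In every weight, the gauge relation is a linear change by the coboundary of the component of
`u`, up to terms of smaller weight. -/
theorem isGauge_iff {c : CoordIndex X.d → G → Λ} {u : CoordIndex X.d → Λ}
    {c' : CoordIndex X.d → G → Λ} : X.IsGauge hA ρ c u c' ↔ ∀ n (q : G × Fin (X.d n)),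
      c' ⟨n, q.2⟩ q.1 = X.gaugeLow hA ρ c u c' n q +
        ∑ l, X.levelMatrix ρ n q.1 q.2 l • u ⟨n, l⟩ - u ⟨n, q.2⟩ := by
  constructor
  · intro h n q
    have h1 := h q.1 ⟨n, q.2⟩
    rw [X.actCoord_eq] at h1
    unfold gaugeLow
    linear_combination h1
  · rintro h g ⟨n, j⟩
    have h1 := h n (g, j)
    rw [X.actCoord_eq]
    unfold gaugeLow at h1
    linear_combination h1

theorem gaugeLow_congr (c : CoordIndex X.d → G → Λ) {u v : CoordIndex X.d → Λ}
    {c' c'' : CoordIndex X.d → G → Λ} {n : ℕ+} (hu : ∀ j, j.1 < n → u j = v j)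
    (hc : ∀ j, j.1 < n → c' j = c'' j) :
    X.gaugeLow hA ρ c u c' n = X.gaugeLow hA ρ c v c'' n := by
  ext q
  unfold gaugeLow
  rw [X.actLow_congr ρ q.1 (i := ⟨n, q.2⟩) hu,
    X.mulLow_congr hA (i := ⟨n, q.2⟩) (fun _ _ => rfl) fun j hj =>
      X.actCoord_congr ρ q.1 fun l hl => hu l (lt_of_le_of_lt hl hj),
    X.mulLow_congr hA (i := ⟨n, q.2⟩) hu fun j hj => congrFun (hc j hj) q.1]

theorem gaugeLow_mem (W : AlgFiltration k Λ) {c : CoordIndex X.d → G → Λ} {u : CoordIndex X.d → Λ}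
    {c' : CoordIndex X.d → G → Λ} {n : ℕ+} (hc : ∀ i g, c i g ∈ W.W i.1)
    (hu : ∀ j, j.1 < n → u j ∈ W.W j.1) (hc' : ∀ j, j.1 < n → ∀ g, c' j g ∈ W.W j.1)
    (q : G × Fin (X.d n)) : X.gaugeLow hA ρ c u c' n q ∈ W.W n := by
  refine sub_mem (add_mem (add_mem (hc ⟨n, q.2⟩ _) (X.actLow_mem ρ W (i := ⟨n, q.2⟩) _ hu)) ?_)
    (X.mulLow_mem hA W (i := ⟨n, q.2⟩) hu fun j hj => hc' j hj _)
  exact X.mulLow_mem hA W (i := ⟨n, q.2⟩) (fun j _ => hc j _) fun j hj =>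
    X.actCoord_mem ρ W _ fun l hl => hu l (lt_of_le_of_lt hl hj)

variable [TopologicalSpace k] [IsTopologicalRing k] [TopologicalSpace G]
  (hF : F.IsStable ρ) (hρ : IsContinuousAction ρ)

include hF hρ in
theorem gaugeLow_mem_tensorFunctions {c : CoordIndex X.d → G → Λ} {u : CoordIndex X.d → Λ}
    {c' : CoordIndex X.d → G → Λ} {n : ℕ+} (hc : ∀ i, c i ∈ tensorFunctions k G Λ)
    (hc' : ∀ j, j.1 < n → c' j ∈ tensorFunctions k G Λ) :
    X.gaugeLow hA ρ c u c' n ∈ tensorFunctions k (G × Fin (X.d n)) Λ := by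
  refine mem_tensorFunctions_prod_fin fun j => ?_
  have h1 := X.actLow_mem_tensorFunctions hA hF hρ (i := ⟨n, j⟩)
    (a := fun j (_ : G) => u j) (τ := id) continuous_id
    fun j _ => const_mem_tensorFunctions (u j)
  have h2 := X.mulLow_mem_tensorFunctions hA (i := ⟨n, j⟩) (a := c)
    (b := fun j (g : G) => X.actCoord ρ g u j) (fun j _ => hc j) fun j _ =>
      X.actCoord_mem_tensorFunctions hA hF hρ (a := fun j (_ : G) => u j)
        (τ := id) continuous_id fun l _ => const_mem_tensorFunctions (u l)
  have h3 := X.mulLow_mem_tensorFunctions hA (i := ⟨n, j⟩) (a := fun j (_ : G) => u j) (b := c')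
    (fun j _ => const_mem_tensorFunctions (u j)) hc'
  exact sub_mem (add_mem (add_mem (hc ⟨n, j⟩) h1) h2) h3

variable {h : ℕ+ → ℕ} (S : ∀ n, CohomologySplitting (X.levelMatrix ρ n) (h n))

/-- The recursion that determines a gauge transformation `u` and the normalized cochain
`c' = u⁻¹ · c · g(u)` for a given cochain `c`. -/
def gaugeStep (c : CoordIndex X.d → G → Λ) (p : CoordIndex X.d → Λ × (G → Λ)) (i : CoordIndex X.d) :
    Λ × (G → Λ) :=
  let s := X.gaugeLow hA ρ c (fun j => (p j).1) (fun j => (p j).2) i.1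
  let v := fun j => -extend (S i.1).lam s j
  (v i.2, fun g => s (g, i.2) + ∑ l, X.levelMatrix ρ i.1 g i.2 l • v l - v i.2)

omit [IsTopologicalRing k] in
theorem gaugeStep_congr (c : CoordIndex X.d → G → Λ) (p p' : CoordIndex X.d → Λ × (G → Λ))
    (i : CoordIndex X.d) (h : ∀ j, j.1 < i.1 → p j = p' j) :
    gaugeStep hA S c p i = gaugeStep hA S c p' i := by
  unfold gaugeStep
  rw [gaugeLow_congr hA c (fun j hj => congrArg Prod.fst (h j hj))
    fun j hj => congrArg Prod.snd (h j hj)]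

include hF hρ

/-- A gauge transformation `u` into a normalized cochain, together with this cochain, is a fixed
point of `gaugeStep`. -/
theorem gaugeStep_eq {c : CoordIndex X.d → G → Λ} {u : CoordIndex X.d → Λ}
    {c' : CoordIndex X.d → G → Λ} (hc : ∀ i, c i ∈ tensorFunctions k G Λ)
    (hc' : ∀ i, c' i ∈ tensorFunctions k G Λ) (hg : X.IsGauge hA ρ c u c') (hn : IsNormalized S c') :
    gaugeStep hA S c (fun i => (u i, c' i)) = fun i => (u i, c' i) := by
  have hg' := (isGauge_iff hA).1 hg
  ext1 ⟨n, j⟩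
  have h1 := (extend_lam_eq_neg_iff (S n)
    (gaugeLow_mem_tensorFunctions hA hF hρ hc fun j _ => hc' j) (fun j => u ⟨n, j⟩)
    (hg' n)).2 (hn n)
  refine Prod.ext ?_ (funext fun g => ?_)
  · simp [gaugeStep, h1]
  · simp only [gaugeStep, h1, neg_neg]
    exact (hg' n (g, j)).symm

/-- At most one gauge transform of a given cochain is normalized. -/
theorem isGauge_unique {c : CoordIndex X.d → G → Λ} {u v : CoordIndex X.d → Λ}
    {c' c'' : CoordIndex X.d → G → Λ} (hc : ∀ i, c i ∈ tensorFunctions k G Λ)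
    (hc' : ∀ i, c' i ∈ tensorFunctions k G Λ) (hg : X.IsGauge hA ρ c u c') (hn : IsNormalized S c')
    (hc'' : ∀ i, c'' i ∈ tensorFunctions k G Λ) (hg' : X.IsGauge hA ρ c v c'')
    (hn' : IsNormalized S c'') : c' = c'' := by
  have h1 := fixedPoint_unique (gaugeStep_congr hA S c) (gaugeStep_eq hA hF hρ S hc hc' hg hn)
    (gaugeStep_eq hA hF hρ S hc hc'' hg' hn')
  exact funext fun i => congrArg Prod.snd (congrFun h1 i)

/-- Every continuous filtered cochain has a gauge transform that is normalized. -/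
theorem exists_isGauge (W : AlgFiltration k Λ) {c : CoordIndex X.d → G → Λ}
    (hc : ∀ i, c i ∈ tensorFunctions k G Λ) (hW : ∀ i g, c i g ∈ W.W i.1) :
    ∃ (u : CoordIndex X.d → Λ) (c' : CoordIndex X.d → G → Λ), X.IsGauge hA ρ c u c' ∧
      IsNormalized S c' ∧ (∀ i, c' i ∈ tensorFunctions k G Λ) ∧ (∀ i, u i ∈ W.W i.1) ∧
      ∀ i g, c' i g ∈ W.W i.1 := by
  obtain ⟨p, hp⟩ := exists_fixedPoint (gaugeStep_congr hA S c)
  let u := fun i => (p i).1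
  let c' := fun i => (p i).2
  have hu : ∀ n, extend (S n).lam (X.gaugeLow hA ρ c u c' n) = fun j => -u ⟨n, j⟩ := by
    intro n
    ext j
    have h1 := congrArg Prod.fst (congrFun hp ⟨n, j⟩)
    change -extend (S n).lam (X.gaugeLow hA ρ c u c' n) j = u ⟨n, j⟩ at h1
    rw [← h1, neg_neg]
  have hc' : ∀ n (q : G × Fin (X.d n)), c' ⟨n, q.2⟩ q.1 = X.gaugeLow hA ρ c u c' n q +
        ∑ l, X.levelMatrix ρ n q.1 q.2 l • u ⟨n, l⟩ - u ⟨n, q.2⟩ := by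
    intro n q
    have h1 := congrFun (congrArg Prod.snd (congrFun hp ⟨n, q.2⟩)) q.1
    refine h1.symm.trans ?_
    change X.gaugeLow hA ρ c u c' n q + ∑ l, X.levelMatrix ρ n q.1 q.2 l •
      -extend (S n).lam (X.gaugeLow hA ρ c u c' n) l -
      -extend (S n).lam (X.gaugeLow hA ρ c u c' n) q.2 = _
    simp only [hu, neg_neg]
  have ht : ∀ i, c' i ∈ tensorFunctions k G Λ := by
    intro i
    induction i using weight_induction with
    | h i ih =>
      have h1 := gaugeLow_mem_tensorFunctions hA (u := u) hF hρ hc ih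
      have h2 : c' i = (fun g => X.gaugeLow hA ρ c u c' i.1 (g, i.2)) +
          ∑ l, (fun g => X.levelMatrix ρ i.1 g i.2 l • u ⟨i.1, l⟩) - fun _ => u i := by
        ext g
        simpa [Finset.sum_apply] using hc' i.1 (g, i.2)
      rw [h2]
      refine sub_mem (add_mem (comp_mem_tensorFunctions h1 (τ := fun g => (g, i.2)) (by fun_prop))
        (sum_mem fun l _ => smul_mem_tensorFunctions
          (X.continuous_actMatrix hA hF hρ ⟨i.1, i.2⟩ ⟨i.1, l⟩ le_rfl) _)) (const_mem_tensorFunctions _)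
  have hmem : ∀ i, u i ∈ W.W i.1 ∧ ∀ g, c' i g ∈ W.W i.1 := by
    intro i
    induction i using weight_induction with
    | h i ih =>
      have h1 := gaugeLow_mem hA (ρ := ρ) W hW (fun j hj => (ih j hj).1) fun j hj => (ih j hj).2
      have h2 : ∀ j, u ⟨i.1, j⟩ ∈ W.W i.1 := fun j => by
        have h3 := extend_mem (L := (S i.1).lam) h1 j
        rw [hu] at h3
        exact neg_mem_iff.1 h3
      refine ⟨h2 i.2, fun g => ?_⟩
      rw [show c' i g = _ from hc' i.1 (g, i.2)]
      exact sub_mem (add_mem (h1 _) (sum_mem fun l _ => Submodule.smul_mem _ _ (h2 l))) (h2 _)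
  refine ⟨u, c', (isGauge_iff hA).2 hc', fun n => ?_, ht, fun i => (hmem i).1, fun i => (hmem i).2⟩
  exact (extend_lam_eq_neg_iff (S n) (gaugeLow_mem_tensorFunctions hA hF hρ hc fun j _ => ht j)
    (fun j => u ⟨n, j⟩) (hc' n)).1 (hu n)

end LogCoordinates

end Gauge

/-! ### Cocycles in coordinates -/

section Cocycles

variable {k : Type*} [Field k] {A : Type u} [CommRing A]
  [HopfAlgebra k A] {F : GroupFiltration k A} {G : Type u} [Group G]

section

variable {Λ : Type*} [CommRing Λ] [Algebra k Λ]

theorem mul_pointInv (u : WithConv (A →ₐ[k] Λ)) : u * pointInv u = 1 :=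
  calc u * pointInv u = pointInv (pointInv u) * pointInv u * (u * pointInv u) := by
        rw [pointInv_mul, one_mul]
    _ = pointInv (pointInv u) * (pointInv u * u) * pointInv u := by simp only [mul_assoc]
    _ = 1 := by rw [pointInv_mul, mul_one, pointInv_mul]

theorem actPoint_mul (ρ : G →* (A →ₐc[k] A)) (g : G) (u v : WithConv (A →ₐ[k] Λ)) :
    actPoint ρ g (u * v) = actPoint ρ g u * actPoint ρ g v :=
  WithConv.ofConv_injective (AlgHom.convMul_comp_bialgHom_distrib u v (ρ g⁻¹))

theorem actPoint_one (ρ : G →* (A →ₐc[k] A)) (g : G) :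
    actPoint ρ g (1 : WithConv (A →ₐ[k] Λ)) = 1 := by
  apply WithConv.ofConv_injective
  refine AlgHom.ext fun a => ?_
  simp [actPoint, AlgHom.convOne_def]

theorem actPoint_actPoint (ρ : G →* (A →ₐc[k] A)) (g g' : G) (u : WithConv (A →ₐ[k] Λ)) :
    actPoint ρ g (actPoint ρ g' u) = actPoint ρ (g * g') u := by
  apply WithConv.ofConv_injective
  refine AlgHom.ext fun a => ?_
  simp [actPoint]

/-- A gauge transform of a cocycle is a cocycle. -/
theorem cocycle_of_gauge {ρ : G →* (A →ₐc[k] A)} {u : WithConv (A →ₐ[k] Λ)}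
    {ξ ξ' : G → WithConv (A →ₐ[k] Λ)} (hξ : ∀ g g', ξ (g * g') = ξ g * actPoint ρ g (ξ g'))
    (h : ∀ g, u * ξ' g = ξ g * actPoint ρ g u) (g g' : G) :
    ξ' (g * g') = ξ' g * actPoint ρ g (ξ' g') := by
  have h1 : u * ξ' (g * g') = u * (ξ' g * actPoint ρ g (ξ' g')) := by
    rw [h, hξ, ← actPoint_actPoint, mul_assoc, ← actPoint_mul, ← h, actPoint_mul, ← mul_assoc,
      ← h, mul_assoc]
  have h2 := congrArg (pointInv u * ·) h1
  simpa only [← mul_assoc, pointInv_mul, one_mul] using h2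

theorem gauge_trans {ρ : G →* (A →ₐc[k] A)} {ξ ξ' ξ'' : G → WithConv (A →ₐ[k] Λ)}
    {u v : WithConv (A →ₐ[k] Λ)}
    (hu : ∀ g, u * ξ' g = ξ g * actPoint ρ g u)
    (hv : ∀ g, v * ξ'' g = ξ' g * actPoint ρ g v) (g : G) :
    u * v * ξ'' g = ξ g * actPoint ρ g (u * v) := by
  rw [mul_assoc, hv, ← mul_assoc, hu, mul_assoc, actPoint_mul]

/-- The relation of being cohomologous without inverses. -/
theorem cohomologous_iff {ρ : G →* (A →ₐc[k] A)} {W : AlgFiltration k A} {Λ : FiltAlg.{u} k}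
    [TopologicalSpace k] [TopologicalSpace G] {ξ ξ' : Cocycle ρ W Λ} :
    Cohomologous ξ ξ' ↔ ∃ u : WithConv (A →ₐ[k] Λ), IsFiltered W Λ.fil u.ofConv ∧
      ∀ g, u * ξ'.toFun g = ξ.toFun g * actPoint ρ g u := by
  refine exists_congr fun u => and_congr_right fun _ => forall_congr' fun g => ?_
  constructor
  · intro h
    rw [h, ← mul_assoc, ← mul_assoc, mul_pointInv, one_mul]
  · intro h
    rw [mul_assoc, ← h, ← mul_assoc, pointInv_mul, one_mul]

end

namespace LogCoordinates

variable (hA : IsProunipotent k A) (X : LogCoordinates F) {ρ : G →* (A →ₐc[k] A)}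

section

variable {Λ : Type*} [CommRing Λ] [Algebra k Λ]

include hA in
theorem actPoint_x (hF : F.IsStable ρ) (g : G) (u : WithConv (A →ₐ[k] Λ)) :
    (fun i => actPoint ρ g u (X.x i)) = X.actCoord ρ g fun i => u (X.x i) :=
  funext fun i => X.actPoint_apply_x hA hF g u i

variable [CharZero k]

theorem isCoordCocycle_iff (hF : F.IsStable ρ) (ξ : G → WithConv (A →ₐ[k] Λ)) :
    X.IsCoordCocycle hA ρ (fun i g => ξ g (X.x i)) ↔
      ∀ g g', ξ (g * g') = ξ g * actPoint ρ g (ξ g') := by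
  have h1 : ∀ g g' i, (ξ g * actPoint ρ g (ξ g')) (X.x i) =
      ξ g (X.x i) + X.actCoord ρ g (fun j => ξ g' (X.x j)) i +
        X.mulLow hA (fun j => ξ g (X.x j)) (X.actCoord ρ g fun j => ξ g' (X.x j)) i := by
    intro g g' i
    rw [X.mul_apply_x hA, ← X.actPoint_x hA hF]
    rfl
  constructor
  · intro h g g'
    exact X.point_ext hA fun i => (h g g' i).trans (h1 g g' i).symm
  · intro h g g' i
    change ξ (g * g') (X.x i) = _
    rw [h, h1]

theorem isGauge_iff_mul (hF : F.IsStable ρ) (ξ ξ' : G → WithConv (A →ₐ[k] Λ))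
    (u : WithConv (A →ₐ[k] Λ)) :
    X.IsGauge hA ρ (fun i g => ξ g (X.x i)) (fun i => u (X.x i)) (fun i g => ξ' g (X.x i)) ↔
      ∀ g, u * ξ' g = ξ g * actPoint ρ g u := by
  have h1 : ∀ g i, (ξ g * actPoint ρ g u) (X.x i) =
      ξ g (X.x i) + X.actCoord ρ g (fun j => u (X.x j)) i +
        X.mulLow hA (fun j => ξ g (X.x j)) (X.actCoord ρ g fun j => u (X.x j)) i := by
    intro g i
    rw [X.mul_apply_x hA, ← X.actPoint_x hA hF]
    rfl
  refine forall_congr' fun g => ⟨fun h => X.point_ext hA fun i => ?_, fun h i => ?_⟩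
  · rw [h1, X.mul_apply_x hA]
    exact h i
  · have h2 := congrArg (fun v => v (X.x i)) h
    simp only [h1, X.mul_apply_x hA] at h2
    exact h2

end

variable [TopologicalSpace k] [TopologicalSpace G] {Λ : FiltAlg.{u} k}

/-- The coordinates of a cocycle. -/
def coord (ξ : Cocycle ρ F.algFiltration Λ) (i : CoordIndex X.d) (g : G) : Λ := ξ.toFun g (X.x i)

include hA in
theorem coord_injective : Function.Injective
    (X.coord : Cocycle ρ F.algFiltration Λ → CoordIndex X.d → G → Λ) := by
  intro ξ ξ' h
  exact Cocycle.ext (funext fun g => X.point_ext hA fun i => congrFun (congrFun h i) g)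

include hA in
theorem coord_mem (ξ : Cocycle ρ F.algFiltration Λ) (i : CoordIndex X.d) (g : G) :
    X.coord ξ i g ∈ Λ.fil.W i.1 :=
  (X.isFiltered_iff hA Λ.fil _).1 (ξ.filtered g) i

variable [CharZero k]

theorem isCoordCocycle_coord (hF : F.IsStable ρ) (ξ : Cocycle ρ F.algFiltration Λ) :
    X.IsCoordCocycle hA ρ (X.coord ξ) :=
  (X.isCoordCocycle_iff hA hF _).2 ξ.map_mul

/-- The cohomology relation in coordinates. -/
theorem cohomologous_iff_isGauge (hF : F.IsStable ρ) {ξ ξ' : Cocycle ρ F.algFiltration Λ} :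
    Cohomologous ξ ξ' ↔ ∃ u : CoordIndex X.d → Λ, (∀ i, u i ∈ Λ.fil.W i.1) ∧
      X.IsGauge hA ρ (X.coord ξ) u (X.coord ξ') := by
  rw [cohomologous_iff]
  constructor
  · rintro ⟨u, hu, h⟩
    exact ⟨fun i => u (X.x i), (X.isFiltered_iff hA _ _).1 hu, (X.isGauge_iff_mul hA hF _ _ _).2 h⟩
  · rintro ⟨u, hu, h⟩
    have hx : (fun i => X.point hA u (X.x i)) = u := funext fun i => X.point_apply_x hA u i
    refine ⟨X.point hA u, (X.isFiltered_iff hA _ _).2 fun i => ?_,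
      (X.isGauge_iff_mul hA hF ξ.toFun ξ'.toFun _).1 (by rwa [hx])⟩
    have := hu i
    rwa [← X.point_apply_x hA u i] at this

variable [IsTopologicalRing k]

omit [Group G] [CharZero k] in
include hA in
/-- The coordinate ring is generated by the coordinates, so continuity can be tested on them. -/
theorem continuous_iff_mem_tensorFunctions [T1Space k] [CompactSpace G]
    (f : G → WithConv (A →ₐ[k] Λ)) :
    @Continuous _ _ _ (pointTopology A Λ (finiteTopology k Λ)) f ↔
      ∀ i, (fun g => f g (X.x i)) ∈ tensorFunctions k G Λ := by
  rw [continuous_point_iff]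
  constructor
  · intro h i
    exact mem_tensorFunctions_of_continuous (h _)
  · intro h a
    refine continuous_finiteTopology_of_mem ?_
    obtain ⟨P, rfl⟩ := X.aeval_x_surjective hA a
    convert aeval_mem_tensorFunctions (c := fun g i => f g (X.x i)) P fun i _ => h i using 1
    ext g
    exact DFunLike.congr_fun (MvPolynomial.comp_aeval X.x (f g).ofConv) P

omit [CharZero k] in
include hA in
theorem coord_mem_tensorFunctions [T1Space k] [CompactSpace G] (ξ : Cocycle ρ F.algFiltration Λ)
    (i : CoordIndex X.d) : X.coord ξ i ∈ tensorFunctions k G Λ :=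
  (X.continuous_iff_mem_tensorFunctions hA _).1 ξ.continuous i

/-- A cocycle with values in `U(Λ)` is the same as a continuous filtered family of coordinate
functions that satisfies the cocycle relation in coordinates. -/
theorem exists_cocycle [T1Space k] [CompactSpace G] (hF : F.IsStable ρ) {c : CoordIndex X.d → G → Λ}
    (hc : X.IsCoordCocycle hA ρ c) (ht : ∀ i, c i ∈ tensorFunctions k G Λ)
    (hW : ∀ i g, c i g ∈ Λ.fil.W i.1) :
    ∃ ξ : Cocycle ρ F.algFiltration Λ, X.coord ξ = c := by
  have hx : (fun i g => X.point hA (fun j => c j g) (X.x i)) = c := by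
    ext i g
    exact X.point_apply_x hA _ i
  refine ⟨⟨fun g => X.point hA fun j => c j g, fun g => (X.isFiltered_iff hA _ _).2 fun i => ?_,
    (X.continuous_iff_mem_tensorFunctions hA _).2 fun i => ?_,
    (X.isCoordCocycle_iff hA hF _).1 (by rwa [hx])⟩, hx⟩
  · have := hW i g
    rwa [← X.point_apply_x hA (fun j => c j g) i] at this
  · rw [show (fun g => X.point hA (fun j => c j g) (X.x i)) = c i from congrFun hx i]
    exact ht i

variable {X} [T1Space k] [CompactSpace G] {h : ℕ+ → ℕ}
  (S : ∀ n, CohomologySplitting (X.levelMatrix ρ n) (h n)) (hF : F.IsStable ρ)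
  (hρ : IsContinuousAction ρ)

include hA hF hρ

/-- Every class in `H¹(G, U(Λ))` contains a normalized cocycle. -/
theorem exists_normalized (ξ : Cocycle ρ F.algFiltration Λ) :
    ∃ ξ' : Cocycle ρ F.algFiltration Λ, Cohomologous ξ ξ' ∧ IsNormalized S (X.coord ξ') := by
  obtain ⟨u, c', hg, hn, ht, hu, hW⟩ := exists_isGauge hA hF hρ S Λ.fil
    (X.coord_mem_tensorFunctions hA ξ) (X.coord_mem hA ξ)
  have hc' : X.IsCoordCocycle hA ρ c' := by
    have hx : (fun i g => X.point hA (fun j => c' j g) (X.x i)) = c' := by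
      ext i g
      exact X.point_apply_x hA _ i
    have hx' : (fun i => X.point hA u (X.x i)) = u := funext fun i => X.point_apply_x hA u i
    have h1 := (X.isGauge_iff_mul hA hF ξ.toFun (fun g => X.point hA fun j => c' j g)
      (X.point hA u)).1 (by rwa [hx, hx'])
    rw [← hx, X.isCoordCocycle_iff hA hF]
    exact cocycle_of_gauge ξ.map_mul h1
  obtain ⟨ξ', rfl⟩ := X.exists_cocycle hA hF hc' ht hW
  exact ⟨ξ', (X.cohomologous_iff_isGauge hA hF).2 ⟨u, hu, hg⟩, hn⟩

/-- Every class in `H¹(G, U(Λ))` contains at most one normalized cocycle. -/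
theorem eq_of_normalized {ξ ξ' : Cocycle ρ F.algFiltration Λ}
    (hξ : IsNormalized S (X.coord ξ)) (hξ' : IsNormalized S (X.coord ξ'))
    (h : (Quot.mk Cohomologous ξ) = Quot.mk Cohomologous ξ') : ξ = ξ' := by
  -- the normal form `N ξ` is constant on classes and fixes normalized cocycles
  choose N hN hN' using exists_normalized (Λ := Λ) hA S hF hρ
  have huniq : ∀ {ξ ξ' ξ'' : Cocycle ρ F.algFiltration Λ} {u v : WithConv (A →ₐ[k] Λ)},
    (∀ g, u * ξ'.toFun g = ξ.toFun g * actPoint ρ g u) →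
    (∀ g, v * ξ''.toFun g = ξ.toFun g * actPoint ρ g v) →
    IsNormalized S (X.coord ξ') → IsNormalized S (X.coord ξ'') → ξ' = ξ'' := by
    intro ξ ξ' ξ'' u v hu hv hn hn'
    refine X.coord_injective hA ?_
    exact isGauge_unique hA hF hρ S (X.coord_mem_tensorFunctions hA ξ)
      (X.coord_mem_tensorFunctions hA ξ') ((X.isGauge_iff_mul hA hF _ _ u).2 hu) hn
      (X.coord_mem_tensorFunctions hA ξ'') ((X.isGauge_iff_mul hA hF _ _ v).2 hv) hn'
  have hlift : ∀ ξ ξ', Cohomologous ξ ξ' → N ξ = N ξ' := by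
    intro ξ ξ' h
    obtain ⟨u, -, hu⟩ := cohomologous_iff.1 h
    obtain ⟨v, -, hv⟩ := cohomologous_iff.1 (hN ξ')
    obtain ⟨w, -, hw⟩ := cohomologous_iff.1 (hN ξ)
    exact huniq hw (gauge_trans hu hv) (hN' _) (hN' _)
  have hfix : ∀ ξ, IsNormalized S (X.coord ξ) → N ξ = ξ := by
    intro ξ hn
    obtain ⟨w, -, hw⟩ := cohomologous_iff.1 (hN ξ)
    refine huniq (u := w) (v := 1) hw (fun g => ?_) (hN' _) hn
    rw [one_mul, actPoint_one, mul_one]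
  rw [← hfix ξ hξ, ← hfix ξ' hξ']
  exact congrArg (Quot.lift N hlift) h

end LogCoordinates

end Cocycles

/-! ### Representability -/

section Representability

/-- The image of a filtration under a homomorphism of algebras. -/
def AlgFiltration.map {k : Type*} [Field k] {A B : Type*} [CommRing A] [Algebra k A] [CommRing B]
    [Algebra k B] (F : AlgFiltration k A) (φ : A →ₐ[k] B) : AlgFiltration k B where
  W i := (F.W i).map φ.toLinearMap
  mono i j hij := Submodule.map_mono (F.mono hij)
  one_mem := ⟨1, F.one_mem, map_one φ⟩
  mul_mem := by
    rintro i j _ _ ⟨x, hx, rfl⟩ ⟨y, hy, rfl⟩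
    exact ⟨x * y, F.mul_mem hx hy, map_mul φ x y⟩

variable {k : Type*} [Field k] [CharZero k]
  {A : Type u} [CommRing A] [HopfAlgebra k A] {F : GroupFiltration k A} {G : Type u} [Group G]

namespace LogCoordinates

variable (hA : IsProunipotent k A) {X : LogCoordinates F} {ρ : G →* (A →ₐc[k] A)}

/-- The point with all coordinates `0` is the identity, so the correction term of the group law
vanishes there. -/
theorem mulLow_zero {Λ : Type*} [CommRing Λ] [Algebra k Λ] (i : CoordIndex X.d) :
    X.mulLow hA (0 : CoordIndex X.d → Λ) 0 i = 0 := by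
  have h1 : (fun i => (1 : WithConv (A →ₐ[k] Λ)) (X.x i)) = 0 := by
    ext i
    have h2 : Coalgebra.counit (R := k) (X.x i) = 0 := X.counit_x hA i
    rw [AlgHom.convOne_apply, h2, map_zero]
    rfl
  have h3 := X.mul_apply_x hA (1 : WithConv (A →ₐ[k] Λ)) 1 i
  rw [mul_one, h1] at h3
  rw [congrFun h1 i] at h3
  rw [Pi.zero_apply, add_zero, zero_add] at h3
  exact h3.symm

theorem isCoordCocycle_zero {Λ : Type*} [CommRing Λ] [Algebra k Λ] :
    X.IsCoordCocycle hA ρ (0 : CoordIndex X.d → G → Λ) := by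
  intro g g' i
  have h1 : X.actCoord ρ g (fun j => (0 : CoordIndex X.d → G → Λ) j g') = 0 := by
    ext i
    simp [actCoord]
  rw [h1]
  have := mulLow_zero (Λ := Λ) hA (X := X) i
  change (0 : Λ) = 0 + 0 + X.mulLow hA 0 0 i
  rw [this, add_zero, add_zero]

omit [CharZero k] in
include hA in
theorem coord_trivialCocycle [TopologicalSpace k] [TopologicalSpace G] (Λ : FiltAlg.{u} k) :
    X.coord (trivialCocycle ρ F.algFiltration Λ) = 0 := by
  ext i g
  have h2 : Coalgebra.counit (R := k) (X.x i) = 0 := X.counit_x hA i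
  change (1 : WithConv (A →ₐ[k] Λ)) (X.x i) = 0
  rw [AlgHom.convOne_apply, h2, map_zero]

variable [TopologicalSpace k] [TopologicalSpace G] {h : ℕ+ → ℕ}
  (S : ∀ n, CohomologySplitting (X.levelMatrix ρ n) (h n))
  [IsTopologicalRing k] (hF : F.IsStable ρ) (hρ : IsContinuousAction ρ)

include hF hρ in
theorem cochain_zero {Λ : Type*} [CommRing Λ] [Algebra k Λ] :
    cochain hA S (0 : CoordIndex h → Λ) = 0 := by
  refine (eq_cochain hA S hF hρ fun n θ => ?_).symm
  rw [← X.differential_of_isCoordCocycle hA (isCoordCocycle_zero hA)]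
  have h1 : (fun q : G × Fin (X.d n) => θ ((0 : CoordIndex X.d → G → Λ) ⟨n, q.2⟩ q.1)) = 0 := by
    ext q
    simp
  rw [h1]
  simp

/-- The relations that make the normalized cochain with coordinates `y` a cocycle. -/
def cocycleIdeal {B : Type*} [CommRing B] [Algebra k B] (y : CoordIndex h → B) : Ideal B :=
  Ideal.span (Set.range fun q : G × G × CoordIndex X.d =>
    cochain hA S y q.2.2 (q.1 * q.2.1) -
      (cochain hA S y q.2.2 q.1 + X.actCoord ρ q.1 (fun j => cochain hA S y j q.2.1) q.2.2 +
        X.mulLow hA (fun j => cochain hA S y j q.1)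
          (X.actCoord ρ q.1 fun j => cochain hA S y j q.2.1) q.2.2))

include hF hρ in
/-- A point of the affine space lies on the closed subscheme if and only if its cochain is a
cocycle. -/
theorem cocycleIdeal_le_ker_iff {B : Type*} [CommRing B] [Algebra k B] (y : CoordIndex h → B)
    {Λ : Type*} [CommRing Λ] [Algebra k Λ] (f : B →ₐ[k] Λ) :
    cocycleIdeal hA S y ≤ RingHom.ker f ↔
      X.IsCoordCocycle hA ρ (cochain hA S fun a => f (y a)) := by
  rw [cocycleIdeal, Ideal.span_le, ← map_cochain hA S hF hρ]
  have h1 : ∀ g g' i, f (cochain hA S y i g + X.actCoord ρ g (fun j => cochain hA S y j g') i +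
      X.mulLow hA (fun j => cochain hA S y j g)
        (X.actCoord ρ g fun j => cochain hA S y j g') i) =
      f (cochain hA S y i g) + X.actCoord ρ g (fun j => f (cochain hA S y j g')) i +
      X.mulLow hA (fun j => f (cochain hA S y j g))
        (X.actCoord ρ g fun j => f (cochain hA S y j g')) i := by
    intro g g' i
    have h2 : ∀ i, f (X.actCoord ρ g (fun j => cochain hA S y j g') i) =
        X.actCoord ρ g (fun j => f (cochain hA S y j g')) i :=
      fun i => X.map_actCoord ρ f.toLinearMap g _ i
    rw [map_add, map_add, X.map_mulLow hA, h2]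
    simp only [h2]
  constructor
  · intro h g g' i
    have h2 := h ⟨(g, g', i), rfl⟩
    rw [SetLike.mem_coe, RingHom.mem_ker, map_sub, sub_eq_zero] at h2
    exact h2.trans (h1 g g' i)
  · rintro h _ ⟨⟨g, g', i⟩, rfl⟩
    rw [SetLike.mem_coe, RingHom.mem_ker, map_sub, sub_eq_zero]
    exact (h g g' i).trans (h1 g g' i).symm

include hA hF hρ S in
/-- The functor `Λ ↦ H¹(G, U(Λ))` is represented by the closed subscheme, defined by the cocycle
relations, of the affine space that parametrizes the normalized cochains. -/
theorem exists_representing [T1Space k] [CompactSpace G] {B : Type u} [CommRing B] [Algebra k B]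
    (WB : AlgFiltration k B) (y : CoordIndex h → B)
    (hfree : ∀ {Λ : Type u} [CommRing Λ] [Algebra k Λ] (z : CoordIndex h → Λ),
      ∃ f : B →ₐ[k] Λ, ∀ a, f (y a) = z a)
    (hext : ∀ {Λ : Type u} [CommRing Λ] [Algebra k Λ] {f f' : B →ₐ[k] Λ},
      (∀ a, f (y a) = f' (y a)) → f = f')
    (hfil : ∀ {Λ : Type u} [CommRing Λ] [Algebra k Λ] (W : AlgFiltration k Λ) (f : B →ₐ[k] Λ),
      IsFiltered WB W f ↔ ∀ a, f (y a) ∈ W.W a.1)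
    (ε : B →ₐ[k] k) (hε : ∀ a, ε (y a) = 0) :
    ∃ Z : PointedFiltAffine.{u} k, Nonempty (Z.points ≅ nonabelianH1 ρ F.algFiltration) ∧
      ∃ φ : B →ₐ[k] Z.ring, IsClosedSubscheme WB Z.ring.fil φ := by
  let I := cocycleIdeal hA S y
  let q : B →ₐ[k] B ⧸ I := Ideal.Quotient.mkₐ k I
  -- the origin of the affine space lies on the subscheme: its cochain is the trivial cocycle
  have hεI : I ≤ RingHom.ker ε := by
    rw [cocycleIdeal_le_ker_iff hA S hF hρ]
    have h1 : (fun a => ε (y a)) = 0 := funext hε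
    rw [h1, cochain_zero hA S hF hρ]
    exact isCoordCocycle_zero hA
  let Z : PointedFiltAffine.{u} k :=
    ⟨⟨B ⧸ I, WB.map q⟩, Ideal.Quotient.liftₐ I ε fun a ha => hεI ha⟩
  let r (Λ : FiltAlg.{u} k) (f : Z.ring ⟶ Λ) : B →ₐ[k] Λ := f.toAlgHom.comp q
  have hr : ∀ (Λ : FiltAlg.{u} k) (f : Z.ring ⟶ Λ) a, r Λ f (y a) ∈ Λ.fil.W a.1 := fun Λ f a =>
    f.filtered _ _ ⟨y a, (hfil WB (AlgHom.id k B)).1 (fun _ _ hx => hx) a, rfl⟩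
  have hker : ∀ (Λ : FiltAlg.{u} k) (f : Z.ring ⟶ Λ), I ≤ RingHom.ker (r Λ f) := fun Λ f b hb => by
    change f.toAlgHom (q b) = 0
    rw [show q b = 0 from Ideal.Quotient.eq_zero_iff_mem.2 hb, map_zero]
  have hN : ∀ (Λ : FiltAlg.{u} k) (f : Z.ring ⟶ Λ), ∃ ξ : Cocycle ρ F.algFiltration Λ,
      X.coord ξ = cochain hA S fun a => r Λ f (y a) := fun Λ f =>
    X.exists_cocycle hA hF ((cocycleIdeal_le_ker_iff hA S hF hρ y _).1 (hker Λ f))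
      (cochain_mem_tensorFunctions hA S hF hρ _) (cochain_mem hA S Λ.fil (hr Λ f))
  choose N hN using hN
  -- the point `f` corresponds to the class of the normalized cocycle `N Λ f`
  have hbij : ∀ Λ : FiltAlg.{u} k, Function.Bijective fun f : Z.ring ⟶ Λ =>
      Quot.mk (Cohomologous (ρ := ρ) (W := F.algFiltration)) (N Λ f) := by
    intro Λ
    constructor
    · intro f f' hff
      have h1 : N Λ f = N Λ f' := eq_of_normalized hA S hF hρ
        (by rw [hN]; exact isNormalized_cochain hA S hF hρ _)
        (by rw [hN]; exact isNormalized_cochain hA S hF hρ _) hff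
      have h2 := cochain_injective hA S hF hρ ((hN Λ f).symm.trans ((congrArg X.coord h1).trans (hN Λ f')))
      have h3 : r Λ f = r Λ f' := hext fun a => congrFun h2 a
      apply FiltAlg.Hom.ext
      refine AlgHom.ext fun b => ?_
      obtain ⟨b, rfl⟩ := Ideal.Quotient.mk_surjective b
      exact DFunLike.congr_fun h3 b
    · intro c
      obtain ⟨ξ, rfl⟩ := Quot.exists_rep c
      obtain ⟨ξ', hξ, hn⟩ := exists_normalized hA S hF hρ ξ
      obtain ⟨z, hz, hc⟩ := exists_eq_cochain hA S hF hρ Λ.fil (X.isCoordCocycle_coord hA hF ξ') hn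
        (X.coord_mem_tensorFunctions hA ξ') (X.coord_mem hA ξ')
      obtain ⟨f, hf⟩ := hfree z
      have hfz : (fun a => f (y a)) = z := funext hf
      have hfI : I ≤ RingHom.ker f := by
        rw [cocycleIdeal_le_ker_iff hA S hF hρ, hfz, ← hc]
        exact X.isCoordCocycle_coord hA hF ξ'
      have hff : IsFiltered WB Λ.fil f := (hfil _ _).2 fun a => by rw [hf]; exact hz a
      let f' : Z.ring ⟶ Λ := ⟨Ideal.Quotient.liftₐ I f fun a ha => hfI ha, by
        rintro i _ ⟨b, hb, rfl⟩
        exact hff i b hb⟩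
      refine ⟨f', ?_⟩
      have h1 : N Λ f' = ξ' := by
        refine X.coord_injective hA ?_
        rw [hN, hc, ← hfz]
        rfl
      change Quot.mk _ (N Λ f') = _
      rw [h1]
      exact (Quot.sound hξ).symm
  have hpt : ∀ Λ : FiltAlg.{u} k, N Λ (Z.basePoint Λ) = trivialCocycle ρ F.algFiltration Λ := by
    intro Λ
    refine X.coord_injective hA ?_
    rw [hN, coord_trivialCocycle hA]
    have h1 : (fun a => r Λ (Z.basePoint Λ) (y a)) = 0 := by
      ext a
      change algebraMap k Λ (ε (y a)) = 0
      rw [hε, map_zero]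
    rw [h1, cochain_zero hA S hF hρ]
  have hnat : ∀ (Λ Λ' : FiltAlg.{u} k) (t : Λ ⟶ Λ') (f : Z.ring ⟶ Λ),
      N Λ' (f ≫ t) = (N Λ f).map t := by
    intro Λ Λ' t f
    refine X.coord_injective hA ?_
    rw [hN]
    have h1 : X.coord ((N Λ f).map t) = fun i g => t.toAlgHom (X.coord (N Λ f) i g) := rfl
    rw [h1, hN, map_cochain hA S hF hρ]
    rfl
  refine ⟨Z, ⟨NatIso.ofComponents (fun Λ => Pointed.Iso.mk (Equiv.ofBijective _ (hbij Λ))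
    (congrArg (Quot.mk _) (hpt Λ))) fun {Λ Λ'} t => ?_⟩, q, Ideal.Quotient.mk_surjective, fun _ => rfl⟩
  apply Pointed.Hom.ext
  funext f
  exact congrArg (Quot.mk _) (hnat Λ Λ' t f)

end LogCoordinates

end Representability

/-! ### Coordinates on products of vector groups -/

section VectorGroups

variable {k : Type*} [Field k] {M : ℕ → Type*} [∀ n, AddCommGroup (M n)] [∀ n, Module k (M n)]
  [∀ n : ℕ+, FiniteDimensional k (M n)]

/-- The linear coordinates on `∏ M n` with respect to bases of the vector spaces `M n`. -/
def linearCoord (k : Type*) [Field k] (M : ℕ → Type*) [∀ n, AddCommGroup (M n)]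
    [∀ n, Module k (M n)] [∀ n : ℕ+, FiniteDimensional k (M n)]
    (i : CoordIndex fun n => Module.finrank k (M n)) : ProdVectorRing k M :=
  SymmetricAlgebra.ι k _ (DirectSum.lof k ℕ+ (fun n : ℕ+ => Module.Dual k (M n)) i.1
    ((Module.finBasis k (M i.1)).coord i.2))

theorem dual_eq_sum (n : ℕ+) (l : Module.Dual k (M n)) :
    l = ∑ a, l (Module.finBasis k (M n) a) • (Module.finBasis k (M n)).coord a :=
  (Module.finBasis k (M n)).ext fun b => by
    simp

theorem ι_lof_eq_sum (n : ℕ+) (l : Module.Dual k (M n)) :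
    SymmetricAlgebra.ι k _ (DirectSum.lof k ℕ+ (fun n : ℕ+ => Module.Dual k (M n)) n l) =
      ∑ a, l (Module.finBasis k (M n) a) • linearCoord k M ⟨n, a⟩ := by
  conv_lhs => rw [dual_eq_sum n l]
  simp only [map_sum, map_smul]
  rfl

theorem linearCoord_algHom_ext {Λ : Type*} [CommRing Λ] [Algebra k Λ]
    {f f' : ProdVectorRing k M →ₐ[k] Λ} (h : ∀ a, f (linearCoord k M a) = f' (linearCoord k M a)) :
    f = f' := by
  refine SymmetricAlgebra.algHom_ext (DirectSum.linearMap_ext _ fun n => LinearMap.ext fun l => ?_)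
  change f (SymmetricAlgebra.ι k _ _) = f' (SymmetricAlgebra.ι k _ _)
  rw [ι_lof_eq_sum]
  simp only [map_sum, map_smul, h]

theorem exists_linearCoord_algHom {Λ : Type*} [CommRing Λ] [Algebra k Λ]
    (z : (CoordIndex fun n => Module.finrank k (M n)) → Λ) :
    ∃ f : ProdVectorRing k M →ₐ[k] Λ, ∀ a, f (linearCoord k M a) = z a := by
  let t : ∀ n : ℕ+, Module.Dual k (M n) →ₗ[k] Λ := fun n =>
    { toFun := fun l => ∑ a, l (Module.finBasis k (M n) a) • z ⟨n, a⟩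
      map_add' := fun l l' => by simp [add_smul, Finset.sum_add_distrib]
      map_smul' := fun r l => by simp [mul_smul, Finset.smul_sum] }
  refine ⟨SymmetricAlgebra.lift (DirectSum.toModule k ℕ+ Λ t), fun a => ?_⟩
  rw [linearCoord, SymmetricAlgebra.lift_ι_apply, DirectSum.toModule_lof]
  simp [t, Finsupp.single_apply]

theorem linearCoord_mem (a : CoordIndex fun n => Module.finrank k (M n)) :
    linearCoord k M a ∈ (prodVectorFiltration k M).W a.1 :=
  Submodule.subset_span ⟨[((a.1 : ℕ), linearCoord k M a)], fun q hq => by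
      rw [List.mem_singleton.1 hq]
      exact ⟨a.1, _, rfl, rfl⟩,
    by simp, by simp⟩

theorem isFiltered_prodVectorFiltration_iff {Λ : Type*} [CommRing Λ] [Algebra k Λ]
    (W : AlgFiltration k Λ) (f : ProdVectorRing k M →ₐ[k] Λ) :
    IsFiltered (prodVectorFiltration k M) W f ↔ ∀ a, f (linearCoord k M a) ∈ W.W a.1 := by
  constructor
  · intro h a
    exact h _ _ (linearCoord_mem a)
  · intro h i
    refine (Submodule.span_le (p := (W.W i).comap f.toLinearMap)).2 ?_
    rintro _ ⟨l, hl, hle, rfl⟩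
    refine W.mono hle ?_
    change f (l.map Prod.snd).prod ∈ _
    clear hle
    induction l with
    | nil => simpa using W.one_mem
    | cons q l ih =>
      simp only [List.map_cons, List.prod_cons, map_mul, List.sum_cons]
      refine W.mul_mem ?_ (ih fun q hq => hl q (by simp [hq]))
      obtain ⟨n, t, h1, h2⟩ := hl q (by simp)
      rw [h1, h2, ι_lof_eq_sum, map_sum]
      exact sum_mem fun a _ => by
        rw [map_smul]
        exact Submodule.smul_mem _ _ (h ⟨n, a⟩)

/-- Every step of the filtration is the sum of the previous step and the polynomials that are
homogeneous for the weights. -/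
theorem prodVectorFiltration_le (i : ℕ) : (prodVectorFiltration k M).W i ≤
    (MvPolynomial.weightedHomogeneousSubmodule k
      (fun a : CoordIndex fun n => Module.finrank k (M n) => (a.1 : ℕ)) i).map
      (MvPolynomial.aeval (linearCoord k M)).toLinearMap ⊔ (prodVectorFiltration k M).prev i := by
  refine Submodule.span_le.2 ?_
  rintro _ ⟨l, hl, hle, rfl⟩
  rcases hle.lt_or_eq with hlt | heq
  · refine Submodule.mem_sup_right ?_
    cases i with
    | zero => omega
    | succ i => exact Submodule.subset_span ⟨l, hl, Nat.lt_succ_iff.1 hlt, rfl⟩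
  · refine Submodule.mem_sup_left ?_
    rw [← heq]
    clear hle heq
    induction l with
    | nil => exact ⟨1, MvPolynomial.isWeightedHomogeneous_one k _, by simp⟩
    | cons q l ih =>
      obtain ⟨P, hP, hP'⟩ := ih fun q hq => hl q (by simp [hq])
      obtain ⟨n, t, h1, h2⟩ := hl q (by simp)
      simp only [List.map_cons, List.prod_cons, List.sum_cons]
      rw [h1]
      refine ⟨(∑ a, MvPolynomial.C (t (Module.finBasis k (M n) a)) * MvPolynomial.X ⟨n, a⟩) * P,
        MvPolynomial.IsWeightedHomogeneous.mul ?_ hP, ?_⟩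
      · refine MvPolynomial.IsWeightedHomogeneous.sum _ _ _ fun a _ => ?_
        have h3 := (MvPolynomial.isWeightedHomogeneous_C
          (fun a : CoordIndex fun n => Module.finrank k (M n) => (a.1 : ℕ))
          (t (Module.finBasis k (M n) a))).mul
          (MvPolynomial.isWeightedHomogeneous_X k _ ⟨n, a⟩)
        rw [zero_add] at h3
        exact h3
      · rw [← hP', h2, ι_lof_eq_sum]
        simp [Algebra.smul_def]

end VectorGroups

/-! ### Hilbert series -/

section HilbertSeries

variable {k : Type*} [Field k]

/-- The rank of a subquotient is at most the number of elements that generate `S` modulo `T`. -/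
theorem rank_subquotient_le {E : Type*} [AddCommGroup E] [Module k E] {S T : Submodule k E}
    {κ : Type*} (s : Finset κ) (v : κ → E) (h : S ≤ Submodule.span k (v '' s) ⊔ T) :
    Cardinal.toENat (Module.rank k (Subquotient S T)) ≤ s.card := by
  classical
  let f : S ⧸ T.submoduleOf S →ₗ[k] E ⧸ T := (T.submoduleOf S).mapQ T S.subtype le_rfl
  have hf : Function.Injective f := by
    rw [← LinearMap.ker_eq_bot, LinearMap.ker_eq_bot']
    intro x hx
    obtain ⟨x, rfl⟩ := Submodule.Quotient.mk_surjective _ x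
    exact (Submodule.Quotient.mk_eq_zero _).2 ((Submodule.Quotient.mk_eq_zero T).1 hx)
  let b : Finset (E ⧸ T) := s.image fun e => T.mkQ (v e)
  have hrange : ∀ x, f x ∈ Submodule.span k (b : Set (E ⧸ T)) := by
    intro x
    obtain ⟨x, rfl⟩ := Submodule.Quotient.mk_surjective _ x
    obtain ⟨y, hy, t, ht, hyt⟩ := Submodule.mem_sup.1 (h x.2)
    have h1 : f (Submodule.Quotient.mk x) = T.mkQ y := by
      change T.mkQ x.1 = _
      rw [← hyt, map_add, (Submodule.Quotient.mk_eq_zero T (x := t)).2 ht |> fun h => (h : T.mkQ t = 0),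
        add_zero]
    rw [h1]
    have h2 : (b : Set (E ⧸ T)) = T.mkQ '' (v '' s) := by
      rw [Finset.coe_image, ← Set.image_comp]
      rfl
    rw [h2, Submodule.span_image]
    exact ⟨y, hy, rfl⟩
  have h1 : Module.rank k (Subquotient S T) ≤ (s.card : Cardinal) := by
    refine (LinearMap.rank_le_of_injective (f.codRestrict _ hrange) ?_).trans ?_
    · intro x y hxy
      exact hf (congrArg Subtype.val hxy)
    · refine (rank_span_finset_le b).trans ?_
      exact_mod_cast Finset.card_image_le
  refine (OrderHomClass.mono Cardinal.toENat h1).trans ?_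
  simp

/-- The indices of weight at most `i`. -/
def indicesUpTo (h : ℕ+ → ℕ) (i : ℕ) : Finset (CoordIndex h) :=
  ((Finset.range i).image Nat.succPNat).sigma fun _ => Finset.univ

theorem mem_image_succPNat {n : ℕ+} {i : ℕ} :
    n ∈ (Finset.range i).image Nat.succPNat ↔ (n : ℕ) ≤ i := by
  rw [Finset.mem_image]
  constructor
  · rintro ⟨m, hm, rfl⟩
    exact Finset.mem_range.1 hm
  · intro h
    have h1 := n.pos
    exact ⟨n.natPred, Finset.mem_range.2 (by rw [PNat.natPred]; omega), PNat.succPNat_natPred n⟩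

theorem mem_indicesUpTo {h : ℕ+ → ℕ} {i : ℕ} {a : CoordIndex h} :
    a ∈ indicesUpTo h i ↔ (a.1 : ℕ) ≤ i := by
  rw [indicesUpTo, Finset.mem_sigma, mem_image_succPNat]
  simp

/-- The exponents of the monomials of weight `i`, multiplied by the weights of the variables. -/
def scaledExponents (h : ℕ+ → ℕ) (i : ℕ) : Finset (CoordIndex h →₀ ℕ) :=
  (Finset.finsuppAntidiag (indicesUpTo h i) i).filter
    fun l => ∀ a ∈ indicesUpTo h i, (a.1 : ℕ) ∣ l a

/-- The coefficients of the product count the monomials by weight. -/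
theorem card_scaledExponents (d : ℕ → ℕ) (i : ℕ) :
    ((scaledExponents (fun n => d n) i).card : ℕ∞) = PowerSeries.coeff i (eulerProduct d) := by
  have h1 : ∏ n ∈ Finset.Icc 1 i, geomSeries n ^ d n =
      ∏ a ∈ indicesUpTo (fun n => d n) i, geomSeries a.1 := by
    rw [indicesUpTo, Finset.prod_sigma]
    refine (Finset.prod_nbij (fun n : ℕ+ => (n : ℕ)) (fun n hn => ?_) (fun _ _ _ _ => PNat.eq)
      (fun n hn => ?_) fun n _ => ?_).symm
    · exact Finset.mem_Icc.2 ⟨n.pos, mem_image_succPNat.1 hn⟩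
    · have h2 := Finset.mem_Icc.1 hn
      exact ⟨⟨n, h2.1⟩, mem_image_succPNat.2 h2.2, rfl⟩
    · simp
  rw [eulerProduct, PowerSeries.coeff_mk, h1, PowerSeries.coeff_prod]
  simp only [geomSeries, PowerSeries.coeff_mk, Finset.prod_ite_zero, Finset.prod_const_one]
  rw [Finset.sum_boole]
  rfl

/-- A filtration on `R` induced from the polynomial ring with variables of positive weights has a
graded ring spanned in degree `i` by the monomials of weight `i`. -/
theorem hilbertSeries_le (M : ℕ → Type*) [∀ n, AddCommGroup (M n)] [∀ n, Module k (M n)]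
    [∀ n : ℕ+, FiniteDimensional k (M n)] {R : Type*} [CommRing R] [Algebra k R]
    (W : AlgFiltration k R) (φ : ProdVectorRing k M →ₐ[k] R)
    (hφ : IsClosedSubscheme (prodVectorFiltration k M) W φ) :
    SeriesLE W.hilbertSeries (eulerProduct fun n => Module.finrank k (M n)) := by
  intro m
  refine Finset.sum_le_sum fun i _ => ?_
  rw [← card_scaledExponents, AlgFiltration.hilbertSeries, PowerSeries.coeff_mk]
  let h : ℕ+ → ℕ := fun n => Module.finrank k (M n)
  -- the monomial that corresponds to the scaled exponents `l`
  let v : (CoordIndex h →₀ ℕ) → ProdVectorRing k M := fun l =>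
    ∏ a ∈ indicesUpTo h i, linearCoord k M a ^ (l a / a.1)
  have hv : (MvPolynomial.weightedHomogeneousSubmodule k (fun a : CoordIndex h => (a.1 : ℕ)) i).map
      (MvPolynomial.aeval (linearCoord k M)).toLinearMap ≤
      Submodule.span k (v '' scaledExponents h i) := by
    rintro _ ⟨P, hP, rfl⟩
    change MvPolynomial.aeval (linearCoord k M) P ∈ _
    rw [MvPolynomial.aeval_def, MvPolynomial.eval₂_eq]
    refine sum_mem fun s hs => ?_
    rw [← Algebra.smul_def]
    refine Submodule.smul_mem _ _ (Submodule.subset_span ?_)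
    have hw : Finsupp.weight (fun a : CoordIndex h => (a.1 : ℕ)) s = i :=
      hP (MvPolynomial.mem_support_iff.1 hs)
    rw [Finsupp.weight_apply, Finsupp.sum] at hw
    simp only [smul_eq_mul] at hw
    have hsupp : s.support ⊆ indicesUpTo h i := by
      intro a ha
      rw [mem_indicesUpTo, ← hw]
      have h1 := Finset.single_le_sum (f := fun a => s a * (a.1 : ℕ)) (fun _ _ => Nat.zero_le _) ha
      exact (Nat.le_mul_of_pos_left _ (Nat.pos_of_ne_zero (Finsupp.mem_support_iff.1 ha))).trans h1
    let l : CoordIndex h →₀ ℕ := Finsupp.onFinset s.support (fun a => s a * a.1) fun a ha =>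
      Finsupp.mem_support_iff.2 (left_ne_zero_of_mul ha)
    refine ⟨l, ?_, ?_⟩
    · refine Finset.mem_filter.2 ⟨Finset.mem_finsuppAntidiag.2 ⟨?_, ?_⟩, fun a _ => ⟨s a, ?_⟩⟩
      · refine Eq.trans ?_ hw
        refine (Finset.sum_subset (f := fun a => s a * (a.1 : ℕ)) hsupp fun a _ ha => ?_).symm
        rw [Finsupp.notMem_support_iff.1 ha, zero_mul]
      · exact Finsupp.support_onFinset_subset.trans hsupp
      · exact mul_comm _ _
    · have h2 : ∀ a, l a / (a.1 : ℕ) = s a := fun a => by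
        rw [show l a = s a * a.1 from rfl, Nat.mul_div_cancel _ a.1.pos]
      simp only [v, h2]
      refine (Finset.prod_subset hsupp fun a _ ha => ?_).symm
      rw [Finsupp.notMem_support_iff.1 ha, pow_zero]
  refine rank_subquotient_le (scaledExponents h i) (fun l => φ (v l)) ?_
  rw [hφ.2 i]
  refine (Submodule.map_mono ((prodVectorFiltration_le i).trans (sup_le_sup_right hv _))).trans ?_
  rw [Submodule.map_sup, Submodule.map_span, ← Set.image_comp]
  refine sup_le_sup le_rfl ?_
  cases i with
  | zero => exact (Submodule.map_bot φ.toLinearMap).le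
  | succ i => exact (hφ.2 i).ge

end HilbertSeries

end WeightFiltration

end

open WeightFiltration in
theorem mainTheorem10 (p : ℕ) [Fact p.Prime]
    (G : Type u) [Group G] [TopologicalSpace G] [IsTopologicalGroup G] [CompactSpace G]
    [TotallyDisconnectedSpace G]
    (A : Type u) [CommRing A] [HopfAlgebra ℚ_[p] A] (hA : IsProunipotent ℚ_[p] A)
    (ρ : G →* (A →ₐc[ℚ_[p]] A)) (hρ : IsContinuousAction ρ)
    (F : GroupFiltration ℚ_[p] A) (hF : F.IsStable ρ) (hsep : F.IsSeparated)
    (hcodim : F.FiniteCodim)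
    (hH0 : ∀ n, 1 ≤ n → (F.rep hF n).invariants = ⊥)
    (hH1 : ∀ n, 1 ≤ n → FiniteDimensional ℚ_[p] (ContH1 (F.rep hF n))) :
    ∃ X : PointedFiltAffine.{u} ℚ_[p],
      Nonempty (X.points ≅ nonabelianH1 ρ F.algFiltration) ∧
      (∃ φ : ProdVectorRing ℚ_[p] (fun n => ContH1 (F.rep hF n)) →ₐ[ℚ_[p]] X.ring,
        IsClosedSubscheme (prodVectorFiltration ℚ_[p] fun n => ContH1 (F.rep hF n))
          X.ring.fil φ) ∧
      SeriesLE X.ring.fil.hilbertSeries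
        (eulerProduct fun n => Module.finrank ℚ_[p] (ContH1 (F.rep hF n))) := by
  obtain ⟨X⟩ := hA.nonempty_logCoordinates F hsep hcodim
  have hfin : ∀ n : ℕ+, FiniteDimensional ℚ_[p] (ContH1 (F.rep hF n)) := fun n => hH1 n n.pos
  have S := fun n : ℕ+ =>
    (X.nonempty_splitting hA hρ hF n (hH0 n n.pos) (hfin n)).some
  obtain ⟨ε, hε⟩ := exists_linearCoord_algHom (k := ℚ_[p])
    (M := fun n => ContH1 (F.rep hF n)) (Λ := ℚ_[p]) 0
  obtain ⟨Z, hZ, φ, hφ⟩ := LogCoordinates.exists_representing hA S hF hρ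
    (prodVectorFiltration ℚ_[p] fun n => ContH1 (F.rep hF n))
    (linearCoord ℚ_[p] fun n => ContH1 (F.rep hF n))
    (fun z => exists_linearCoord_algHom (k := ℚ_[p]) (M := fun n => ContH1 (F.rep hF n)) z)
    (fun h => linearCoord_algHom_ext (k := ℚ_[p]) (M := fun n => ContH1 (F.rep hF n)) h)
    (fun W f => isFiltered_prodVectorFiltration_iff (k := ℚ_[p]) (M := fun n => ContH1 (F.rep hF n)) W f) ε hε
  exact ⟨Z, hZ, ⟨φ, hφ⟩, hilbertSeries_le (fun n => ContH1 (F.rep hF n)) _ φ hφ⟩
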